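/- **Lemma 5.2.** *Setting.* Let $\Gamma\subset S^3$ be a finite, connected graph with at least one edge. Its edges are smoothly embedded closed arcs that meet only in vertices, the edges incident to a given vertex have distinct tangent rays there, and each vertex has even valency. Let $\mathcal I\to S^3-\Gamma$ be a real line bundle with a fiber metric whose restriction to each linking circle of $\Gamma$ is the Möbius bundle. (A linking circle is an embedded circle in $S^3-\Gamma$ bounding an embedded disk in $S^3$ that meets $\Gamma$ in exactly one point, an interior point of an edge, and transversally.) Let $\mathbb V\to S^3$ be a real or complex vector bundle of positive rank with a Euclidean or Hermitian fiber metric and a metric compatible connection, and let $\mathcal R$ be (the extension to $\mathbb V\otimes\mathcal I$ of) a symmetric or Hermitian endomorphism of $\mathbb V$; all of these are smooth. The connection $\nabla$ on $\mathbb V\otimes\mathcal I$ is the one for which $\nabla(v\otimes u)=(\nabla v)\otimes u$ for every local section $u$ of $\mathcal I$ with $|u|=1$. Let $\mathbb H$ and $\mathbb L$ be the completions of the space $C^\infty_c(S^3-\Gamma;\mathbb V\otimes\mathcal I)$ of smooth, compactly supported sections in the norms with squares $\int_{S^3-\Gamma}|\nabla\psi|^2$ and $\int_{S^3-\Gamma}|\psi|^2$,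 for the round metric. A $(\nabla^\dagger\nabla+\mathcal R)$-*eigensection* in $\mathbb H$ is a non-zero $\psi\in\mathbb H$ for which there is $\mathtt E\in\mathbb R$ with $$\int\langle\nabla\eta,\nabla\psi\rangle+\int\langle\eta,\mathcal R\psi\rangle=\mathtt E\int\langle\eta,\psi\rangle\qquad\text{for all }\eta\in\mathbb H .$$ Let $G$ be a finite subgroup of $\mathrm{SO}(4)$ that maps $\Gamma$ to itself. Assume that 1. the action of $G$ on $S^3-\Gamma$ lifts to a smooth, fiberwise linear, isometric action on $\mathbb V\otimes\mathcal I$: there are isometric isomorphisms $\delta_g:g^*(\mathbb V\otimes\mathcal I)\to\mathbb V\otimes\mathcal I$ for $g\in G$ with $\delta_g\circ\delta_{g'}=\delta_{g'g}$, so that $g$ maps a section $s$ to the section $gs: x\mapsto\delta_g\,s(g(x))$; 2. the operator $\nabla^\dagger\nabla+\mathcal R$ on sections of $\mathbb V\otimes\mathcal I$ is $G$-equivariant. *Claim.* The identity of $C^\infty_c(S^3-\Gamma;\mathbb V\otimes\mathcal I)$ extends to a bounded linear map $\mathbb H\to\mathbb L$. There is a countably infinite set of $G$-invariant $(\nabla^\dagger\nabla+\mathcal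 R)$-eigensections in $\mathbb H$ which is $\mathbb L$-orthonormal and whose closed linear span in $\mathbb L$ is the subspace of all $G$-invariant elements of $\mathbb L$. (Here an element of $\mathbb H$ is $G$-invariant if its image in $\mathbb L$ is.) The case where $\mathbb V$ is the product $\mathbb R$-bundle with its product connection and $\mathcal R=0$, with $G$ acting on $\mathbb{V}\otimes\mathcal I=\mathcal I$ through a lift to $\mathcal I$, is the corresponding statement for the Laplacian on sections of $\mathcal I$ (Lemma 5.1). -/

import Mathlib

open scoped Manifold ContDiff TensorProduct Topology InnerProductSpace
open Bundle MeasureTheory Set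

noncomputable section

set_option linter.unusedSectionVars false

namespace TwistedSphere

/-! ### The round three-sphere -/

/-- Euclidean four-space. -/
abbrev E4 : Type := EuclideanSpace ℝ (Fin 4)

/-- The unit sphere `S³ ⊂ ℝ⁴`, with Mathlib's structure of a smooth manifold. -/
abbrev S3 : Type := Metric.sphere (0 : E4) 1

instance factFinrankE4 : Fact (Module.finrank ℝ E4 = 3 + 1) := ⟨by simp⟩

/-- The surface measure of the round metric on `S³`. -/
def surfaceMeasure : Measure S3 := (volume : Measure E4).toSphere

/-- The radial projection `ℝ⁴ ∖ 0 → S³` (with an irrelevant value at `0`). -/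
def radial (y : E4) : S3 :=
  if h : y = 0 then ⟨EuclideanSpace.single 0 1, by simp⟩
  else ⟨‖y‖⁻¹ • y, by simp [norm_smul, h]⟩

/-- The orthogonal projection `ℝ⁴ → T_x S³`, that is, the differential at `x` of the radial
projection; see `mvfderiv_coe_tangentProj`. -/
def tangentProj (x : S3) : E4 →L[ℝ] TangentSpace (𝓡 3) x :=
  mfderiv 𝓘(ℝ, E4) (𝓡 3) radial (x : E4)

lemma coe_radial {y : E4} (hy : y ≠ 0) : (radial y : E4) = ‖y‖⁻¹ • y := by
  simp [radial, hy]

lemma S3.ne_zero (x : S3) : (x : E4) ≠ 0 := by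
  have h : ‖(x : E4)‖ = 1 := by simp
  intro h0
  simp [h0] at h

lemma radial_coe (x : S3) : radial (x : E4) = x := by
  apply Subtype.ext
  have h : ‖(x : E4)‖ = 1 := by simp
  rw [coe_radial (S3.ne_zero x), h]
  simp

lemma contMDiffAt_radial {y : E4} (hy : y ≠ 0) : ContMDiffAt 𝓘(ℝ, E4) (𝓡 3) ∞ radial y := by
  let W : TopologicalSpace.Opens E4 := ⟨{z | z ≠ 0}, isOpen_ne⟩
  have h1 : ContMDiff 𝓘(ℝ, E4) 𝓘(ℝ, E4) ∞ (fun z : W => ‖(z : E4)‖⁻¹ • (z : E4)) := by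
    intro z
    have hz : ContDiffAt ℝ ∞ (fun w : E4 => ‖w‖⁻¹ • w) (z : E4) :=
      ((contDiffAt_norm ℝ z.2).inv (norm_ne_zero_iff.2 z.2)).smul contDiffAt_id
    exact (contMDiffAt_subtype_iff (U := W) (f := fun w : E4 => ‖w‖⁻¹ • w)).2 hz.contMDiffAt
  have h2 := h1.codRestrict_sphere (n := 3) (fun z => by
    have hz : ‖(z : E4)‖ ≠ 0 := norm_ne_zero_iff.2 z.2
    simp [norm_smul, hz])
  have h3 : ContMDiffAt 𝓘(ℝ, E4) (𝓡 3) ∞ (fun z : W => radial (z : E4)) ⟨y, hy⟩ := by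
    refine (h2 ⟨y, hy⟩).congr_of_eventuallyEq (Filter.Eventually.of_forall fun z => ?_)
    apply Subtype.ext
    simp [coe_radial z.2]
  exact contMDiffAt_subtype_iff.1 h3

/-- `tangentProj x` is the orthogonal projection of `ℝ⁴` onto the tangent space at `x`, when the
latter is regarded as a subspace of `ℝ⁴`. -/
lemma mvfderiv_coe_tangentProj (x : S3) (v : E4) :
    mvfderiv (𝓡 3) (fun y : S3 => (y : E4)) x (tangentProj x v)
      = v - (inner ℝ (x : E4) v) • (x : E4) := by
  have hx := S3.ne_zero x
  have hn : ‖(x : E4)‖ = 1 := by simp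
  have h1 : MDifferentiableAt 𝓘(ℝ, E4) (𝓡 3) radial (x : E4) :=
    (contMDiffAt_radial hx).mdifferentiableAt (by simp)
  have h2 : MDifferentiableAt (𝓡 3) 𝓘(ℝ, E4) (fun y : S3 => (y : E4)) (radial (x : E4)) :=
    (contMDiff_coe_sphere (m := 1) _).mdifferentiableAt one_ne_zero
  have h3 := mfderiv_comp (x : E4) h2 h1
  have h4 : ((fun y : S3 => (y : E4)) ∘ radial) =ᶠ[𝓝 (x : E4)] fun w : E4 => ‖w‖⁻¹ • w := by
    filter_upwards [isOpen_ne.mem_nhds hx] with z hz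
    exact coe_radial hz
  have h5 : HasFDerivAt (fun w : E4 => ‖w‖⁻¹ • w)
      (ContinuousLinearMap.id ℝ E4 - (innerSL ℝ (x : E4)).smulRight (x : E4)) (x : E4) := by
    have hN : HasFDerivAt (fun w : E4 => ‖w‖) (innerSL ℝ (x : E4)) (x : E4) := by
      have h6 := (hasStrictFDerivAt_norm_sq (x : E4)).hasFDerivAt.sqrt (by simp)
      refine (h6.congr_fderiv ?_).congr_of_eventuallyEq (Filter.Eventually.of_forall fun z => ?_)
      · ext w
        simp [hn]
      · simp
    have h7 := (((hasDerivAt_inv (x := ‖(x : E4)‖) (by simp)).comp_hasFDerivAt _ hN).smul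
      (hasFDerivAt_id (𝕜 := ℝ) (x : E4)))
    refine h7.congr_fderiv ?_
    ext1 w
    simp [sub_eq_add_neg]
  rw [h4.mfderiv_eq, mfderiv_eq_fderiv, h5.fderiv] at h3
  have h8 := congrArg (fun L : E4 →L[ℝ] E4 => L v) h3
  have hr : radial (x : E4) = x := radial_coe x
  have key : ∀ y : S3, y = x → ∀ w : EuclideanSpace ℝ (Fin 3),
      (mfderiv (𝓡 3) 𝓘(ℝ, E4) (fun y : S3 => (y : E4)) y : _ →L[ℝ] E4) w
        = (mfderiv (𝓡 3) 𝓘(ℝ, E4) (fun y : S3 => (y : E4)) x : _ →L[ℝ] E4) w := by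
    rintro _ rfl w
    rfl
  exact (key _ hr _).symm.trans h8.symm

lemma contMDiff_tangentProj (v : E4) :
    ContMDiff (𝓡 3) (𝓡 3).tangent ∞
      (fun x : S3 => (TotalSpace.mk' (EuclideanSpace ℝ (Fin 3)) x (tangentProj x v) :
        TangentBundle (𝓡 3) S3)) := by
  have h1 : ContMDiffOn 𝓘(ℝ, E4) (𝓡 3) ∞ radial {y : E4 | y ≠ 0} :=
    fun y hy => (contMDiffAt_radial hy).contMDiffWithinAt
  have h2 := h1.contMDiffOn_tangentMapWithin (m := ∞) (by simp) isOpen_ne.uniqueMDiffOn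
  have h3 : ContMDiff (𝓡 3) 𝓘(ℝ, E4).tangent ∞
      (fun x : S3 => (TotalSpace.mk' E4 (x : E4) v : TangentBundle 𝓘(ℝ, E4) E4)) := by
    have h4 : ContMDiff 𝓘(ℝ, E4) 𝓘(ℝ, E4).tangent ∞
        (fun x : E4 => (TotalSpace.mk' E4 x v : TangentBundle 𝓘(ℝ, E4) E4)) :=
      contMDiff_vectorSpace_iff_contDiff.2 contDiff_const
    exact h4.comp contMDiff_coe_sphere
  intro x
  have h5 := (h2.comp_contMDiff h3 (fun x => S3.ne_zero x)) x
  refine h5.congr_of_eventuallyEq (Filter.Eventually.of_forall fun z => ?_)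
  have hz : radial (z : E4) = z := radial_coe z
  have h6 : mfderivWithin 𝓘(ℝ, E4) (𝓡 3) radial {y : E4 | y ≠ 0} (z : E4)
      = mfderiv 𝓘(ℝ, E4) (𝓡 3) radial (z : E4) :=
    mfderivWithin_of_isOpen isOpen_ne (S3.ne_zero z)
  have key : ∀ y : S3, y = z → ∀ w : EuclideanSpace ℝ (Fin 3),
      (⟨z, w⟩ : TangentBundle (𝓡 3) S3) = ⟨y, w⟩ := by
    rintro _ rfl w
    rfl
  refine (key _ hz _).trans ?_
  simp only [Function.comp, tangentMapWithin, h6, tangentProj]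
  rfl

/-- The bilinear form `∑ᵢ ⟨A Pᵢ, B Pᵢ⟩` over the projections `Pᵢ` of the four coordinate vectors
equals the same sum over any orthonormal basis of the tangent space. -/
lemma sum_tangentProj_eq {𝕜 W : Type*} [RCLike 𝕜] [NormedAddCommGroup W] [InnerProductSpace 𝕜 W]
    [NormedSpace ℝ W] [IsScalarTower ℝ 𝕜 W]
    (x : S3) (A B : TangentSpace (𝓡 3) x →ₗ[ℝ] W) (e : Fin 3 → TangentSpace (𝓡 3) x)
    (he : Orthonormal ℝ
      (fun j => mvfderiv (𝓡 3) (fun y : S3 => (y : E4)) x (e j))) :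
    ∑ i : Fin 4, inner 𝕜 (A (tangentProj x (EuclideanSpace.single i 1)))
        (B (tangentProj x (EuclideanSpace.single i 1)))
      = ∑ j : Fin 3, inner 𝕜 (A (e j)) (B (e j)) := by
  obtain ⟨f, hf⟩ : ∃ f : Fin 3 → E4,
      ∀ j, mvfderiv (𝓡 3) (fun y : S3 => (y : E4)) x (e j) = f j := ⟨_, fun _ => rfl⟩
  replace he : Orthonormal ℝ f := by
    convert he using 1
    exact (funext hf).symm
  have hn : ‖(x : E4)‖ = 1 := by simp
  have hperp : ∀ j, inner ℝ (x : E4) (f j) = 0 := by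
    intro j
    have h1 := range_mvfderiv_subtypeVal (n := 3) x
    have h2 : f j ∈ (ℝ ∙ (x : E4))ᗮ := by
      rw [← h1]
      exact ⟨e j, hf j⟩
    exact Submodule.mem_orthogonal_singleton_iff_inner_right.1 h2
  let b : Fin 4 → E4 := Fin.cons (x : E4) f
  have hb : Orthonormal ℝ b := by
    rw [orthonormal_iff_ite]
    intro i j
    have h3 := orthonormal_iff_ite.1 he
    refine Fin.cases ?_ (fun i => ?_) i <;> refine Fin.cases ?_ (fun j => ?_) j
    · simp [b]
    · simpa [b, Fin.succ_ne_zero, (Fin.succ_ne_zero _).symm] using hperp j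
    · simpa [b, Fin.succ_ne_zero, (Fin.succ_ne_zero _).symm, real_inner_comm] using hperp i
    · have h4 := h3 i j
      simp only [b, Fin.cons_succ, Fin.succ_inj, h4]
  let B4 : OrthonormalBasis (Fin 4) ℝ E4 :=
    OrthonormalBasis.mk hb (by
      rw [hb.linearIndependent.span_eq_top_of_card_eq_finrank' (by simp)])
  have hB4 : ∀ i, B4 i = b i := fun i => by simp [B4]
  have hexp : ∀ v : E4, tangentProj x v = ∑ j, (inner ℝ (f j) v : ℝ) • e j := by
    intro v
    apply injective_mvfderiv_subtypeVal_sphere (n := 3) x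
    have h4 := mvfderiv_coe_tangentProj x v
    have h5 := B4.sum_repr' v
    rw [Fin.sum_univ_succ] at h5
    simp only [hB4, b, Fin.cons_zero, Fin.cons_succ] at h5
    refine h4.trans ?_
    rw [map_sum]
    refine (sub_eq_iff_eq_add'.2 h5.symm).trans ?_
    refine Finset.sum_congr rfl fun j _ => ?_
    rw [map_smul, hf]
  have hij : ∀ j k, ∑ i : Fin 4, (f j) i * (f k) i = if j = k then 1 else 0 := by
    intro j k
    have h6 := orthonormal_iff_ite.1 he j k
    rw [PiLp.inner_apply] at h6
    refine Eq.trans (Finset.sum_congr rfl fun i _ => ?_) (h6.trans (by congr))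
    simp [mul_comm]
  have hinn : ∀ j i, inner ℝ (f j) (EuclideanSpace.single i (1 : ℝ)) = (f j) i := by
    intro j i
    simp [EuclideanSpace.inner_single_right]
  have hr : ∀ (r : ℝ) (w : W), r • w = (r : 𝕜) • w := fun r w =>
    RCLike.real_smul_eq_coe_smul (K := 𝕜) r w
  have hA : ∀ i, tangentProj x (EuclideanSpace.single i (1 : ℝ)) = ∑ j, (f j i) • e j := by
    intro i
    rw [hexp]
    exact Finset.sum_congr rfl fun j _ => by rw [hinn]
  have hAB : ∀ i, inner 𝕜 (A (tangentProj x (EuclideanSpace.single i 1)))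
      (B (tangentProj x (EuclideanSpace.single i 1)))
      = ∑ j, ∑ k, ((f j i * f k i : ℝ) : 𝕜) * inner 𝕜 (A (e j)) (B (e k)) := by
    intro i
    rw [hA, map_sum, map_sum, sum_inner]
    refine Finset.sum_congr rfl fun j _ => ?_
    rw [inner_sum]
    refine Finset.sum_congr rfl fun k _ => ?_
    rw [map_smul, map_smul, hr, hr, inner_smul_left, inner_smul_right, RCLike.conj_ofReal]
    push_cast
    ring
  simp only [hAB]
  rw [Finset.sum_comm]
  refine Finset.sum_congr rfl fun j _ => ?_
  rw [Finset.sum_comm]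
  have h7 : ∀ k, ∑ i : Fin 4, ((f j i * f k i : ℝ) : 𝕜) * inner 𝕜 (A (e j)) (B (e k))
      = if j = k then inner 𝕜 (A (e j)) (B (e k)) else 0 := by
    intro k
    rw [← Finset.sum_mul, ← RCLike.ofReal_sum, hij j k]
    split_ifs <;> simp
  simp only [h7]
  simp

/-! ### Sections twisted by a Euclidean line bundle -/

section Sections

/-- Contraction of the line factor of `W ⊗ J` with a vector of `J`. -/
def contract {W J : Type*} [AddCommGroup W] [Module ℝ W] [NormedAddCommGroup J]
    [InnerProductSpace ℝ J] (u : J) : W ⊗[ℝ] J →ₗ[ℝ] W :=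
  (TensorProduct.rid ℝ W).toLinearMap ∘ₗ LinearMap.lTensor W (innerₗ J u)

@[simp] lemma contract_tmul {W J : Type*} [AddCommGroup W] [Module ℝ W] [NormedAddCommGroup J]
    [InnerProductSpace ℝ J] (u : J) (w : W) (j : J) :
    contract u (w ⊗ₜ[ℝ] j) = (inner ℝ u j) • w := by
  simp [contract]

lemma contract_smul {𝕜 W J : Type*} [RCLike 𝕜] [AddCommGroup W] [Module ℝ W] [Module 𝕜 W]
    [IsScalarTower ℝ 𝕜 W] [NormedAddCommGroup J]
    [InnerProductSpace ℝ J] (u : J) (c : 𝕜) (s : W ⊗[ℝ] J) :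
    contract u (c • s) = c • contract u s := by
  induction s with
  | zero => simp
  | tmul w j =>
    rw [TensorProduct.smul_tmul', contract_tmul, contract_tmul]
    exact smul_comm _ _ _
  | add a b ha hb => simp [ha, hb]

lemma contract_smul_left {W J : Type*} [AddCommGroup W] [Module ℝ W] [NormedAddCommGroup J]
    [InnerProductSpace ℝ J] (u : J) (c : ℝ) (s : W ⊗[ℝ] J) :
    contract (c • u) s = c • contract u s := by
  induction s with
  | zero => simp
  | tmul w j => simp [inner_smul_left, mul_smul]
  | add a b ha hb => simp [ha, hb]

variable (𝕜 : Type*) [RCLike 𝕜]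
  (F : Type*) [NormedAddCommGroup F] [NormedSpace ℝ F]
  (V : S3 → Type*) [TopologicalSpace (TotalSpace F V)]
  [∀ x, NormedAddCommGroup (V x)] [∀ x, InnerProductSpace ℝ (V x)]
  [FiberBundle F V] [VectorBundle ℝ F V]
  {U : TopologicalSpace.Opens S3}
  (I : U → Type*) [TopologicalSpace (TotalSpace ℝ I)]
  [∀ x, NormedAddCommGroup (I x)] [∀ x, InnerProductSpace ℝ (I x)]
  [FiberBundle ℝ I] [VectorBundle ℝ ℝ I]

variable {I} in
/-- `u` is a continuous section of unit length of the line bundle `I` near `x`. -/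
def IsUnitFrameAt (u : ∀ y : U, I y) (x : U) : Prop :=
  ∀ᶠ y in 𝓝 x, ‖u y‖ = 1 ∧ ContinuousAt (fun z : U => TotalSpace.mk' ℝ z (u z)) y

/-- Sections (without regularity) of `V ⊗ I` over `U`. -/
abbrev RoughSection : Type _ := ∀ y : U, V y ⊗[ℝ] I y

variable {V I}

/-- For a section `s` of `V ⊗ I` and a section `u` of `I`, the section `v` of `V` with `s = v ⊗ u`
where `u` has unit length, extended by zero outside of `U`. -/
def localRep (u : ∀ y : U, I y) (s : RoughSection V I) (y : S3) : V y := by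
  classical
  exact if h : y ∈ U then contract (u ⟨y, h⟩) (s ⟨y, h⟩) else 0

/-- A section of `V ⊗ I` is smooth if near each point it is of the form `v ⊗ u` with `u` a
continuous unit length section of `I` and `v` a smooth section of `V`. -/
def IsSmooth (s : RoughSection V I) : Prop :=
  ∀ (x : U) (u : ∀ y : U, I y), IsUnitFrameAt u x →
    ContMDiffAt (𝓡 3) ((𝓡 3).prod 𝓘(ℝ, F)) ∞
      (fun y : S3 => TotalSpace.mk' F y (localRep u s y)) (x : S3)

@[simp] lemma localRep_apply (u : ∀ y : U, I y) (s : RoughSection V I) (y : U) :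
    localRep u s (y : S3) = contract (u y) (s y) := by
  simp [localRep]

lemma localRep_add (u : ∀ y : U, I y) (s t : RoughSection V I) :
    localRep u (s + t) = localRep u s + localRep u t := by
  funext y
  by_cases h : y ∈ U <;> simp [localRep, h]

lemma localRep_smul [∀ x, InnerProductSpace 𝕜 (V x)] [∀ x, IsScalarTower ℝ 𝕜 (V x)]
    (u : ∀ y : U, I y) (c : 𝕜) (s : RoughSection V I) :
    localRep u (c • s) = c • localRep u s := by
  funext y
  by_cases h : y ∈ U <;> simp [localRep, h, contract_smul]

variable [IsContinuousRiemannianBundle ℝ I]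

lemma eq_smul_of_norm_eq_one (y : U) {a b : I y} (ha : ‖a‖ = 1) :
    b = (inner ℝ a b : ℝ) • a := by
  let L := (trivializationAt ℝ I y).continuousLinearEquivAt ℝ y
    (FiberBundle.mem_baseSet_trivializationAt' y)
  have hLa : L a ≠ 0 := by
    intro h
    have : a = 0 := by simpa using h
    simp [this] at ha
  have hb : b = (L b / L a) • a := by
    apply L.injective
    rw [map_smul, smul_eq_mul]
    field_simp
  have h1 : (inner ℝ a b : ℝ) = L b / L a := by
    conv_lhs => rw [hb]
    rw [inner_smul_right, real_inner_self_eq_norm_sq, ha]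
    simp
  rw [h1]
  exact hb

lemma exists_isUnitFrameAt (x : U) : ∃ u : ∀ y : U, I y, IsUnitFrameAt u x := by
  let e := trivializationAt ℝ I x
  have hx : e.baseSet ∈ 𝓝 x :=
    e.open_baseSet.mem_nhds (FiberBundle.mem_baseSet_trivializationAt' x)
  let w : ∀ y : U, I y := fun y => e.symm y 1
  have hw : ∀ y ∈ e.baseSet, ContinuousAt (fun z : U => TotalSpace.mk' ℝ z (w z)) y := by
    intro y hy
    have h1 : ContinuousOn (fun z : U => TotalSpace.mk' ℝ z (e.symm z (1 : ℝ))) e.baseSet := by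
      have := e.continuousOn_symm.comp (f := fun z : U => (z, (1 : ℝ)))
        (s := e.baseSet) (by fun_prop) (fun z hz => ⟨hz, mem_univ _⟩)
      exact this
    exact h1.continuousAt (e.open_baseSet.mem_nhds hy)
  have hw0 : ∀ y ∈ e.baseSet, w y ≠ 0 := by
    intro y hy h0
    have h1 := e.apply_mk_symm hy (1 : ℝ)
    have h2 : e ⟨y, e.symm y 1⟩ = e ⟨y, (0 : I y)⟩ := congrArg (fun v => e ⟨y, v⟩) h0
    have h3 : (e ⟨y, (0 : I y)⟩).2 = 0 := by
      have := (e.linear ℝ hy).map_zero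
      exact this
    rw [h2] at h1
    rw [h1] at h3
    exact one_ne_zero h3
  refine ⟨fun y => ‖w y‖⁻¹ • w y, ?_⟩
  filter_upwards [e.open_baseSet.mem_nhds (FiberBundle.mem_baseSet_trivializationAt' x)] with y hy
  refine ⟨by simp [norm_smul, hw0 y hy], ?_⟩
  have hn : ContinuousAt (fun z => ‖w z‖⁻¹) y := by
    have h1 := (hw y hy).inner_bundle (hw y hy)
    have h2 : ContinuousAt (fun z => ‖w z‖) y := by
      have := h1.sqrt
      refine this.congr (Filter.Eventually.of_forall fun z => ?_)
      simp
    exact h2.inv₀ (norm_ne_zero_iff.2 (hw0 y hy))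
  have hbs : e.baseSet ∈ 𝓝 y := e.open_baseSet.mem_nhds hy
  have hc : ContinuousAt (fun z : U => TotalSpace.mk' ℝ z (e.symm z (‖w z‖⁻¹))) y := by
    have h1 : ContinuousAt (fun p : U × ℝ => TotalSpace.mk' ℝ p.1 (e.symm p.1 p.2))
        (y, ‖w y‖⁻¹) :=
      e.continuousOn_symm.continuousAt
        ((e.open_baseSet.prod isOpen_univ).mem_nhds ⟨hy, mem_univ _⟩)
    exact ContinuousAt.comp (f := fun z : U => (z, ‖w z‖⁻¹)) h1 (continuousAt_id.prodMk hn)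
  refine hc.congr ?_
  filter_upwards [hbs] with z hz
  have h1 := (e.symmₗ ℝ z).map_smul (‖w z‖⁻¹) 1
  rw [e.symmₗ_apply hz, e.symmₗ_apply hz, smul_eq_mul, mul_one] at h1
  rw [h1]

lemma IsUnitFrameAt.eventually {u : ∀ y : U, I y} {x : U} (h : IsUnitFrameAt u x) :
    ∀ᶠ y in 𝓝 x, IsUnitFrameAt u y := by
  unfold IsUnitFrameAt at *
  exact eventually_eventually_nhds.2 h

lemma IsUnitFrameAt.norm_eq {u : ∀ y : U, I y} {x : U} (h : IsUnitFrameAt u x) : ‖u x‖ = 1 :=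
  (Filter.Eventually.self_of_nhds h).1

/-- Two unit frames differ locally by a constant sign. -/
lemma IsUnitFrameAt.exists_sign {u v : ∀ y : U, I y} {x : U} (hu : IsUnitFrameAt u x)
    (hv : IsUnitFrameAt v x) : ∃ c : ℝ, c * c = 1 ∧ ∀ᶠ y in 𝓝 x, v y = c • u y := by
  have hcont : ContinuousAt (fun y => (inner ℝ (u y) (v y) : ℝ)) x :=
    (Filter.Eventually.self_of_nhds hu).2.inner_bundle (Filter.Eventually.self_of_nhds hv).2
  have hsq : ∀ᶠ y in 𝓝 x, (inner ℝ (u y) (v y) : ℝ) * inner ℝ (u y) (v y) = 1 := by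
    filter_upwards [hu, hv] with y h1 h2
    have h3 := eq_smul_of_norm_eq_one y (b := v y) h1.1
    have h4 := congrArg norm h3
    rw [norm_smul, h1.1, h2.1, mul_one, Real.norm_eq_abs] at h4
    rw [← abs_mul_abs_self, ← h4, mul_one]
  have hx : (inner ℝ (u x) (v x) : ℝ) * inner ℝ (u x) (v x) = 1 := hsq.self_of_nhds
  refine ⟨inner ℝ (u x) (v x), hx, ?_⟩
  have hnear : ∀ᶠ y in 𝓝 x, |(inner ℝ (u y) (v y) : ℝ) - inner ℝ (u x) (v x)| < 1 := by
    have := Metric.tendsto_nhds.1 hcont 1 one_pos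
    simpa [Real.dist_eq] using this
  filter_upwards [hu, hsq, hnear] with y h1 h2 h3
  have h4 : (inner ℝ (u y) (v y) : ℝ) = inner ℝ (u x) (v x) := by
    rcases mul_self_eq_one_iff.1 h2 with h | h <;> rcases mul_self_eq_one_iff.1 hx with h' | h' <;>
      rw [h, h'] at h3 ⊢ <;> norm_num at h3
  rw [← h4]
  exact eq_smul_of_norm_eq_one y h1.1

/-- A choice of a unit length continuous section of `I` near `x`, unique up to sign. -/
def frame (I : U → Type*) [TopologicalSpace (TotalSpace ℝ I)]
    [∀ x, NormedAddCommGroup (I x)] [∀ x, InnerProductSpace ℝ (I x)]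
    [FiberBundle ℝ I] [VectorBundle ℝ ℝ I] [IsContinuousRiemannianBundle ℝ I] (x : U) :
    ∀ y : U, I y :=
  (exists_isUnitFrameAt x).choose

lemma isUnitFrameAt_frame (x : U) : IsUnitFrameAt (frame I x) x :=
  (exists_isUnitFrameAt x).choose_spec

/-- The fiber metric of `V ⊗ I`: it is given by `⟨v ⊗ u, w ⊗ u⟩ = ⟨v, w⟩` for `‖u‖ = 1`. -/
def fiberInner [∀ x, InnerProductSpace 𝕜 (V x)] (y : U) (s t : V y ⊗[ℝ] I y) : 𝕜 :=
  inner 𝕜 (contract (frame I y y) s) (contract (frame I y y) t)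

/-- The covariant derivative on sections of `V ⊗ I`: if `s = v ⊗ u` near `x`, where `u` is a local
section of `I` of unit length, then `∇_w s = ∇_w v ⊗ u` at `x`. -/
def nabla (cov : CovariantDerivative (𝓡 3) F V) (s : RoughSection V I) (x : U)
    (w : TangentSpace (𝓡 3) (x : S3)) : V x ⊗[ℝ] I x :=
  cov (localRep (frame I x) s) (x : S3) w ⊗ₜ[ℝ] frame I x x

/-- The inner product `⟨∇s, ∇t⟩` on `T*S³ ⊗ V ⊗ I` at `x`, computed with the projections of the
coordinate vectors to the tangent space (any orthonormal basis of the tangent space gives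
the same result by `sum_tangentProj_eq`). -/
def nablaInner [∀ x, InnerProductSpace 𝕜 (V x)] (cov : CovariantDerivative (𝓡 3) F V)
    (s t : RoughSection V I) (x : U) : 𝕜 :=
  ∑ i : Fin 4, fiberInner 𝕜 x
    (nabla F cov s x (tangentProj x (EuclideanSpace.single i 1)))
    (nabla F cov t x (tangentProj x (EuclideanSpace.single i 1)))

variable [∀ x, InnerProductSpace 𝕜 (V x)] [∀ x, IsScalarTower ℝ 𝕜 (V x)]

lemma fiberInner_eq {y : U} {u : I y} (hu : ‖u‖ = 1) (s t : V y ⊗[ℝ] I y) :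
    fiberInner 𝕜 y s t = inner 𝕜 (contract u s) (contract u t) := by
  have h1 := eq_smul_of_norm_eq_one y (a := u) (b := frame I y y) hu
  set c : ℝ := inner ℝ u (frame I y y)
  have h2 : ‖c‖ = 1 := by
    have := congrArg norm h1
    rw [norm_smul, hu, (isUnitFrameAt_frame y).norm_eq, mul_one] at this
    exact this.symm
  have hc : c * c = 1 := by
    rw [← abs_mul_abs_self, ← Real.norm_eq_abs, h2, mul_one]
  rw [fiberInner, h1, contract_smul_left, contract_smul_left,
    RCLike.real_smul_eq_coe_smul (K := 𝕜), RCLike.real_smul_eq_coe_smul (K := 𝕜),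
    inner_smul_left, inner_smul_right, RCLike.conj_ofReal, ← mul_assoc, ← RCLike.ofReal_mul, hc]
  simp

lemma re_inner_eq_inner {W : Type*} [NormedAddCommGroup W] [InnerProductSpace ℝ W]
    [InnerProductSpace 𝕜 W] (a b : W) : RCLike.re (inner 𝕜 a b) = inner ℝ a b := by
  have h1 := re_inner_eq_norm_add_mul_self_sub_norm_sub_mul_self_div_four (𝕜 := 𝕜) a b
  have h2 := re_inner_eq_norm_add_mul_self_sub_norm_sub_mul_self_div_four (𝕜 := ℝ) a b
  rw [h1, ← h2]
  rfl

variable (V) in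
/-- Multiplication by scalars of `𝕜` (real or complex numbers) is a smooth bundle map of `V`.
For `𝕜 = ℂ` this says that `V` is a smooth complex vector bundle. -/
class SmoothScalars : Prop where
  contMDiff_smul : ∀ c : 𝕜, ContMDiff (𝓡 3) ((𝓡 3).prod 𝓘(ℝ, F →L[ℝ] F)) ∞
    (fun x : S3 => TotalSpace.mk' (F →L[ℝ] F) (E := fun x => V x →L[ℝ] V x) x
      (c • ContinuousLinearMap.id ℝ (V x)))

variable (V) in
/-- The hypotheses on the connection of the Euclidean (`𝕜 = ℝ`) or Hermitian (`𝕜 = ℂ`) bundle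
`V`: it is smooth, linear over `𝕜` and compatible with the fiber metric. -/
class MetricConnection [FiniteDimensional ℝ F] [ContMDiffVectorBundle ∞ F V (𝓡 3)]
    [IsContMDiffRiemannianBundle (𝓡 3) ∞ F V]
    (cov : CovariantDerivative (𝓡 3) F V) : Prop where
  smooth : cov.ContMDiffCovariantDerivative ∞
  metric : cov.IsMetricCompatible
  smul : ∀ (c : 𝕜) (σ : ∀ x, V x) (x : S3) (w : TangentSpace (𝓡 3) x),
    MDifferentiableAt (𝓡 3) ((𝓡 3).prod 𝓘(ℝ, F)) (fun y => TotalSpace.mk' F y (σ y)) x →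
    cov (c • σ) x w = c • cov σ x w

variable [IsContMDiffRiemannianBundle (𝓡 3) ∞ F V]

lemma continuousAt_inner [SmoothScalars 𝕜 F V] {σ τ : ∀ x, V x} {x : S3}
    (hσ : ContMDiffAt (𝓡 3) ((𝓡 3).prod 𝓘(ℝ, F)) ∞ (fun y => TotalSpace.mk' F y (σ y)) x)
    (hτ : ContMDiffAt (𝓡 3) ((𝓡 3).prod 𝓘(ℝ, F)) ∞ (fun y => TotalSpace.mk' F y (τ y)) x) :
    ContinuousAt (fun y => inner 𝕜 (σ y) (τ y)) x := by
  have hI : ContMDiffAt (𝓡 3) ((𝓡 3).prod 𝓘(ℝ, F)) ∞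
      (fun y => TotalSpace.mk' F y ((RCLike.I : 𝕜) • σ y)) x :=
    ContMDiffAt.clm_bundle_apply (F₁ := F) (F₂ := F) (E₁ := V) (E₂ := V) (b := fun y => y)
      (SmoothScalars.contMDiff_smul (𝕜 := 𝕜) (F := F) (V := V) (RCLike.I : 𝕜) x) hσ
  have h1 : ContinuousAt (fun y => (inner ℝ (σ y) (τ y) : ℝ)) x :=
    (hσ.inner_bundle hτ).continuousAt
  have h2 : ContinuousAt (fun y => (inner ℝ ((RCLike.I : 𝕜) • σ y) (τ y) : ℝ)) x :=
    (hI.inner_bundle hτ).continuousAt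
  have h3 : ∀ y, inner 𝕜 (σ y) (τ y) = ((inner ℝ (σ y) (τ y) : ℝ) : 𝕜)
      + ((inner ℝ ((RCLike.I : 𝕜) • σ y) (τ y) : ℝ) : 𝕜) * RCLike.I := by
    intro y
    rw [← re_inner_eq_inner 𝕜, ← re_inner_eq_inner 𝕜, inner_smul_left]
    conv_lhs => rw [← RCLike.re_add_im (inner 𝕜 (σ y) (τ y))]
    simp
  simp only [h3]
  exact (RCLike.continuous_ofReal.continuousAt.comp h1).add
    ((RCLike.continuous_ofReal.continuousAt.comp h2).mul continuousAt_const)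

/-- Functions near `x : U` can be compared with functions near `(x : S3)`. -/
lemma eventually_coe {p : S3 → Prop} {x : U} (h : ∀ᶠ y in 𝓝 (x : S3), p y) :
    ∀ᶠ y : U in 𝓝 x, p y :=
  continuous_subtype_val.continuousAt.eventually h

lemma eventually_of_coe {p : U → Prop} {x : U} (h : ∀ᶠ y in 𝓝 x, p y) :
    ∀ᶠ y in 𝓝 (x : S3), ∃ hy : y ∈ U, p ⟨y, hy⟩ := by
  have h1 := U.2.isOpenEmbedding_subtypeVal.isOpenMap.image_mem_nhds h
  filter_upwards [h1] with y hy
  obtain ⟨z, hz, rfl⟩ := hy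
  exact ⟨z.2, hz⟩

lemma continuous_fiberInner [SmoothScalars 𝕜 F V] {s t : RoughSection V I}
    (hs : IsSmooth F s) (ht : IsSmooth F t) :
    Continuous (fun y : U => fiberInner 𝕜 y (s y) (t y)) := by
  rw [continuous_iff_continuousAt]
  intro x
  have hu := isUnitFrameAt_frame (I := I) x
  have h1 := continuousAt_inner 𝕜 F (hs x _ hu) (ht x _ hu)
  have h2 : ContinuousAt (fun y : U => inner 𝕜 (localRep (frame I x) s (y : S3))
      (localRep (frame I x) t (y : S3))) x :=
    ContinuousAt.comp (f := fun y : U => (y : S3)) h1 continuous_subtype_val.continuousAt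
  refine h2.congr ?_
  filter_upwards [hu] with y hy
  rw [fiberInner_eq 𝕜 hy.1, localRep_apply, localRep_apply]

section Nabla

variable [FiniteDimensional ℝ F] [ContMDiffVectorBundle ∞ F V (𝓡 3)]
  (cov : CovariantDerivative (𝓡 3) F V)

lemma nabla_eq {s : RoughSection V I} (hs : IsSmooth F s) {x : U} {u : ∀ y : U, I y}
    (hu : IsUnitFrameAt u x) (w : TangentSpace (𝓡 3) (x : S3)) :
    nabla F cov s x w = cov (localRep u s) (x : S3) w ⊗ₜ[ℝ] u x := by
  obtain ⟨c, hc, hv⟩ := hu.exists_sign (isUnitFrameAt_frame x)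
  have h1 := (hs x _ hu).mdifferentiableAt (by simp)
  have h2 := (hs x _ (isUnitFrameAt_frame x)).mdifferentiableAt (by simp)
  have h3 : cov (localRep (frame I x) s) (x : S3) = cov (c • localRep u s) (x : S3) := by
    refine cov.isCovariantDerivativeOn.congr_of_eventuallyEq (s := univ) h2 ?_ Filter.univ_mem ?_
    · exact ((hs x _ hu).const_smul_section (a := c)).mdifferentiableAt (by simp)
    · filter_upwards [eventually_of_coe hv] with y hy
      obtain ⟨hyU, hy⟩ := hy
      simp [localRep, hyU, hy, contract_smul_left]
  have h4 : cov (c • localRep u s) (x : S3) = c • cov (localRep u s) (x : S3) :=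
    cov.isCovariantDerivativeOn.smul_const (s := univ) c h1
  rw [nabla, h3, h4, hv.self_of_nhds, _root_.smul_apply, TensorProduct.smul_tmul_smul,
    hc, one_smul]

lemma exists_global {σ : ∀ x, V x} {x : S3}
    (hσ : ∀ᶠ y in 𝓝 x, ContMDiffAt (𝓡 3) ((𝓡 3).prod 𝓘(ℝ, F)) ∞
      (fun y => TotalSpace.mk' F y (σ y)) y) :
    ∃ τ : ∀ x, V x, ContMDiff (𝓡 3) ((𝓡 3).prod 𝓘(ℝ, F)) ∞ (fun y => TotalSpace.mk' F y (τ y)) ∧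
      ∀ᶠ y in 𝓝 x, τ y = σ y := by
  obtain ⟨f, -, hf⟩ := (SmoothBumpFunction.nhds_basis_tsupport (I := 𝓡 3) x).mem_iff.1 hσ
  refine ⟨fun y => f y • σ y, fun y => ?_, ?_⟩
  · by_cases hy : y ∈ tsupport f
    · exact (f.contMDiff y).smul_section (hf hy)
    · have h1 : ∀ᶠ z in 𝓝 y, f z = 0 := by
        filter_upwards [(isClosed_tsupport f).isOpen_compl.mem_nhds hy] with z hz
        exact image_eq_zero_of_notMem_tsupport hz
      refine (contMDiff_zeroSection ℝ V y).congr_of_eventuallyEq ?_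
      filter_upwards [h1] with z hz
      simp [hz, zeroSection]
  · filter_upwards [f.eventuallyEq_one] with y hy
    simp [hy]

lemma contMDiffAt_cov (hcov : cov.ContMDiffCovariantDerivative ∞) {σ : ∀ x, V x} {x : S3}
    (hσ : ∀ᶠ y in 𝓝 x, ContMDiffAt (𝓡 3) ((𝓡 3).prod 𝓘(ℝ, F)) ∞
      (fun y => TotalSpace.mk' F y (σ y)) y) (v : E4) :
    ContMDiffAt (𝓡 3) ((𝓡 3).prod 𝓘(ℝ, F)) ∞
      (fun y => TotalSpace.mk' F y (cov σ y (tangentProj y v))) x := by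
  obtain ⟨τ, hτ, heq⟩ := exists_global F hσ
  have h1 := (hcov.contMDiff.contMDiff (σ := τ) hτ.contMDiffOn).contMDiffAt (x := x) Filter.univ_mem
  have h2 : ContMDiffAt (𝓡 3) ((𝓡 3).prod 𝓘(ℝ, F)) ∞
      (fun y => TotalSpace.mk' F y (cov τ y (tangentProj y v))) x :=
    ContMDiffAt.clm_bundle_apply (F₁ := EuclideanSpace ℝ (Fin 3)) (F₂ := F)
      (E₁ := TangentSpace (𝓡 3)) (E₂ := V) (b := fun y => y) h1 (contMDiff_tangentProj v x)
  refine h2.congr_of_eventuallyEq ?_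
  filter_upwards [eventually_eventually_nhds.2 heq, hσ] with y hy hy2
  rw [cov.isCovariantDerivativeOn.congr_of_eventuallyEq (s := univ)
    ((hτ y).mdifferentiableAt (by simp)) (hy2.mdifferentiableAt (by simp)) Filter.univ_mem hy]

lemma continuous_nablaInner [SmoothScalars 𝕜 F V] [hcov : MetricConnection 𝕜 F V cov]
    {s t : RoughSection V I} (hs : IsSmooth F s) (ht : IsSmooth F t) :
    Continuous (nablaInner 𝕜 F cov s t) := by
  rw [continuous_iff_continuousAt]
  intro x
  have hu := isUnitFrameAt_frame (I := I) x
  have key : ∀ r : RoughSection V I, IsSmooth F r → ∀ᶠ y in 𝓝 (x : S3),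
      ContMDiffAt (𝓡 3) ((𝓡 3).prod 𝓘(ℝ, F)) ∞
        (fun y => TotalSpace.mk' F y (localRep (frame I x) r y)) y := by
    intro r hr
    filter_upwards [eventually_of_coe hu.eventually] with y hy
    obtain ⟨hyU, hy⟩ := hy
    exact hr ⟨y, hyU⟩ _ hy
  have h1 : ContinuousAt (fun y : U => ∑ i : Fin 4, inner 𝕜
      (cov (localRep (frame I x) s) (y : S3) (tangentProj y (EuclideanSpace.single i 1)))
      (cov (localRep (frame I x) t) (y : S3) (tangentProj y (EuclideanSpace.single i 1)))) x := by
    refine tendsto_finsetSum _ fun i _ => ?_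
    exact ContinuousAt.comp (f := fun y : U => (y : S3))
      (continuousAt_inner 𝕜 F (contMDiffAt_cov F cov hcov.smooth (key s hs) _)
        (contMDiffAt_cov F cov hcov.smooth (key t ht) _)) continuous_subtype_val.continuousAt
  refine h1.congr ?_
  filter_upwards [hu, hu.eventually] with y hy1 hy
  refine Finset.sum_congr rfl fun i _ => ?_
  rw [nabla_eq F cov hs hy, nabla_eq F cov ht hy, fiberInner_eq 𝕜 hy1.1]
  simp [hy1.1]

end Nabla

/-! ### Test sections and the two Hilbert spaces -/

/-- The surface measure of `S³`, restricted to the open subset `U`. -/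
def measureOn (U : TopologicalSpace.Opens S3) : Measure U :=
  surfaceMeasure.comap (Subtype.val : U → S3)

instance instIsFiniteMeasureOn (U : TopologicalSpace.Opens S3) : IsFiniteMeasure (measureOn U) := by
  constructor
  have h1 : IsFiniteMeasure surfaceMeasure := by unfold surfaceMeasure; infer_instance
  have h2 := (MeasurableEmbedding.subtype_coe (s := (U : Set S3))
    U.2.measurableSet).comap_apply surfaceMeasure univ
  exact h2.trans_lt (measure_lt_top _ _)

variable [SmoothScalars 𝕜 F V]

variable (V I) in
/-- The space of smooth sections of `V ⊗ I` with compact support in `U`. -/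
def testSections : Submodule 𝕜 (RoughSection V I) where
  carrier := {s | IsSmooth F s ∧ ∃ K : Set U, IsCompact K ∧ ∀ y ∉ K, s y = 0}
  zero_mem' := by
    refine ⟨fun x u _ => ?_, ∅, isCompact_empty, fun _ _ => rfl⟩
    refine (contMDiff_zeroSection ℝ V (x : S3)).congr_of_eventuallyEq
      (Filter.Eventually.of_forall fun y => ?_)
    by_cases h : y ∈ U <;> simp [localRep, h, zeroSection]
  add_mem' := by
    rintro s t ⟨hs, K, hK, hsK⟩ ⟨ht, K', hK', htK⟩
    refine ⟨fun x u hu => ?_, K ∪ K', hK.union hK', fun y hy => ?_⟩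
    · rw [localRep_add]
      exact (hs x u hu).add_section (ht x u hu)
    · rw [Pi.add_apply, hsK y (fun h => hy (Or.inl h)), htK y (fun h => hy (Or.inr h)), add_zero]
  smul_mem' := by
    rintro c s ⟨hs, K, hK, hsK⟩
    refine ⟨fun x u hu => ?_, K, hK, fun y hy => ?_⟩
    · rw [localRep_smul]
      exact ContMDiffAt.clm_bundle_apply (F₁ := F) (F₂ := F) (E₁ := V) (E₂ := V) (b := fun y => y)
        (SmoothScalars.contMDiff_smul (𝕜 := 𝕜) (F := F) (V := V) c (x : S3)) (hs x u hu)
    · rw [Pi.smul_apply, hsK y hy, smul_zero]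

/-- The `L²` inner product `∫ ⟨s, t⟩` over `U`. -/
def innerL (s t : testSections 𝕜 F V I) : 𝕜 :=
  ∫ y, fiberInner 𝕜 y (s.1 y) (t.1 y) ∂(measureOn U)

/-- The Dirichlet inner product `∫ ⟨∇s, ∇t⟩` over `U`. -/
def innerH (cov : CovariantDerivative (𝓡 3) F V) (s t : testSections 𝕜 F V I) : 𝕜 :=
  ∫ y, nablaInner 𝕜 F cov s.1 t.1 y ∂(measureOn U)

section Cores

lemma integrable_fiberInner (s t : testSections 𝕜 F V I) :
    Integrable (fun y => fiberInner 𝕜 y (s.1 y) (t.1 y)) (measureOn U) := by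
  obtain ⟨K, hK, hsK⟩ := s.2.2
  refine (continuous_fiberInner 𝕜 F s.2.1 t.2.1).integrable_of_hasCompactSupport
    (HasCompactSupport.intro hK fun y hy => ?_)
  simp [fiberInner, hsK y hy]

/-- The axioms of an inner product (without definiteness) for the `L²` inner product. -/
@[reducible] def coreL : PreInnerProductSpace.Core 𝕜 (testSections 𝕜 F V I) where
  inner s t := innerL 𝕜 F s t
  conj_inner_symm s t := by
    simp only [innerL]
    rw [← integral_conj]
    simp [fiberInner]
  re_inner_nonneg s := by
    simp only [innerL]
    rw [← integral_re (integrable_fiberInner 𝕜 F s s)]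
    exact integral_nonneg fun y => inner_self_nonneg
  add_left s t r := by
    simp only [innerL]
    rw [← integral_add (integrable_fiberInner 𝕜 F s r) (integrable_fiberInner 𝕜 F t r)]
    refine integral_congr_ae (Filter.Eventually.of_forall fun y => ?_)
    simp [fiberInner, inner_add_left]
  smul_left s t c := by
    simp only [innerL]
    rw [← integral_const_mul]
    refine integral_congr_ae (Filter.Eventually.of_forall fun y => ?_)
    simp [fiberInner, inner_smul_left, contract_smul]

variable [FiniteDimensional ℝ F] [ContMDiffVectorBundle ∞ F V (𝓡 3)]
    (cov : CovariantDerivative (𝓡 3) F V)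

lemma nabla_add {s t : RoughSection V I} (hs : IsSmooth F s) (ht : IsSmooth F t) (x : U)
    (w : TangentSpace (𝓡 3) (x : S3)) :
    nabla F cov (s + t) x w = nabla F cov s x w + nabla F cov t x w := by
  have hu := isUnitFrameAt_frame (I := I) x
  have h1 := cov.isCovariantDerivativeOn.add (s := univ) ((hs x _ hu).mdifferentiableAt (by simp))
    ((ht x _ hu).mdifferentiableAt (by simp))
  simp only [nabla]
  rw [localRep_add, h1, ← TensorProduct.add_tmul]
  rfl

lemma nabla_smul [MetricConnection 𝕜 F V cov] {s : RoughSection V I} (hs : IsSmooth F s) (c : 𝕜)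
    (x : U) (w : TangentSpace (𝓡 3) (x : S3)) :
    nabla F cov (c • s) x w = c • nabla F cov s x w := by
  have hu := isUnitFrameAt_frame (I := I) x
  simp only [nabla]
  rw [localRep_smul, MetricConnection.smul c _ _ _ ((hs x _ hu).mdifferentiableAt (by simp)),
    TensorProduct.smul_tmul']

lemma nabla_eq_zero {s : RoughSection V I} {x : U} (hx : ∀ᶠ y in 𝓝 x, s y = 0)
    (w : TangentSpace (𝓡 3) (x : S3)) : nabla F cov s x w = 0 := by
  have h1 : ∀ᶠ y in 𝓝 (x : S3), localRep (frame I x) s y = (0 : ∀ y, V y) y := by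
    filter_upwards [eventually_of_coe hx] with y hy
    obtain ⟨hyU, hy⟩ := hy
    simp [localRep, hyU, hy]
  have h2 : MDifferentiableAt (𝓡 3) ((𝓡 3).prod 𝓘(ℝ, F))
      (fun y => TotalSpace.mk' F y ((0 : ∀ y, V y) y)) (x : S3) :=
    (contMDiff_zeroSection ℝ V (n := 1) (x : S3)).mdifferentiableAt one_ne_zero
  have h3 : cov (localRep (frame I x) s) (x : S3) = cov 0 (x : S3) :=
    cov.isCovariantDerivativeOn.congr_of_eventuallyEq (s := univ)
      (h2.congr_of_eventuallyEq (by filter_upwards [h1] with y hy; rw [hy])) h2 Filter.univ_mem h1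
  rw [nabla, h3, cov.zero]
  simp

variable [MetricConnection 𝕜 F V cov]

lemma integrable_nablaInner (s t : testSections 𝕜 F V I) :
    Integrable (nablaInner 𝕜 F cov s.1 t.1) (measureOn U) := by
  obtain ⟨K, hK, hsK⟩ := s.2.2
  refine (continuous_nablaInner 𝕜 F cov s.2.1 t.2.1).integrable_of_hasCompactSupport
    (HasCompactSupport.intro hK fun y hy => ?_)
  have h1 : ∀ᶠ z in 𝓝 y, s.1 z = 0 := by
    filter_upwards [hK.isClosed.isOpen_compl.mem_nhds hy] with z hz
    exact hsK z hz
  simp [nablaInner, nabla_eq_zero F cov h1, fiberInner]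

/-- The axioms of an inner product (without definiteness) for the Dirichlet inner product. -/
@[reducible] def coreH : PreInnerProductSpace.Core 𝕜 (testSections 𝕜 F V I) where
  inner s t := innerH 𝕜 F cov s t
  conj_inner_symm s t := by
    simp only [innerH]
    rw [← integral_conj]
    simp [nablaInner, fiberInner]
  re_inner_nonneg s := by
    simp only [innerH]
    rw [← integral_re (integrable_nablaInner 𝕜 F cov s s)]
    refine integral_nonneg fun y => ?_
    simp only [nablaInner, map_sum, Pi.zero_apply]
    exact Finset.sum_nonneg fun i _ => inner_self_nonneg
  add_left s t r := by
    simp only [innerH]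
    rw [← integral_add (integrable_nablaInner 𝕜 F cov s r) (integrable_nablaInner 𝕜 F cov t r)]
    refine integral_congr_ae (Filter.Eventually.of_forall fun y => ?_)
    simp [nablaInner, nabla_add F cov s.2.1 t.2.1, fiberInner, inner_add_left,
      Finset.sum_add_distrib]
  smul_left s t c := by
    simp only [innerH]
    rw [← integral_const_mul]
    refine integral_congr_ae (Filter.Eventually.of_forall fun y => ?_)
    simp [nablaInner, nabla_smul 𝕜 F cov s.2.1, fiberInner, inner_smul_left, contract_smul,
      Finset.mul_sum]

end Cores

variable (V I) in
/-- The space of test sections, as a pre-Hilbert space with the norm `(∫ |s|²)^{1/2}`. -/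
def PreL : Type _ := testSections 𝕜 F V I

variable (I) in
/-- The space of test sections, as a pre-Hilbert space with the norm `(∫ |∇s|²)^{1/2}`. -/
def PreH (_cov : CovariantDerivative (𝓡 3) F V) : Type _ := testSections 𝕜 F V I

section Hilbert

instance : SeminormedAddCommGroup (PreL 𝕜 F V I) :=
  @InnerProductSpace.Core.toSeminormedAddCommGroup 𝕜 (testSections 𝕜 F V I) _ _ _ (coreL 𝕜 F)
instance : InnerProductSpace 𝕜 (PreL 𝕜 F V I) :=
  @InnerProductSpace.ofCore 𝕜 (testSections 𝕜 F V I) _ _ _ (coreL 𝕜 F)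

variable [FiniteDimensional ℝ F] [ContMDiffVectorBundle ∞ F V (𝓡 3)]
    (cov : CovariantDerivative (𝓡 3) F V) [MetricConnection 𝕜 F V cov]

instance : SeminormedAddCommGroup (PreH 𝕜 F I cov) :=
  @InnerProductSpace.Core.toSeminormedAddCommGroup 𝕜 (testSections 𝕜 F V I) _ _ _ (coreH 𝕜 F cov)
instance : InnerProductSpace 𝕜 (PreH 𝕜 F I cov) :=
  @InnerProductSpace.ofCore 𝕜 (testSections 𝕜 F V I) _ _ _ (coreH 𝕜 F cov)

variable (V I) in
/-- The Hilbert space `𝕃`: the completion of the space of test sections in the `L²` norm. -/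
abbrev LSpace : Type _ := UniformSpace.Completion (PreL 𝕜 F V I)

variable (I) in
/-- The Hilbert space `ℍ`: the completion of the space of test sections in the norm
`(∫ |∇s|²)^{1/2}`. -/
abbrev HSpace : Type _ := UniformSpace.Completion (PreH 𝕜 F I cov)

variable {𝕜 F}

/-- A test section, as an element of `𝕃`. -/
def toL (s : testSections 𝕜 F V I) : LSpace 𝕜 F V I :=
  ((show PreL 𝕜 F V I from s : PreL 𝕜 F V I) : UniformSpace.Completion (PreL 𝕜 F V I))

/-- A test section, as an element of `ℍ`. -/
def toH (s : testSections 𝕜 F V I) : HSpace 𝕜 F I cov :=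
  ((show PreH 𝕜 F I cov from s : PreH 𝕜 F I cov) : UniformSpace.Completion (PreH 𝕜 F I cov))

lemma inner_toL (s t : testSections 𝕜 F V I) :
    inner 𝕜 (toL s) (toL t) = innerL 𝕜 F s t :=
  UniformSpace.Completion.inner_coe _ _

lemma inner_toH (s t : testSections 𝕜 F V I) :
    inner 𝕜 (toH cov s) (toH cov t) = innerH 𝕜 F cov s t :=
  UniformSpace.Completion.inner_coe _ _

end Hilbert

end Sections

/-! ### Operators on sections -/

section Operators

variable (𝕜 : Type*) [RCLike 𝕜]
  (F : Type*) [NormedAddCommGroup F] [NormedSpace ℝ F]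
  {V : S3 → Type*} [TopologicalSpace (TotalSpace F V)]
  [∀ x, NormedAddCommGroup (V x)] [∀ x, InnerProductSpace ℝ (V x)]
  [FiberBundle F V] [VectorBundle ℝ F V]
  {U : TopologicalSpace.Opens S3}
  {I : U → Type*} [TopologicalSpace (TotalSpace ℝ I)]
  [∀ x, NormedAddCommGroup (I x)] [∀ x, InnerProductSpace ℝ (I x)]
  [FiberBundle ℝ I] [VectorBundle ℝ ℝ I] [IsContinuousRiemannianBundle ℝ I]
  [∀ x, InnerProductSpace 𝕜 (V x)] [∀ x, IsScalarTower ℝ 𝕜 (V x)]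

lemma integrable_contract_sq [SmoothScalars 𝕜 F V] [IsContMDiffRiemannianBundle (𝓡 3) ∞ F V]
    (s : testSections 𝕜 F V I) :
    Integrable (fun y : U => ‖contract (frame I y y) (s.1 y)‖ ^ 2) (measureOn U) := by
  have h := (integrable_fiberInner 𝕜 F s s).re
  refine h.congr (Filter.Eventually.of_forall fun y => ?_)
  simp only [fiberInner]
  exact inner_self_eq_norm_sq _

lemma norm_sq_preL [SmoothScalars 𝕜 F V] [IsContMDiffRiemannianBundle (𝓡 3) ∞ F V]
    (s : PreL 𝕜 F V I) :
    ‖s‖ ^ 2 = ∫ y : U, ‖contract (frame I y y)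
      ((show testSections 𝕜 F V I from s).1 y)‖ ^ 2 ∂(measureOn U) := by
  rw [← inner_self_eq_norm_sq (𝕜 := 𝕜) s]
  change RCLike.re (innerL 𝕜 F (show testSections 𝕜 F V I from s)
    (show testSections 𝕜 F V I from s)) = _
  rw [innerL, ← integral_re (integrable_fiberInner 𝕜 F _ _)]
  refine integral_congr_ae (Filter.Eventually.of_forall fun y => ?_)
  simp only [fiberInner]
  exact inner_self_eq_norm_sq _

/-! ### Symmetric endomorphisms -/

section Endomorphism

variable (V) in
/-- A smooth symmetric (`𝕜 = ℝ`) or Hermitian (`𝕜 = ℂ`) endomorphism of the bundle `V`. -/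
structure SymmetricEndomorphism where
  /-- the endomorphism of the fiber at `x` -/
  toFun : ∀ x : S3, V x →L[𝕜] V x
  smooth : ContMDiff (𝓡 3) ((𝓡 3).prod 𝓘(ℝ, F →L[ℝ] F)) ∞
    (fun x : S3 => TotalSpace.mk' (F →L[ℝ] F) (E := fun x => V x →L[ℝ] V x) x
      ((toFun x).restrictScalars ℝ))
  symm : ∀ x (v w : V x), inner 𝕜 (toFun x v) w = inner 𝕜 v (toFun x w)

namespace SymmetricEndomorphism

variable {𝕜 F} (R : SymmetricEndomorphism 𝕜 F V)

/-- The extension `R ⊗ id` of the endomorphism to the fiber of `V ⊗ I` at `y`. -/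
def twist (I : U → Type*) [∀ x, NormedAddCommGroup (I x)] [∀ x, InnerProductSpace ℝ (I x)] (y : U) :
    V y ⊗[ℝ] I y →ₗ[𝕜] V y ⊗[ℝ] I y :=
  TensorProduct.AlgebraTensorModule.map (R.toFun y : V y →ₗ[𝕜] V y) LinearMap.id

lemma contract_twist (y : U) (u : I y) (s : V y ⊗[ℝ] I y) :
    contract u (R.twist I y s) = R.toFun y (contract u s) := by
  induction s with
  | zero => simp
  | tmul v j =>
    have h := ((R.toFun y).restrictScalars ℝ).map_smul (inner ℝ u j : ℝ) v
    simp only [twist, TensorProduct.AlgebraTensorModule.map_tmul, contract_tmul,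
      LinearMap.id_apply]
    exact h.symm
  | add a b ha hb => simp [ha, hb]

lemma exists_bound [IsContMDiffRiemannianBundle (𝓡 3) ∞ F V] :
    ∃ M : ℝ, 0 ≤ M ∧ ∀ (x : S3) (v : V x), ‖R.toFun x v‖ ≤ M * ‖v‖ := by
  have key : ∀ x : S3, ∃ M : ℝ, ∀ᶠ y in 𝓝 x, ∀ v : V y, ‖R.toFun y v‖ ≤ M * ‖v‖ := by
    intro x
    have hc : IsContinuousRiemannianBundle F V  := by
      obtain ⟨g, hg, hg2⟩ := IsContMDiffRiemannianBundle.exists_contMDiff (IB := 𝓡 3) (n := ∞)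
        (F := F) (E := V)
      exact ⟨g, hg.continuous, hg2⟩
    obtain ⟨C, hC, hC'⟩ := eventually_norm_trivializationAt_lt F V x
    obtain ⟨D, hD, hD'⟩ := eventually_norm_symmL_trivializationAt_lt F V x
    have h1 := (continuousAt_hom_bundle (RingHom.id ℝ) (fun x : S3 => TotalSpace.mk' (F →L[ℝ] F)
      (E := fun x => V x →L[ℝ] V x) x ((R.toFun x).restrictScalars ℝ))).1 (R.smooth x).continuousAt
    have h2 := h1.2.norm.eventually_lt_const (lt_add_one _)
    dsimp only at h2
    set N : ℝ := ‖ContinuousLinearMap.inCoordinates F V F V x x x x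
      ((R.toFun x).restrictScalars ℝ)‖ + 1
    refine ⟨D * (N * C), ?_⟩
    filter_upwards [hC', hD', h2, (trivializationAt F V x).open_baseSet.mem_nhds
      (FiberBundle.mem_baseSet_trivializationAt' x)] with y hy1 hy2 hy3 hy4 v
    set e := trivializationAt F V x
    set A := ContinuousLinearMap.inCoordinates F V F V x y x y ((R.toFun y).restrictScalars ℝ)
    have h3 : R.toFun y v = e.symmL ℝ y (A (e.continuousLinearMapAt ℝ y v)) := by
      simp only [A, ContinuousLinearMap.inCoordinates, ContinuousLinearMap.coe_comp,
        Function.comp_apply, e]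
      rw [Bundle.Trivialization.symmL_continuousLinearMapAt _ hy4,
        Bundle.Trivialization.symmL_continuousLinearMapAt _ hy4]
      rfl
    rw [h3]
    calc ‖e.symmL ℝ y (A (e.continuousLinearMapAt ℝ y v))‖
        ≤ D * ‖A (e.continuousLinearMapAt ℝ y v)‖ :=
          ContinuousLinearMap.le_of_opNorm_le _ hy2.le _
      _ ≤ D * (N * ‖e.continuousLinearMapAt ℝ y v‖) := by
          gcongr
          exact ContinuousLinearMap.le_of_opNorm_le _ hy3.le _
      _ ≤ D * (N * (C * ‖v‖)) := by
          gcongr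
          exact ContinuousLinearMap.le_of_opNorm_le _ hy1.le _
      _ = _ := by ring
  choose M hM using key
  obtain ⟨t, -, ht⟩ := isCompact_univ.elim_nhds_subcover _ fun x _ => hM x
  refine ⟨∑ x ∈ t, |M x|, Finset.sum_nonneg fun _ _ => abs_nonneg _, fun y v => ?_⟩
  obtain ⟨x, hx, hy⟩ := mem_iUnion₂.1 (ht (mem_univ y))
  refine (hy v).trans ?_
  gcongr
  exact (le_abs_self _).trans (Finset.single_le_sum (f := fun x => |M x|)
    (fun _ _ => abs_nonneg _) hx)

variable [SmoothScalars 𝕜 F V]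

/-- The action of the endomorphism on test sections. -/
def onTest : testSections 𝕜 F V I →ₗ[𝕜] testSections 𝕜 F V I where
  toFun s := ⟨fun y => R.twist I y (s.1 y), by
    obtain ⟨hs, K, hK, hsK⟩ := s.2
    refine ⟨fun x u hu => ?_, K, hK, fun y hy => by simp [hsK y hy]⟩
    have h1 : localRep u (fun y => R.twist I y (s.1 y))
        = fun y => ((R.toFun y).restrictScalars ℝ) (localRep u s.1 y) := by
      funext y
      by_cases h : y ∈ U
      · simp [localRep, h, contract_twist]
      · simp [localRep, h]
    rw [h1]
    exact ContMDiffAt.clm_bundle_apply (F₁ := F) (F₂ := F) (E₁ := V) (E₂ := V) (b := fun y => y)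
      (R.smooth x) (hs x u hu)⟩
  map_add' s t := by
    apply Subtype.ext
    funext y
    simp
  map_smul' c s := by
    apply Subtype.ext
    funext y
    simp

variable [IsContMDiffRiemannianBundle (𝓡 3) ∞ F V]

lemma exists_bound_onTest : ∃ M : ℝ, ∀ s : PreL 𝕜 F V I,
    ‖(show PreL 𝕜 F V I from R.onTest (show testSections 𝕜 F V I from s))‖ ≤ M * ‖s‖ := by
  obtain ⟨M, hM0, hM⟩ := R.exists_bound
  refine ⟨M, fun s => ?_⟩
  refine (sq_le_sq₀ (norm_nonneg _) (mul_nonneg hM0 (norm_nonneg _))).1 ?_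
  rw [mul_pow, norm_sq_preL, norm_sq_preL, ← integral_const_mul]
  refine integral_mono_of_nonneg (Filter.Eventually.of_forall fun y => sq_nonneg _)
    ((integrable_contract_sq 𝕜 F _).const_mul _) (Filter.Eventually.of_forall fun y => ?_)
  change ‖contract _ (R.twist I y (s.1 y))‖ ^ 2 ≤ M ^ 2 * ‖_‖ ^ 2
  rw [contract_twist, ← mul_pow]
  gcongr
  exact hM _ _

/-- The bounded operator on `𝕃` given by the endomorphism. -/
def onL : LSpace 𝕜 F V I →L[𝕜] LSpace 𝕜 F V I :=
  ContinuousLinearMap.completion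
    (LinearMap.mkContinuousOfExistsBound (E := PreL 𝕜 F V I) (F := PreL 𝕜 F V I)
      (show PreL 𝕜 F V I →ₗ[𝕜] PreL 𝕜 F V I from (R.onTest (I := I)))
      R.exists_bound_onTest)

lemma onL_toL (s : testSections 𝕜 F V I) : R.onL (toL s) = toL (R.onTest s) :=
  UniformSpace.Completion.map_coe (ContinuousLinearMap.uniformContinuous _) _

end SymmetricEndomorphism

end Endomorphism

/-! ### Group actions -/

/-- The isometry of `S³` induced by a linear isometry of `ℝ⁴`. -/
def rotate (g : E4 ≃ₗᵢ[ℝ] E4) (x : S3) : S3 := ⟨g x, by simp⟩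

/-- The group `G` of isometries of `S³` maps the open set `U` to itself. -/
def Preserves (G : Subgroup (E4 ≃ₗᵢ[ℝ] E4)) (U : TopologicalSpace.Opens S3) : Prop :=
  ∀ g ∈ G, ∀ x ∈ U, rotate g x ∈ U

lemma continuous_rotate (g : E4 ≃ₗᵢ[ℝ] E4) : Continuous (rotate g) := by
  unfold rotate
  fun_prop

open scoped Pointwise in
lemma measurePreserving_rotate (g : E4 ≃ₗᵢ[ℝ] E4) :
    MeasurePreserving (rotate g) surfaceMeasure surfaceMeasure := by
  refine ⟨(continuous_rotate g).measurable, ?_⟩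
  ext A hA
  rw [Measure.map_apply (continuous_rotate g).measurable hA, surfaceMeasure,
    Measure.toSphere_apply' _ hA, Measure.toSphere_apply' _ ((continuous_rotate g).measurable hA)]
  have h1 : Ioo (0 : ℝ) 1 • ((fun x : S3 => (x : E4)) '' (rotate g ⁻¹' A))
      = g ⁻¹' (Ioo (0 : ℝ) 1 • ((fun x : S3 => (x : E4)) '' A)) := by
    ext z
    simp only [mem_preimage, Set.mem_smul, mem_image]
    constructor
    · rintro ⟨r, hr, _, ⟨x, hx, rfl⟩, rfl⟩
      exact ⟨r, hr, _, ⟨rotate g x, hx, rfl⟩, by simp [rotate]⟩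
    · rintro ⟨r, hr, _, ⟨x, hx, rfl⟩, h⟩
      refine ⟨r, hr, _, ⟨rotate g.symm x, ?_, rfl⟩, ?_⟩
      · have : rotate g (rotate g.symm x) = x := Subtype.ext (by simp [rotate])
        simpa [mem_preimage, this] using hx
      · apply g.injective
        simp [rotate, h]
  have h2 := g.measurePreserving.measure_preimage_equiv
    (f := g.toHomeomorph.toMeasurableEquiv) (Ioo (0 : ℝ) 1 • ((fun x : S3 => (x : E4)) '' A))
  rw [h1]
  exact congrArg _ h2

section Action

variable {G : Subgroup (E4 ≃ₗᵢ[ℝ] E4)} (hG : Preserves G U)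

/-- The action of `G` on `U`. -/
def act (hG : Preserves G U) (g : G) : U ≃ₜ U where
  toFun x := ⟨rotate g x, hG g g.2 x x.2⟩
  invFun x := ⟨rotate (g⁻¹ : G) x, hG _ (g⁻¹).2 x x.2⟩
  left_inv x := by
    apply Subtype.ext
    apply Subtype.ext
    exact (g : E4 ≃ₗᵢ[ℝ] E4).symm_apply_apply _
  right_inv x := by
    apply Subtype.ext
    apply Subtype.ext
    exact (g : E4 ≃ₗᵢ[ℝ] E4).apply_symm_apply _
  continuous_toFun := by
    exact ((continuous_rotate g).comp continuous_subtype_val).subtype_mk _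
  continuous_invFun := by
    exact ((continuous_rotate (g⁻¹ : G)).comp continuous_subtype_val).subtype_mk _

lemma measurePreserving_act (g : G) :
    MeasurePreserving (act hG g) (measureOn U) (measureOn U) := by
  refine ⟨(act hG g).continuous.measurable, ?_⟩
  have hU := MeasurableEmbedding.subtype_coe (s := (U : Set S3)) U.2.measurableSet
  have hm : Measurable (act hG g) := (act hG g).continuous.measurable
  have h0 : ∀ B : Set U, measureOn U B = surfaceMeasure (Subtype.val '' B) := fun B =>
    hU.comap_apply surfaceMeasure B
  ext A hA
  have h1 := (measurePreserving_rotate (g : E4 ≃ₗᵢ[ℝ] E4)).measure_preimage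
      (hU.measurableSet_image.2 hA).nullMeasurableSet
  rw [Measure.map_apply hm hA, h0, h0]
  refine Eq.trans ?_ h1
  congr 1
  ext z
  constructor
  · rintro ⟨y, hy, rfl⟩
    exact ⟨act hG g y, hy, rfl⟩
  · rintro ⟨y, hy, hz⟩
    have h1 : (act hG g).symm y = (⟨z, by
      have h2 : rotate (g⁻¹ : G) (y : S3) = z := by
        rw [hz]
        exact Subtype.ext ((g : E4 ≃ₗᵢ[ℝ] E4).symm_apply_apply _)
      rw [← h2]
      exact hG _ (g⁻¹).2 _ y.2⟩ : U) := by
      rw [Homeomorph.symm_apply_eq]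
      exact Subtype.ext hz
    refine ⟨(act hG g).symm y, ?_, congrArg Subtype.val h1⟩
    simpa using hy

variable (V I G) in
/-- A lift of the action of `G` on `U` to a fiberwise linear, isometric action on the total space of
`V ⊗ I`: for `g ∈ G` there is a smooth family of linear isometries `δ_g` from the fiber at `g x`
to the fiber at `x`, and these are compatible with the group law. -/
structure IsometricLift where
  /-- the linear map from the fiber at `g x` to the fiber at `x` -/
  δ : ∀ (g : G) (x : U), V (act hG g x) ⊗[ℝ] I (act hG g x) →ₗ[𝕜] V x ⊗[ℝ] I x
  isometry : ∀ g x s t, fiberInner 𝕜 x (δ g x s) (δ g x t) = fiberInner 𝕜 (act hG g x) s t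
  smooth : ∀ (g : G) (s : RoughSection V I), IsSmooth F s →
    IsSmooth F (fun x => δ g x (s (act hG g x)))
  comp : ∀ (g h : G) (s : RoughSection V I),
    (fun x => δ g x (δ h (act hG g x) (s (act hG h (act hG g x)))))
      = fun x => δ (h * g) x (s (act hG (h * g) x))

namespace IsometricLift

variable {𝕜 F hG} (δ : IsometricLift 𝕜 F V I G hG) [SmoothScalars 𝕜 F V]

/-- The action of `g ∈ G` on test sections, which sends `s` to the section `x ↦ δ_g (s (g x))`. -/
def onTest (g : G) : testSections 𝕜 F V I →ₗ[𝕜] testSections 𝕜 F V I where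
  toFun s := ⟨fun x => δ.δ g x (s.1 (act hG g x)), by
    obtain ⟨hs, K, hK, hsK⟩ := s.2
    refine ⟨δ.smooth g _ hs, act hG g ⁻¹' K, (act hG g).isCompact_preimage.2 hK, fun y hy => ?_⟩
    change δ.δ g y (s.1 (act hG g y)) = 0
    rw [hsK _ hy, map_zero]⟩
  map_add' s t := by
    apply Subtype.ext
    funext y
    simp
  map_smul' c s := by
    apply Subtype.ext
    funext y
    simp

lemma innerL_onTest (g : G) (s t : testSections 𝕜 F V I) :
    innerL 𝕜 F (δ.onTest g s) (δ.onTest g t) = innerL 𝕜 F s t := by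
  simp only [innerL, onTest, LinearMap.coe_mk, AddHom.coe_mk, δ.isometry]
  exact (measurePreserving_act hG g).integral_comp (act hG g).measurableEmbedding
    (fun y => fiberInner 𝕜 y (s.1 y) (t.1 y))

variable [IsContMDiffRiemannianBundle (𝓡 3) ∞ F V]

lemma exists_bound_onTest (g : G) : ∃ M : ℝ, ∀ s : PreL 𝕜 F V I,
    ‖(show PreL 𝕜 F V I from δ.onTest g (show testSections 𝕜 F V I from s))‖ ≤ M * ‖s‖ := by
  refine ⟨1, fun s => ?_⟩
  rw [one_mul]
  refine (sq_le_sq₀ (norm_nonneg _) (norm_nonneg _)).1 (le_of_eq ?_)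
  rw [← inner_self_eq_norm_sq (𝕜 := 𝕜) s, ← inner_self_eq_norm_sq (𝕜 := 𝕜)]
  exact congrArg RCLike.re (δ.innerL_onTest g s s)

/-- The action of `g ∈ G` on `𝕃`. -/
def onL (g : G) : LSpace 𝕜 F V I →L[𝕜] LSpace 𝕜 F V I :=
  ContinuousLinearMap.completion
    (LinearMap.mkContinuousOfExistsBound (E := PreL 𝕜 F V I) (F := PreL 𝕜 F V I)
      (show PreL 𝕜 F V I →ₗ[𝕜] PreL 𝕜 F V I from δ.onTest g) (δ.exists_bound_onTest g))

lemma onL_toL (g : G) (s : testSections 𝕜 F V I) : δ.onL g (toL s) = toL (δ.onTest g s) :=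
  UniformSpace.Completion.map_coe (ContinuousLinearMap.uniformContinuous _) _

/-- The subspace of `G`-invariant elements of `𝕃`. -/
def invariants : Submodule 𝕜 (LSpace 𝕜 F V I) :=
  ⨅ g : G, LinearMap.eqLocus (δ.onL g : LSpace 𝕜 F V I →ₗ[𝕜] LSpace 𝕜 F V I) LinearMap.id

lemma mem_invariants {ψ : LSpace 𝕜 F V I} : ψ ∈ δ.invariants ↔ ∀ g : G, δ.onL g ψ = ψ := by
  simp [invariants]

end IsometricLift

end Action

/-! ### Eigensections -/

section Energy

variable [SmoothScalars 𝕜 F V] [IsContMDiffRiemannianBundle (𝓡 3) ∞ F V]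
  [FiniteDimensional ℝ F] [ContMDiffVectorBundle ∞ F V (𝓡 3)]
  (cov : CovariantDerivative (𝓡 3) F V)

variable {𝕜 F}

/-- The sesquilinear form `∫ ⟨∇η, ∇ψ⟩ + ∫ ⟨η, Rψ⟩` of the operator `∇†∇ + R`. -/
def energy (R : SymmetricEndomorphism 𝕜 F V) (η ψ : testSections 𝕜 F V I) : 𝕜 :=
  innerH 𝕜 F cov η ψ + innerL 𝕜 F η (R.onTest ψ)

/-- The operator `∇†∇ + R` on sections of `V ⊗ I` is `G`-equivariant. Here `(∇†∇ + R)ψ` is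
regarded as the distribution `η ↦ ∫ ⟨∇η, ∇ψ⟩ + ∫ ⟨η, Rψ⟩` (which is `η ↦ ∫ ⟨η, (∇†∇ + R)ψ⟩` since
`∇†` is the formal adjoint of `∇`), and `g` maps a distribution `T` to `η ↦ T (g⁻¹ η)`. -/
def IsEquivariant {G : Subgroup (E4 ≃ₗᵢ[ℝ] E4)} {hG : Preserves G U}
    (R : SymmetricEndomorphism 𝕜 F V) (δ : IsometricLift 𝕜 F V I G hG) : Prop :=
  ∀ (g : G) (η ψ : testSections 𝕜 F V I),
    energy cov R η (δ.onTest g ψ) = energy cov R (δ.onTest g⁻¹ η) ψ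

variable [MetricConnection 𝕜 F V cov]

variable {cov} in
/-- `ψ ∈ ℍ` is an eigensection of `∇†∇ + R`: it is not zero, and there is a real number `E` with
`∫ ⟨∇η, ∇ψ⟩ + ∫ ⟨η, Rψ⟩ = E ∫ ⟨η, ψ⟩` for all `η ∈ ℍ`. Here `ι` is the map from `ℍ` to `𝕃` that
extends the identity on test sections. -/
def IsEigensection (R : SymmetricEndomorphism 𝕜 F V)
    (ι : HSpace 𝕜 F I cov →L[𝕜] LSpace 𝕜 F V I) (ψ : HSpace 𝕜 F I cov) : Prop :=
  ψ ≠ 0 ∧ ∃ E : ℝ, ∀ η : HSpace 𝕜 F I cov,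
    inner 𝕜 η ψ + inner 𝕜 (ι η) (R.onL (ι ψ)) = (E : 𝕜) * inner 𝕜 (ι η) (ι ψ)

end Energy

end Operators

/-! ### Graphs in the three-sphere and their linking circles -/

/-- A finite graph in `S³` whose edges are smoothly embedded closed arcs, parametrized by `[0, 1]`.
Distinct edges meet only in vertices. -/
structure EmbeddedGraph where
  /-- the vertices -/
  vertices : Finset S3
  /-- the number of edges -/
  numEdges : ℕ
  /-- the parametrization of an edge; only the values on `[0, 1]` matter -/
  arc : Fin numEdges → ℝ → S3
  smooth : ∀ e, ContDiffOn ℝ ∞ (fun t => (arc e t : E4)) (Icc 0 1)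
  immersed : ∀ e, ∀ t ∈ Icc (0 : ℝ) 1,
    derivWithin (fun r => (arc e r : E4)) (Icc 0 1) t ≠ 0
  injective : ∀ e, InjOn (arc e) (Icc 0 1)
  source_mem : ∀ e, arc e 0 ∈ vertices
  target_mem : ∀ e, arc e 1 ∈ vertices
  interior_notMem : ∀ e, ∀ t ∈ Ioo (0 : ℝ) 1, arc e t ∉ vertices
  disjoint : ∀ e e', e ≠ e' → ∀ t ∈ Ioo (0 : ℝ) 1, ∀ t' ∈ Icc (0 : ℝ) 1, arc e t ≠ arc e' t'

namespace EmbeddedGraph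

variable (Γ : EmbeddedGraph)

/-- The graph as a subset of `S³`. -/
def carrier : Set S3 := ↑Γ.vertices ∪ ⋃ e, Γ.arc e '' Icc 0 1

lemma isClosed_carrier : IsClosed Γ.carrier := by
  refine Γ.vertices.finite_toSet.isClosed.union (isClosed_iUnion_of_finite fun e => ?_)
  refine (isCompact_Icc.image_of_continuousOn ?_).isClosed
  exact Topology.IsInducing.subtypeVal.continuousOn_iff.2 (Γ.smooth e).continuousOn

/-- The complement `S³ ∖ Γ`. -/
def compl : TopologicalSpace.Opens S3 := ⟨Γ.carrierᶜ, Γ.isClosed_carrier.isOpen_compl⟩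

/-- Each edge has two ends, `(e, false)` at parameter `0` and `(e, true)` at parameter `1`. The
vertex at an end. -/
def endPoint (a : Fin Γ.numEdges × Bool) : S3 := Γ.arc a.1 (if a.2 then 1 else 0)

/-- The tangent vector of an edge at one of its ends, pointing into the edge. -/
def endDirection (a : Fin Γ.numEdges × Bool) : E4 :=
  if a.2 then -derivWithin (fun r => (Γ.arc a.1 r : E4)) (Icc 0 1) 1
  else derivWithin (fun r => (Γ.arc a.1 r : E4)) (Icc 0 1) 0

/-- The conditions on the graph: it is (non-empty and) connected, it has at least one edge, each
vertex has even valency, and the edges that are incident to a given vertex have distinct tangent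
rays there. -/
structure IsAdmissible : Prop where
  connected : IsConnected Γ.carrier
  pos_numEdges : 0 < Γ.numEdges
  even_valency : ∀ v ∈ Γ.vertices, Even (Nat.card {a // Γ.endPoint a = v})
  not_sameRay : ∀ a b, a ≠ b → Γ.endPoint a = Γ.endPoint b →
    ¬ SameRay ℝ (Γ.endDirection a) (Γ.endDirection b)

/-- The closed curve `c` in `S³ ∖ Γ` is a linking circle of `Γ`: it bounds a smoothly embedded
disk `D` in `S³` that meets `Γ` in a single point, which lies in the interior of the disk and in the
interior of an edge, and where the disk and the edge intersect transversally. -/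
def IsLinkingCircle (c : Circle → Γ.compl) : Prop :=
  ∃ D : ℂ → S3, ContDiff ℝ ∞ (fun z => (D z : E4)) ∧
    InjOn D (Metric.closedBall 0 1) ∧
    (∀ z ∈ Metric.closedBall (0 : ℂ) 1,
      Function.Injective (fderiv ℝ (fun w => (D w : E4)) z)) ∧
    (∀ z : Circle, (c z : S3) = D z) ∧
    ∃ z₀ ∈ Metric.ball (0 : ℂ) 1, ∃ e, ∃ t₀ ∈ Ioo (0 : ℝ) 1, D z₀ = Γ.arc e t₀ ∧
      (∀ z ∈ Metric.closedBall (0 : ℂ) 1, D z ∈ Γ.carrier ↔ z = z₀) ∧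
      deriv (fun r => (Γ.arc e r : E4)) t₀ ∉ range (fderiv ℝ (fun w => (D w : E4)) z₀)

/-- A group that maps `Γ` to itself preserves the complement of `Γ`. -/
lemma preserves_compl {G : Subgroup (E4 ≃ₗᵢ[ℝ] E4)}
    (hG : ∀ g ∈ G, rotate g '' Γ.carrier = Γ.carrier) : Preserves G Γ.compl := by
  intro g hg x hx hgx
  refine hx ?_
  rw [← hG g hg] at hgx
  obtain ⟨y, hy, hyx⟩ := hgx
  have h : y = x := by
    apply Subtype.ext
    apply g.injective
    exact congrArg Subtype.val hyx
  exact h ▸ hy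

end EmbeddedGraph

/-- The real line bundle `I` restricts to the Möbius bundle on the closed curve `c`: the restriction
is not trivial, that is, it has no nowhere vanishing continuous section. -/
def IsMoebius {U : TopologicalSpace.Opens S3} (I : U → Type*) [TopologicalSpace (TotalSpace ℝ I)]
    [∀ x, NormedAddCommGroup (I x)] (c : Circle → U) : Prop :=
  ¬ ∃ u : ∀ z, I (c z), Continuous (fun z => TotalSpace.mk' ℝ (c z) (u z)) ∧ ∀ z, u z ≠ 0

end TwistedSphere

end

open TwistedSphere

noncomputable section

set_option linter.unusedSectionVars false

namespace TwistedSphere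

open scoped ENNReal

/-! ### Spectral theory: compact symmetric operators and the abstract weak eigenvalue problem -/

section Spectral

variable {𝕜 : Type*} [RCLike 𝕜]

/-! The eigensections are the eigenvectors of a compact self-adjoint solution operator. Two analytic
facts carry this: the Dirichlet norm dominates the `L²` norm, and the resulting map from `ℍ` to `𝕃`
is compact.

Domination (`exists_norm_toL_le`). Choose finitely many global sections `σ j` of `V` that span every
fiber. Contracting a test section `s` with `σ j` gives a section of `I`, so on a linking circle,
where `I` is a Möbius bundle, the contraction has a zero. Integrating the derivative from that zero
bounds `|s|` on the circle by a constant times the radius times the integral of `|s| + |∇s|`; on a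
short circle the term with `|s|` is absorbed (`le_integral_of_exists_zero`). Near an interior point
of an edge, suitable small rotation circles are linking circles and pass through all points of an
open set `W` (`exists_eventually_isLinkingCircle`). Integrating over the rotations, which preserve
the measure, gives an `L²` bound on `W`. By Kato's inequality the function `|s|`, extended by zero
across the graph, has gradient at most `|∇s|` on all of `S³`, so a Poincaré inequality relative to
`W` (`exists_global_poincare`) spreads the bound from `W` to the connected sphere.

Compactness (`isCompactOperator_embed`). This is a Rellich argument. The part of the complement near
the graph has small measure and so carries little `L²` mass relative to the energy
(`exists_small_set_bound`). On the compact remainder, local unit sections of `I` turn `s` into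
finitely many real functions, and their integrals over small cells control `s` up to a small
multiple of the energy (`exists_functionals`). Finitely many bounded functionals plus a small error
give total boundedness.

Spectral theory (`exists_weak_eigenvectors`). Adding `c = ‖R‖` makes the form coercive on `ℍ`. The
solution operator on `𝕃` is compact, symmetric and injective. It preserves the invariant subspace,
since a translate of a solution with invariant right hand side solves the same equation, which has
only one solution (`IsEquivariant.embed_mem_invariants`). That subspace has infinite dimension:
average over `G` bump sections whose supports have disjoint translates. -/

lemma countable_of_orthonormal {K : Type*} [NormedAddCommGroup K] [InnerProductSpace 𝕜 K]
    [TopologicalSpace.SeparableSpace K] {α : Type*} {v : α → K} (hv : Orthonormal 𝕜 v) :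
    Countable α := by
  -- Orthonormal vectors are at distance `√2`, so the balls of radius `1/2` around them are disjoint
  -- open sets, of which a separable space has only countably many.
  have hd : ∀ a b, a ≠ b → 1 ≤ dist (v a) (v b) := by
    intro a b hab
    have h1 : ‖v a - v b‖ ^ 2 = 2 := by
      rw [@norm_sub_sq 𝕜, hv.1 a, hv.1 b, hv.2 hab]
      norm_num
    rw [dist_eq_norm]
    nlinarith [norm_nonneg (v a - v b)]
  have h2 : (univ : Set α).PairwiseDisjoint (fun a => Metric.ball (v a) (1 / 2)) := by
    intro a _ b _ hab
    refine Metric.ball_disjoint_ball ?_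
    have := hd a b hab
    linarith
  exact countable_univ_iff.1 (h2.countable_of_isOpen (fun _ _ => Metric.isOpen_ball)
    (fun a _ => ⟨v a, Metric.mem_ball_self (by norm_num)⟩))

/-- The range is a countable union of images of balls, which are relatively compact, so it is
separable. By symmetry its orthogonal complement is the kernel, so injectivity makes it dense. This
yields countability of the eigenbasis without assuming separability. -/
lemma separableSpace_of_compact_symmetric {K : Type*} [NormedAddCommGroup K]
    [InnerProductSpace 𝕜 K] [CompleteSpace K] (T : K →L[𝕜] K) (hc : IsCompactOperator T)
    (hs : T.IsSymmetric) (hinj : ∀ x, T x = 0 → x = 0) : TopologicalSpace.SeparableSpace K := by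
  have h1 : TopologicalSpace.IsSeparable (range T) := by
    have h2 : range T ⊆ ⋃ n : ℕ, closure (T '' Metric.closedBall 0 n) := by
      rintro _ ⟨x, rfl⟩
      obtain ⟨n, hn⟩ := exists_nat_ge ‖x‖
      exact mem_iUnion.2 ⟨n, subset_closure ⟨x, by simpa using hn, rfl⟩⟩
    refine TopologicalSpace.IsSeparable.mono (TopologicalSpace.IsSeparable.iUnion fun n => ?_) h2
    exact (IsCompactOperator.isCompact_closure_image_closedBall (f := (T : K →ₗ[𝕜] K)) hc
      n).isSeparable
  have h3 : (LinearMap.range (T : K →ₗ[𝕜] K)).topologicalClosure = ⊤ := by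
    rw [Submodule.topologicalClosure_eq_top_iff]
    rw [Submodule.eq_bot_iff]
    intro x hx
    refine hinj x (ext_inner_left 𝕜 fun y => ?_)
    have := (Submodule.mem_orthogonal _ _).1 hx (T y) ⟨y, rfl⟩
    rw [inner_zero_right, ← this]
    exact (hs y x).symm
  have h4 : closure (range T) = univ := by
    have := congrArg (fun s : Submodule 𝕜 K => (s : Set K)) h3
    simpa only [Submodule.topologicalClosure_coe, Submodule.top_coe, LinearMap.coe_range,
      ContinuousLinearMap.coe_coe] using this
  rw [← TopologicalSpace.isSeparable_univ_iff, ← h4]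
  exact h1.closure

/-- An injective compact symmetric operator on an infinite-dimensional Hilbert space has a
countably infinite orthonormal basis of eigenvectors. -/
theorem exists_orthonormal_eigenvectors {K : Type*} [NormedAddCommGroup K]
    [InnerProductSpace 𝕜 K] [CompleteSpace K] (T : K →L[𝕜] K) (hc : IsCompactOperator T)
    (hs : T.IsSymmetric) (hinj : ∀ x, T x = 0 → x = 0) (hinf : ¬ FiniteDimensional 𝕜 K) :
    ∃ B : Set K, B.Countable ∧ B.Infinite ∧ Orthonormal 𝕜 (Subtype.val : B → K) ∧
      (∀ b ∈ B, ∃ μ : ℝ, μ ≠ 0 ∧ T b = (μ : 𝕜) • b) ∧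
      (Submodule.span 𝕜 B).topologicalClosure = ⊤ := by
  have hsep := separableSpace_of_compact_symmetric T hc hs hinj
  let W : 𝕜 → Submodule 𝕜 K := fun μ => Module.End.eigenspace (T : Module.End 𝕜 K) μ
  have hclosed : ∀ μ, IsClosed (W μ : Set K) := by
    intro μ
    have : (W μ : Set K) = {x | T x = μ • x} := by
      ext x
      simp [W]
    rw [this]
    exact isClosed_eq T.continuous (continuous_const_smul μ)
  have hcomp : ∀ μ, CompleteSpace (W μ) := fun μ => (hclosed μ).completeSpace_coe
  -- A Hilbert basis of every eigenspace; eigenspaces are mutually orthogonal, so together these are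
  -- orthonormal, and by the spectral theorem their span is dense.
  choose w b hb using fun μ => exists_hilbertBasis 𝕜 (W μ)
  have hfam := LinearMap.IsSymmetric.orthogonalFamily_eigenspaces hs
  let f : (Σ μ, w μ) → K := fun p => ((b p.1 p.2 : W p.1) : K)
  have hf : Orthonormal 𝕜 f := hfam.orthonormal_sigma_orthonormal fun μ => (b μ).orthonormal
  have hfe : ∀ p, T (f p) = p.1 • f p := fun p =>
    Module.End.mem_eigenspace_iff.1 (b p.1 p.2 : W p.1).2
  have hspan : (Submodule.span 𝕜 (range f)).topologicalClosure = ⊤ := by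
    rw [← top_le_iff]
    have h1 : (⨆ μ, W μ).topologicalClosure = ⊤ := by
      rw [Submodule.topologicalClosure_eq_top_iff]
      exact ContinuousLinearMap.orthogonalComplement_iSup_eigenspaces_eq_bot hc hs
    rw [← h1]
    refine Submodule.topologicalClosure_minimal _ (iSup_le fun μ => ?_)
      (Submodule.isClosed_topologicalClosure _)
    intro x hx
    have h2 : (⟨x, hx⟩ : W μ) ∈ (Submodule.span 𝕜 (range (b μ))).topologicalClosure := by
      rw [(b μ).dense_span]
      trivial
    have h3 := (W μ).subtypeL.continuous.continuousOn.image_closure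
      (s := (Submodule.span 𝕜 (range (b μ)) : Set (W μ)))
    have h4 : x ∈ closure ((W μ).subtypeL '' (Submodule.span 𝕜 (range (b μ)) : Set (W μ))) :=
      h3 ⟨⟨x, hx⟩, h2, rfl⟩
    refine closure_mono ?_ h4
    rintro _ ⟨y, hy, rfl⟩
    have h5 : (Submodule.span 𝕜 (range (b μ))).map (W μ).subtype
        ≤ Submodule.span 𝕜 (range f) := by
      rw [Submodule.map_span, Submodule.span_le]
      rintro _ ⟨_, ⟨i, rfl⟩, rfl⟩
      exact Submodule.subset_span ⟨⟨μ, i⟩, rfl⟩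
    exact h5 ⟨y, hy, rfl⟩
  have hcount : (range f).Countable := by
    have := countable_of_orthonormal hf
    exact countable_range f
  refine ⟨range f, hcount, ?_, hf.toSubtypeRange, ?_, hspan⟩
  · intro hfin
    have := hfin.to_subtype
    -- A finite family would have a closed span, which by density would be the whole space.
    have h1 : FiniteDimensional 𝕜 (Submodule.span 𝕜 (range f)) :=
      FiniteDimensional.span_of_finite 𝕜 hfin
    have h2 : (Submodule.span 𝕜 (range f)).topologicalClosure = Submodule.span 𝕜 (range f) :=
      (Submodule.closed_of_finiteDimensional _).submodule_topologicalClosure_eq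
    rw [h2] at hspan
    rw [hspan] at h1
    exact hinf (Module.Finite.equiv (Submodule.topEquiv (R := 𝕜) (M := K)))
  · rintro _ ⟨p, rfl⟩
    have hp : f p ≠ 0 := hf.ne_zero p
    have hev : Module.End.HasEigenvalue (T : Module.End 𝕜 K) p.1 :=
      Module.End.hasEigenvalue_of_hasEigenvector
        ⟨Module.End.mem_eigenspace_iff.2 (hfe p), hp⟩
    have hreal : ((RCLike.re p.1 : ℝ) : 𝕜) = p.1 :=
      RCLike.conj_eq_iff_re.1 (LinearMap.IsSymmetric.conj_eigenvalue_eq_self hs hev)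
    refine ⟨RCLike.re p.1, fun h0 => hp (hinj _ ?_), ?_⟩
    · rw [hfe p, ← hreal, h0]
      simp
    · rw [hreal]
      exact hfe p

/-- Eigenvectors of the form `⟪η, u⟫ + ⟪ι η, R ι u⟫` relative to `⟪ι η, ι u⟫` for a compact map `ι`
with dense range form an orthonormal basis of each closed subspace that is preserved by the
solution operator. -/
theorem exists_weak_eigenvectors {H L : Type*} [NormedAddCommGroup H] [InnerProductSpace 𝕜 H]
    [CompleteSpace H] [NormedAddCommGroup L] [InnerProductSpace 𝕜 L] [CompleteSpace L]
    (ι : H →L[𝕜] L) (hι : IsCompactOperator ι) (hd : DenseRange ι) (R : L →L[𝕜] L)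
    (hR : ∀ x y, ⟪R x, y⟫_𝕜 = ⟪x, R y⟫_𝕜) (c : ℝ)
    (hc : ∀ x, 0 ≤ RCLike.re ⟪x, R x⟫_𝕜 + c * ‖x‖ ^ 2)
    (K : Submodule 𝕜 L) (hKc : IsClosed (K : Set L))
    (hK : ∀ (u : H) (x : L), x ∈ K → (∀ η, ⟪η, u⟫_𝕜 + ⟪ι η, R (ι u)⟫_𝕜
      + (c : 𝕜) * ⟪ι η, ι u⟫_𝕜 = ⟪ι η, x⟫_𝕜) → ι u ∈ K)
    (hinf : ¬ FiniteDimensional 𝕜 K) :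
    ∃ S : Set H, S.Countable ∧ S.Infinite ∧
      (∀ ψ ∈ S, ψ ≠ 0 ∧ (∃ E : ℝ, ∀ η, ⟪η, ψ⟫_𝕜 + ⟪ι η, R (ι ψ)⟫_𝕜 = (E : 𝕜) * ⟪ι η, ι ψ⟫_𝕜)
        ∧ ι ψ ∈ K) ∧
      Orthonormal 𝕜 (fun ψ : S => ι ψ) ∧ (Submodule.span 𝕜 (ι '' S)).topologicalClosure = K := by
  -- `J x` represents the functional `η ↦ ⟪ι η, x⟫` on `H`, so that the weak equation shifted by `c`
  -- reads `A u = J x`.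
  let J : L →L[𝕜] H := ContinuousLinearMap.adjoint ι
  have hJ : ∀ η x, ⟪η, J x⟫_𝕜 = ⟪ι η, x⟫_𝕜 := fun η x => ContinuousLinearMap.adjoint_inner_right ι η x
  let A : H →L[𝕜] H := ContinuousLinearMap.id 𝕜 H + J ∘L (R + (c : 𝕜) • ContinuousLinearMap.id 𝕜 L) ∘L ι
  have hA : ∀ η u, ⟪η, A u⟫_𝕜 = ⟪η, u⟫_𝕜 + ⟪ι η, R (ι u)⟫_𝕜 + (c : 𝕜) * ⟪ι η, ι u⟫_𝕜 := by
    intro η u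
    simp only [A, _root_.add_apply, ContinuousLinearMap.comp_apply,
      ContinuousLinearMap.id_apply, _root_.smul_apply, inner_add_right, hJ,
      inner_smul_right, map_add, map_smul]
    ring
  have hAsymm : ∀ η u, ⟪η, A u⟫_𝕜 = ⟪A η, u⟫_𝕜 := by
    intro η u
    rw [← inner_conj_symm (A η) u, hA, hA]
    simp only [map_add, map_mul, inner_conj_symm, RCLike.conj_ofReal, hR]
  -- Coercivity: the shift `c` makes the zeroth order part of the form nonnegative. Hence `A` is
  -- invertible.
  have hAco : ∀ u, ‖u‖ ^ 2 ≤ RCLike.re ⟪u, A u⟫_𝕜 := by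
    intro u
    have h1 := hc (ι u)
    have h2 : RCLike.re ((c : 𝕜) * ⟪ι u, ι u⟫_𝕜) = c * ‖ι u‖ ^ 2 := by
      rw [RCLike.re_ofReal_mul, inner_self_eq_norm_sq]
    rw [hA, map_add, map_add, h2, inner_self_eq_norm_sq]
    linarith
  have hAunit : IsUnit A := by
    refine ContinuousLinearMap.isUnit_of_forall_le_norm_inner_map A (c := 1) one_pos fun x => ?_
    rw [← hAsymm]
    simpa using (hAco x).trans (RCLike.re_le_norm _)
  obtain ⟨Ae, hAe⟩ := hAunit
  let B : H →L[𝕜] H := (↑(Ae⁻¹) : H →L[𝕜] H)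
  have hAB : ∀ x, A (B x) = x := by
    intro x
    have h1 : (Ae : H →L[𝕜] H) * (↑(Ae⁻¹) : H →L[𝕜] H) = 1 := Ae.mul_inv
    rw [hAe] at h1
    exact congrArg (fun f : H →L[𝕜] H => f x) h1
  have hBsymm : ∀ x y, ⟪B x, y⟫_𝕜 = ⟪x, B y⟫_𝕜 := by
    intro x y
    rw [← hAB y, hAsymm, hAB, hAB]
  -- The solution operator, seen on `L`. It is compact because `ι` is.
  let T : L →L[𝕜] L := ι ∘L B ∘L J
  have hTs : T.IsSymmetric := by
    intro x y
    change ⟪ι (B (J x)), y⟫_𝕜 = ⟪x, ι (B (J y))⟫_𝕜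
    rw [← hJ, hBsymm, ← inner_conj_symm, hJ, inner_conj_symm]
  -- If `T x = 0`, the form at `B (J x)` equals `⟪T x, x⟫ = 0`, so coercivity gives `J x = 0`. Then
  -- `x` is orthogonal to the dense range of `ι`.
  have hTinj : ∀ x, T x = 0 → x = 0 := by
    intro x hx
    have h1 : ⟪B (J x), A (B (J x))⟫_𝕜 = 0 := by
      rw [hAB, hJ]
      change ⟪T x, x⟫_𝕜 = 0
      rw [hx, inner_zero_left]
    have h2 := hAco (B (J x))
    rw [h1] at h2
    have h3 : B (J x) = 0 := by
      have : ‖B (J x)‖ ^ 2 ≤ 0 := by simpa using h2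
      simpa using this
    have h4 : J x = 0 := by rw [← hAB (J x), h3, map_zero]
    have h5 : ∀ η, ⟪ι η, x⟫_𝕜 = 0 := fun η => by rw [← hJ, h4, inner_zero_right]
    have h6 : ∀ y, ⟪y, x⟫_𝕜 = 0 := by
      intro y
      exact congrFun (DenseRange.equalizer (g := fun y => ⟪y, x⟫_𝕜) (h := fun _ => (0 : 𝕜))
        hd (by fun_prop) continuous_const (funext h5)) y
    exact inner_self_eq_zero.1 (h6 x)
  have hTc : IsCompactOperator T := hι.comp_clm (B ∘L J)
  have hTK : ∀ x ∈ K, T x ∈ K := by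
    intro x hx
    refine hK (B (J x)) x hx fun η => ?_
    rw [← hA, hAB, hJ]
  have : CompleteSpace K := hKc.completeSpace_coe
  let TK : K →L[𝕜] K := T.restrict hTK
  have hTKa : ∀ x : K, ((TK x : K) : L) = T x := fun x => rfl
  obtain ⟨Z, hZ1, hZ2, hZ3, hZ4, hZ5⟩ := exists_orthonormal_eigenvectors TK
    (hTc.restrict' (f := (T : L →ₗ[𝕜] L)) hTK) (fun x y => hTs x y)
    (fun x hx => Subtype.ext (hTinj x (by rw [← hTKa, hx]; rfl))) hinf
  choose! μ hμ0 hμ using hZ4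
  -- The lift of an eigenvector `b` of `T` to `H`: since `ι (B (J b)) = μ b`, dividing by `μ` gives
  -- `ι (f b) = b`.
  let f : K → H := fun b => ((μ b : 𝕜)⁻¹) • B (J b)
  have hμ' : ∀ b ∈ Z, (μ b : 𝕜) ≠ 0 := fun b hb => by exact_mod_cast hμ0 b hb
  have hf : ∀ b ∈ Z, ι (f b) = b := by
    intro b hb
    have h1 : ι (B (J b)) = (μ b : 𝕜) • (b : L) := congrArg Subtype.val (hμ b hb)
    simp only [f, map_smul, h1]
    rw [smul_smul, inv_mul_cancel₀ (hμ' b hb), one_smul]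
  have hinj : InjOn f Z := by
    intro a ha b hb hab
    apply Subtype.ext
    rw [← hf a ha, ← hf b hb, hab]
  refine ⟨f '' Z, hZ1.image f, hZ2.image hinj, ?_, ?_, ?_⟩
  · rintro _ ⟨b, hb, rfl⟩
    -- `A (f b) = μ⁻¹ J b` is the weak equation with eigenvalue `μ⁻¹` for the shifted form; undoing
    -- the shift subtracts `c`.
    refine ⟨fun h0 => ?_, ⟨(μ b)⁻¹ - c, fun η => ?_⟩, by rw [hf b hb]; exact b.2⟩
    · have h1 := hf b hb
      rw [h0, map_zero] at h1
      exact hZ3.ne_zero ⟨b, hb⟩ (Subtype.ext h1.symm)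
    · have h1 := hA η (f b)
      have h2 : A (f b) = ((μ b : 𝕜)⁻¹) • J b := by
        simp only [f, map_smul, hAB]
      rw [h2, inner_smul_right, hJ] at h1
      rw [hf b hb] at h1 ⊢
      push_cast
      linear_combination -h1
  · have hbij : ∀ ψ : f '' Z, ∃ b : Z, f b = ψ := fun ψ => by
      obtain ⟨b, hb, h⟩ := ψ.2
      exact ⟨⟨b, hb⟩, h⟩
    choose g hg using hbij
    have hginj : Function.Injective g := by
      intro a b hab
      apply Subtype.ext
      rw [← hg a, ← hg b, hab]
    have h1 : Orthonormal 𝕜 (fun ψ : f '' Z => ((g ψ : K) : L)) :=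
      (hZ3.comp g hginj).comp_linearIsometry K.subtypeₗᵢ
    refine (congrArg (Orthonormal 𝕜) (funext fun ψ => ?_)).mp h1
    rw [← hg ψ, hf _ (g ψ).2]
  · have h1 : ι '' (f '' Z) = Subtype.val '' Z := by
      rw [image_image]
      exact image_congr hf
    have h2 : Submodule.span 𝕜 (Subtype.val '' Z) = (Submodule.span 𝕜 Z).map K.subtype := by
      rw [Submodule.map_span]
      rfl
    rw [h1]
    refine le_antisymm (Submodule.topologicalClosure_minimal _ ?_ hKc) ?_
    · rw [Submodule.span_le]
      rintro _ ⟨b, _, rfl⟩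
      exact b.2
    · intro x hx
      have h3 : (⟨x, hx⟩ : K) ∈ (Submodule.span 𝕜 Z).topologicalClosure := by
        rw [hZ5]
        trivial
      have h4 := K.subtypeL.continuous.continuousOn.image_closure
        (s := (Submodule.span 𝕜 Z : Set K)) ⟨⟨x, hx⟩, h3, rfl⟩
      rw [h2]
      exact h4

end Spectral

/-! ### The Poincaré inequality on convex sets -/

section ConvexPoincare



variable {E : Type*} [NormedAddCommGroup E] [NormedSpace ℝ E] [FiniteDimensional ℝ E]
  [MeasurableSpace E] [BorelSpace E] [SecondCountableTopology E]
  (μ : Measure E) [μ.IsAddHaarMeasure]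

/-- `g` bounds the square of the gradient of `h` along all segments with end points in `Q`. -/
def SegmentBound (Q : Set E) (h : E → ℝ) (g : E → ℝ≥0∞) : Prop :=
  ∀ x ∈ Q, ∀ y ∈ Q, ‖h x - h y‖ₑ ^ 2
    ≤ ENNReal.ofReal (‖x - y‖ ^ 2) * ∫⁻ t in Icc (0 : ℝ) 1, g (x + t • (y - x))

/-- Change of variables: the homothety keeps `Q` inside itself, and its inverse Jacobian `t⁻ⁿ` is at
most `2ⁿ` for `t ≥ 1/2`. -/
lemma lintegral_homothety_le {Q : Set E} (hQm : MeasurableSet Q) {g : E → ℝ≥0∞}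
    (hg : Measurable g) {t : ℝ} (ht : 1 / 2 ≤ t) (z : E) (hz : ∀ y ∈ Q, z + t • y ∈ Q) :
    ∫⁻ y in Q, g (z + t • y) ∂μ ≤ 2 ^ Module.finrank ℝ E * ∫⁻ y in Q, g y ∂μ := by
  have ht0 : 0 < t := by linarith
  have h1 : ∫⁻ y in Q, g (z + t • y) ∂μ ≤ ∫⁻ y, Q.indicator g (z + t • y) ∂μ := by
    rw [← lintegral_indicator hQm]
    refine lintegral_mono fun y => ?_
    by_cases hy : y ∈ Q
    · simp [hy, hz y hy]
    · simp [hy]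
  have h2 : ∫⁻ y, Q.indicator g (z + t • y) ∂μ
      = ∫⁻ y, Q.indicator g (z + y) ∂(Measure.map (t • ·) μ) := by
    rw [lintegral_map (f := fun y => Q.indicator g (z + y)) ((hg.indicator hQm).comp (measurable_const_add z))
      (measurable_const_smul t)]
  rw [Measure.map_addHaar_smul μ ht0.ne', lintegral_smul_measure,
    lintegral_add_left_eq_self (fun y => Q.indicator g y) z, lintegral_indicator hQm] at h2
  refine h1.trans (h2.trans_le ?_)
  rw [smul_eq_mul]
  gcongr
  have h3 : |(t ^ Module.finrank ℝ E)⁻¹| ≤ 2 ^ Module.finrank ℝ E := by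
    rw [abs_of_pos (by positivity), ← inv_pow]
    gcongr
    rw [inv_le_comm₀ ht0 (by norm_num)]
    linarith
  calc ENNReal.ofReal |(t ^ Module.finrank ℝ E)⁻¹| ≤ ENNReal.ofReal (2 ^ Module.finrank ℝ E) :=
        ENNReal.ofReal_le_ofReal h3
    _ = 2 ^ Module.finrank ℝ E := by
        rw [ENNReal.ofReal_pow (by norm_num)]
        simp

/-- By Tonelli the parameter `t` may be integrated last. For `t ≥ 1/2` freeze `x` and substitute in
`y`; for `t ≤ 1/2` exchange the roles of `x` and `y`, which replaces `t` by `1 - t`. The Jacobian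
therefore never degenerates. -/
lemma lintegral_segments_le {Q : Set E} (hQ : Convex ℝ Q) (hQm : MeasurableSet Q)
    {g : E → ℝ≥0∞} (hg : Measurable g) :
    ∫⁻ x in Q, ∫⁻ y in Q, (∫⁻ t in Icc (0 : ℝ) 1, g (x + t • (y - x))) ∂μ ∂μ
      ≤ 2 ^ Module.finrank ℝ E * μ Q * ∫⁻ y in Q, g y ∂μ := by
  have hF : Measurable (fun p : (E × E) × ℝ => g (p.1.1 + p.2 • (p.1.2 - p.1.1))) :=
    hg.comp (by fun_prop)
  have h1 : ∀ x, ∫⁻ y in Q, (∫⁻ t in Icc (0 : ℝ) 1, g (x + t • (y - x))) ∂μ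
      = ∫⁻ t in Icc (0 : ℝ) 1, ∫⁻ y in Q, g (x + t • (y - x)) ∂μ := by
    intro x
    refine lintegral_lintegral_swap (Measurable.aemeasurable ?_)
    exact hF.comp (f := fun p : E × ℝ => ((x, p.1), p.2)) (by fun_prop)
  simp only [h1]
  rw [lintegral_lintegral_swap]
  swap
  · refine Measurable.aemeasurable ?_
    refine Measurable.lintegral_prod_right' (f := fun p : (E × ℝ) × E =>
      g (p.1.1 + p.1.2 • (p.2 - p.1.1))) ?_
    exact hF.comp (f := fun p : (E × ℝ) × E => ((p.1.1, p.2), p.1.2)) (by fun_prop)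
  have h2 : ∀ t ∈ Icc (0 : ℝ) 1, ∫⁻ x in Q, ∫⁻ y in Q, g (x + t • (y - x)) ∂μ ∂μ
      ≤ 2 ^ Module.finrank ℝ E * μ Q * ∫⁻ y in Q, g y ∂μ := by
    intro t ht
    have key : ∀ s : ℝ, 1 / 2 ≤ s → s ≤ 1 →
        ∫⁻ x in Q, ∫⁻ y in Q, g (x + s • (y - x)) ∂μ ∂μ
          ≤ 2 ^ Module.finrank ℝ E * μ Q * ∫⁻ y in Q, g y ∂μ := by
      intro s hs hs1
      have h3 : ∀ x ∈ Q, ∫⁻ y in Q, g (x + s • (y - x)) ∂μ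
          ≤ 2 ^ Module.finrank ℝ E * ∫⁻ y in Q, g y ∂μ := by
        intro x hx
        have h4 : ∀ y, x + s • (y - x) = (1 - s) • x + s • y := fun y => by module
        simp only [h4]
        refine lintegral_homothety_le μ hQm hg hs _ fun y hy => ?_
        exact hQ hx hy (by linarith) (by linarith) (by ring)
      refine (setLIntegral_mono' hQm h3).trans ?_
      rw [setLIntegral_const]
      exact le_of_eq (by ring)
    rcases le_total (1 / 2) t with h | h
    · exact key t h ht.2
    · rw [lintegral_lintegral_swap]
      · have h4 : ∀ x y : E, x + t • (y - x) = y + (1 - t) • (x - y) := fun x y => by module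
        simp only [h4]
        exact key (1 - t) (by linarith) (by linarith [ht.1])
      · exact (hF.comp (f := fun p : E × E => (p, t)) (by fun_prop)).aemeasurable
  refine (setLIntegral_mono' measurableSet_Icc h2).trans ?_
  rw [setLIntegral_const]
  simp

/-- The Poincaré inequality on a convex set, in terms of double integrals. -/
theorem SegmentBound.lintegral_le {Q : Set E} (hQ : Convex ℝ Q) (hQm : MeasurableSet Q) {d : ℝ}
    (hd : ∀ x ∈ Q, ∀ y ∈ Q, ‖x - y‖ ≤ d) {h : E → ℝ} {g : E → ℝ≥0∞} (hg : Measurable g)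
    (hb : SegmentBound Q h g) :
    ∫⁻ x in Q, ∫⁻ y in Q, ‖h x - h y‖ₑ ^ 2 ∂μ ∂μ
      ≤ ENNReal.ofReal (d ^ 2) * 2 ^ Module.finrank ℝ E * μ Q * ∫⁻ y in Q, g y ∂μ := by
  have h1 : ∫⁻ x in Q, ∫⁻ y in Q, ‖h x - h y‖ₑ ^ 2 ∂μ ∂μ
      ≤ ∫⁻ x in Q, ∫⁻ y in Q,
        (ENNReal.ofReal (d ^ 2) * ∫⁻ t in Icc (0 : ℝ) 1, g (x + t • (y - x))) ∂μ ∂μ := by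
    refine setLIntegral_mono' hQm fun x hx => setLIntegral_mono' hQm fun y hy => ?_
    refine (hb x hx y hy).trans ?_
    gcongr
    exact hd x hx y hy
  refine h1.trans ?_
  simp only [lintegral_const_mul' _ _ ENNReal.ofReal_ne_top]
  rw [mul_assoc, mul_assoc, ← mul_assoc (2 ^ _)]
  gcongr
  exact lintegral_segments_le μ hQ hQm hg

/-- Comparison of the square integrals of a function over two subsets of `Q`. -/
lemma mul_lintegral_sq_le {Q A B : Set E} (hA : A ⊆ Q) (hB : B ⊆ Q) {h : E → ℝ}
    (hh : Measurable h) :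
    μ B * ∫⁻ x in A, ‖h x‖ₑ ^ 2 ∂μ ≤ 2 * μ A * ∫⁻ x in B, ‖h x‖ₑ ^ 2 ∂μ
      + 2 * ∫⁻ x in Q, ∫⁻ y in Q, ‖h x - h y‖ₑ ^ 2 ∂μ ∂μ := by
  have hsq : ∀ a b : ℝ, ‖a‖ₑ ^ 2 ≤ 2 * ‖b‖ₑ ^ 2 + 2 * ‖a - b‖ₑ ^ 2 := by
    intro a b
    simp only [← ofReal_norm, ← ENNReal.ofReal_pow (norm_nonneg _)]
    rw [show (2 : ℝ≥0∞) = ENNReal.ofReal 2 by simp, ← ENNReal.ofReal_mul (by norm_num),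
      ← ENNReal.ofReal_mul (by norm_num), ← ENNReal.ofReal_add (by positivity) (by positivity)]
    refine ENNReal.ofReal_le_ofReal ?_
    simp only [Real.norm_eq_abs, sq_abs]
    nlinarith [sq_nonneg (a - 2 * b)]
  have hm : Measurable fun x => ‖h x‖ₑ ^ 2 := hh.enorm.pow_const 2
  have hm2 : Measurable fun p : E × E => ‖h p.1 - h p.2‖ₑ ^ 2 :=
    ((hh.comp measurable_fst).sub (hh.comp measurable_snd)).enorm.pow_const 2
  have h1 : μ B * ∫⁻ x in A, ‖h x‖ₑ ^ 2 ∂μ = ∫⁻ x in A, ∫⁻ _ in B, ‖h x‖ₑ ^ 2 ∂μ ∂μ := by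
    simp only [setLIntegral_const]
    rw [lintegral_mul_const _ hm, mul_comm]
  have h2 : ∫⁻ x in A, ∫⁻ y in B, ‖h y‖ₑ ^ 2 ∂μ ∂μ = μ A * ∫⁻ x in B, ‖h x‖ₑ ^ 2 ∂μ := by
    rw [setLIntegral_const, mul_comm]
  calc μ B * ∫⁻ x in A, ‖h x‖ₑ ^ 2 ∂μ
      ≤ ∫⁻ x in A, ∫⁻ y in B, (2 * ‖h y‖ₑ ^ 2 + 2 * ‖h x - h y‖ₑ ^ 2) ∂μ ∂μ := by
        rw [h1]
        exact lintegral_mono fun x => lintegral_mono fun y => hsq _ _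
    _ = 2 * (μ A * ∫⁻ x in B, ‖h x‖ₑ ^ 2 ∂μ)
        + 2 * ∫⁻ x in A, ∫⁻ y in B, ‖h x - h y‖ₑ ^ 2 ∂μ ∂μ := by
        have h3 : ∀ x, ∫⁻ y in B, (2 * ‖h y‖ₑ ^ 2 + 2 * ‖h x - h y‖ₑ ^ 2) ∂μ
            = 2 * ∫⁻ y in B, ‖h y‖ₑ ^ 2 ∂μ + 2 * ∫⁻ y in B, ‖h x - h y‖ₑ ^ 2 ∂μ := by
          intro x
          rw [lintegral_add_left (hm.const_mul 2), lintegral_const_mul 2 hm,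
            lintegral_const_mul' 2 _ (by simp)]
        simp only [h3]
        rw [lintegral_add_left measurable_const, setLIntegral_const,
          lintegral_const_mul' 2 (fun x => ∫⁻ y in B, ‖h x - h y‖ₑ ^ 2 ∂μ) (by simp)]
        ring
    _ ≤ _ := by
        rw [← mul_assoc]
        gcongr

/-- The square integral of a function is controlled by its mean value and by differences. -/
lemma mul_lintegral_sq_le_mean {Q : Set E} (hQ : μ Q ≠ ⊤) {h : E → ℝ}
    (hi : MemLp h 2 (μ.restrict Q)) :
    μ Q * ∫⁻ x in Q, ‖h x‖ₑ ^ 2 ∂μ ≤ ENNReal.ofReal ((∫ x in Q, h x ∂μ) ^ 2)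
      + ∫⁻ x in Q, ∫⁻ y in Q, ‖h x - h y‖ₑ ^ 2 ∂μ ∂μ := by
  have hfin : IsFiniteMeasure (μ.restrict Q) := ⟨by simpa using hQ.lt_top⟩
  have hi1 : Integrable h (μ.restrict Q) := hi.integrable (by norm_num)
  have hi2 : Integrable (fun x => h x ^ 2) (μ.restrict Q) := hi.integrable_sq
  set m : ℝ := (μ Q).toReal with hm
  set a : ℝ := ∫ x in Q, h x ∂μ with ha
  set b : ℝ := ∫ x in Q, h x ^ 2 ∂μ with hb
  have hb0 : 0 ≤ b := integral_nonneg fun x => sq_nonneg _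
  have henorm : ∀ r : ℝ, ‖r‖ₑ ^ 2 = ENNReal.ofReal (r ^ 2) := by
    intro r
    rw [← ofReal_norm, ← ENNReal.ofReal_pow (norm_nonneg _), Real.norm_eq_abs, sq_abs]
  have hlin : ∀ x, Integrable (fun y => h x ^ 2 - 2 * h x * h y) (μ.restrict Q) := fun x =>
    (integrable_const _).sub (hi1.const_mul _)
  have hlin2 : Integrable (fun x => m * h x ^ 2 - 2 * a * h x) (μ.restrict Q) :=
    (hi2.const_mul _).sub (hi1.const_mul _)
  have h1 : ∀ x, ∫⁻ y in Q, ‖h x - h y‖ₑ ^ 2 ∂μ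
      = ENNReal.ofReal (m * h x ^ 2 - 2 * a * h x + b) := by
    intro x
    have h2 : ∀ y, (h x - h y) ^ 2 = h x ^ 2 - 2 * h x * h y + h y ^ 2 := fun y => by ring
    have hint : Integrable (fun y => h x ^ 2 - 2 * h x * h y + h y ^ 2) (μ.restrict Q) :=
      ((integrable_const _).sub (hi1.const_mul _)).add hi2
    simp only [henorm, h2]
    rw [← ofReal_integral_eq_lintegral_ofReal hint (Filter.Eventually.of_forall fun y => by
      simp only [Pi.zero_apply, ← h2]
      positivity)]
    rw [integral_add (hlin x) hi2,
      integral_sub (integrable_const _) (hi1.const_mul _), integral_const_mul]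
    congr 1
    simp [Measure.real, ← ha, ← hb, ← hm]
    ring
  have hint : Integrable (fun x => m * h x ^ 2 - 2 * a * h x + b) (μ.restrict Q) :=
    ((hi2.const_mul _).sub (hi1.const_mul _)).add (integrable_const _)
  have hnn : ∀ x, 0 ≤ m * h x ^ 2 - 2 * a * h x + b := by
    intro x
    have h2 : ∀ y, (h x - h y) ^ 2 = h x ^ 2 - 2 * h x * h y + h y ^ 2 := fun y => by ring
    have h3 : ∫ y in Q, (h x - h y) ^ 2 ∂μ = m * h x ^ 2 - 2 * a * h x + b := by
      simp only [h2]
      rw [integral_add (hlin x) hi2,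
        integral_sub (integrable_const _) (hi1.const_mul _), integral_const_mul]
      simp [Measure.real, ← ha, ← hb, ← hm]
      ring
    rw [← h3]
    exact integral_nonneg fun y => sq_nonneg _
  simp only [h1]
  rw [← ofReal_integral_eq_lintegral_ofReal hint (Filter.Eventually.of_forall hnn)]
  -- The double integral of `(h x - h y)²` is `2 (m b - a²)`, so `m b` is `a²` plus half of it.
  have h4 : ∫ x in Q, (m * h x ^ 2 - 2 * a * h x + b) ∂μ = 2 * (m * b) - 2 * a ^ 2 := by
    rw [integral_add hlin2 (integrable_const _),
      integral_sub (hi2.const_mul _) (hi1.const_mul _), integral_const_mul, integral_const_mul]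
    simp [Measure.real, ← ha, ← hb, ← hm]
    ring
  have h5 : 0 ≤ 2 * (m * b) - 2 * a ^ 2 := by
    rw [← h4]
    exact integral_nonneg hnn
  rw [h4, ← ENNReal.ofReal_add (sq_nonneg _) h5]
  simp only [henorm]
  rw [← ofReal_integral_eq_lintegral_ofReal hi2 (Filter.Eventually.of_forall fun x => sq_nonneg _),
    ← ENNReal.ofReal_toReal hQ, ← ENNReal.ofReal_mul ENNReal.toReal_nonneg]
  refine ENNReal.ofReal_le_ofReal ?_
  rw [← hm, ← hb]
  linarith

end ConvexPoincare

/-! ### Integrals over the sphere as integrals over shells of `ℝ⁴` -/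

section Shell


/-- The shell of points of norm between `a` and `b` in `ℝ⁴`. -/
def shell (a b : ℝ) : Set E4 := {y | a < ‖y‖ ∧ ‖y‖ < b}

lemma isOpen_shell (a b : ℝ) : IsOpen (shell a b) :=
  (isOpen_lt continuous_const continuous_norm).inter (isOpen_lt continuous_norm continuous_const)

lemma continuousOn_radial : ContinuousOn radial {y : E4 | y ≠ 0} := fun _ hy =>
  (contMDiffAt_radial hy).continuousAt.continuousWithinAt

lemma measurable_radial : Measurable radial := by
  refine measurable_of_continuousOn_compl_singleton 0 ?_
  exact continuousOn_radial

/-- Polar coordinates: the integrand is constant along rays, so the radial integral contributes only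
the factor `κ`. This moves questions on `S³` to `ℝ⁴`, where there are convex sets and straight
segments. -/
theorem exists_lintegral_shell {a b : ℝ} (ha : 0 ≤ a) (hab : a < b) :
    ∃ κ : ℝ≥0∞, κ ≠ 0 ∧ κ ≠ ⊤ ∧ ∀ φ : S3 → ℝ≥0∞, Measurable φ →
      ∫⁻ y in shell a b, φ (radial y) = κ * ∫⁻ x, φ x ∂surfaceMeasure := by
  let ν := Measure.volumeIoiPow (Module.finrank ℝ E4 - 1)
  let P : Set (Ioi (0 : ℝ)) := {r | a < r.1 ∧ r.1 < b}
  have hPo : IsOpen P := (isOpen_lt continuous_const continuous_subtype_val).inter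
    (isOpen_lt continuous_subtype_val continuous_const)
  refine ⟨ν P, ?_, ?_, ?_⟩
  · intro h0
    -- If the radii between `a` and `b` had measure zero, the radii below `b` would not outweigh
    -- those below the midpoint, contrary to the explicit formula. The midpoint is used because `a`
    -- may be `0`.
    have hm : 0 < (a + b) / 2 := by linarith
    have h1 : (Iio (⟨b, ha.trans_lt hab⟩ : Ioi (0 : ℝ)))
        ⊆ Iio (⟨(a + b) / 2, hm⟩ : Ioi (0 : ℝ)) ∪ P := by
      intro r hr
      have hr' : r.1 < b := hr
      by_cases h : r.1 < (a + b) / 2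
      · exact Or.inl h
      · exact Or.inr ⟨by linarith, hr'⟩
    have h2 := (measure_mono h1).trans (measure_union_le (μ := ν) _ _)
    rw [h0, add_zero, Measure.volumeIoiPow_apply_Iio, Measure.volumeIoiPow_apply_Iio,
      ENNReal.ofReal_le_ofReal_iff (by positivity)] at h2
    have h3 : ((a + b) / 2) ^ (Module.finrank ℝ E4 - 1 + 1) < b ^ (Module.finrank ℝ E4 - 1 + 1) :=
      pow_lt_pow_left₀ (by linarith) hm.le (by simp)
    have h4 := div_lt_div_of_pos_right h3
      (by positivity : (0 : ℝ) < ((Module.finrank ℝ E4 - 1 : ℕ) : ℝ) + 1)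
    exact absurd h2 (not_le.2 h4)
  · refine ne_top_of_le_ne_top ?_ (measure_mono (t := Iio (⟨b, ha.trans_lt hab⟩ : Ioi (0 : ℝ))) fun _ hr => hr.2)
    rw [Measure.volumeIoiPow_apply_Iio]
    exact ENNReal.ofReal_ne_top
  · intro φ hφ
    have hs : MeasurableSet ({0}ᶜ : Set E4) := (measurableSet_singleton 0).compl
    have h1 : ∫⁻ y in shell a b, φ (radial y)
        = ∫⁻ y : ({0}ᶜ : Set E4), (shell a b).indicator (fun y => φ (radial y)) y
          ∂(Measure.comap Subtype.val volume) := by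
      rw [lintegral_subtype_comap hs (fun y => (shell a b).indicator (fun y => φ (radial y)) y),
        ← lintegral_indicator (isOpen_shell a b).measurableSet, ← lintegral_indicator hs]
      congr 1
      funext y
      by_cases hy : y = 0
      · simp [hy, shell, ha.not_gt]
      · simp [hy]
    have h2 := (Measure.measurePreserving_homeomorphUnitSphereProd (volume : Measure E4))
    let Φ : S3 × Ioi (0 : ℝ) → ℝ≥0∞ := fun p => φ p.1 * P.indicator 1 p.2
    have hΦ : Measurable Φ := (hφ.comp measurable_fst).mul
      ((measurable_one.indicator hPo.measurableSet).comp measurable_snd)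
    rw [h1]
    have h3 := h2.lintegral_comp hΦ
    have h4 : ∀ y : ({0}ᶜ : Set E4), Φ (homeomorphUnitSphereProd E4 y)
        = (shell a b).indicator (fun y => φ (radial y)) y := by
      intro y
      have e1 : (homeomorphUnitSphereProd E4 y).1 = radial (y : E4) := by
        apply Subtype.ext
        rw [homeomorphUnitSphereProd_apply_fst_coe, coe_radial y.2]
      have e2 : ((homeomorphUnitSphereProd E4 y).2 : ℝ) = ‖(y : E4)‖ := by
        simp
      have e3 : (homeomorphUnitSphereProd E4 y).2 ∈ P ↔ (y : E4) ∈ shell a b := by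
        change (_ ∧ _) ↔ (_ ∧ _)
        rw [e2]
      simp only [Φ, e1]
      by_cases hy : (y : E4) ∈ shell a b
      · simp [hy, e3.2 hy]
      · simp [hy, mt e3.1 hy]
    simp only [h4] at h3
    rw [h3, lintegral_prod _ hΦ.aemeasurable]
    simp only [Φ]
    have h5 : ∀ x, ∫⁻ r, φ x * P.indicator 1 r ∂ν = φ x * ν P := by
      intro x
      rw [lintegral_const_mul _ (measurable_one.indicator hPo.measurableSet),
        lintegral_indicator_one hPo.measurableSet]
    simp only [ν] at h5
    simp only [h5]
    rw [lintegral_mul_const _ hφ, mul_comm]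
    rfl

end Shell

/-! ### Gradient bounds for functions on the sphere, through their homogeneous extensions of degree
zero -/

section SphereGradient


/-- `b` bounds the norm of the gradient of the function `h` on `O ⊆ S³`. -/
def SphereGradBound (O : Set S3) (h b : S3 → ℝ) : Prop :=
  ∀ x ∈ O, DifferentiableAt ℝ (fun y : E4 => h (radial y)) (x : E4) ∧
    ∀ v, |fderiv ℝ (fun y : E4 => h (radial y)) (x : E4) v| ≤ b x * ‖v‖

lemma radial_smul {c : ℝ} (hc : 0 < c) (y : E4) : radial (c • y) = radial y := by
  by_cases hy : y = 0
  · simp [hy]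
  · apply Subtype.ext
    rw [coe_radial hy, coe_radial (smul_ne_zero hc.ne' hy), norm_smul, Real.norm_of_nonneg hc.le,
      smul_smul]
    congr 1
    field_simp

lemma fderiv_comp_radial_coe {h : S3 → ℝ} {x : S3} (hh : MDifferentiableAt (𝓡 3) 𝓘(ℝ, ℝ) h x) :
    DifferentiableAt ℝ (fun y : E4 => h (radial y)) (x : E4) ∧
    ∀ v, fderiv ℝ (fun y : E4 => h (radial y)) (x : E4) v
      = mvfderiv (𝓡 3) h x (tangentProj x v) := by
  have hx := S3.ne_zero x
  have hr : radial (x : E4) = x := radial_coe x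
  have h1 : MDifferentiableAt 𝓘(ℝ, E4) (𝓡 3) radial (x : E4) :=
    (contMDiffAt_radial hx).mdifferentiableAt (by simp)
  have h2 : MDifferentiableAt (𝓡 3) 𝓘(ℝ, ℝ) h (radial (x : E4)) := by rwa [hr]
  have h3 := mfderiv_comp (x : E4) h2 h1
  have h4 := h2.comp (x : E4) h1
  refine ⟨mdifferentiableAt_iff_differentiableAt.1 h4, fun v => ?_⟩
  rw [mfderiv_eq_fderiv] at h3
  -- `radial x = x` holds only propositionally, and the tangent space depends on the point;
  -- generalizing over the point permits the substitution.
  have key : ∀ y : S3, y = x → ∀ w : EuclideanSpace ℝ (Fin 3),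
      (mfderiv (𝓡 3) 𝓘(ℝ, ℝ) h y : _ →L[ℝ] ℝ) w
        = (mfderiv (𝓡 3) 𝓘(ℝ, ℝ) h x : _ →L[ℝ] ℝ) w := by
    rintro _ rfl w
    rfl
  have h8 := congrArg (fun L : E4 →L[ℝ] ℝ => L v) h3
  exact h8.trans (key _ hr _)

/-- The extension is homogeneous of degree zero, so its differential is homogeneous of degree `-1`:
at `y` it is `‖y‖⁻¹` times the one at `y / ‖y‖`. -/
lemma SphereGradBound.of_radial {O : Set S3} {h b : S3 → ℝ} (hb : SphereGradBound O h b) {y : E4}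
    (hy : y ≠ 0) (hyO : radial y ∈ O) :
    DifferentiableAt ℝ (fun z : E4 => h (radial z)) y ∧
    ∀ v, |fderiv ℝ (fun z : E4 => h (radial z)) y v| ≤ ‖y‖⁻¹ * b (radial y) * ‖v‖ := by
  obtain ⟨h1, h2⟩ := hb _ hyO
  rw [coe_radial hy] at h1 h2
  have hc : 0 < ‖y‖⁻¹ := inv_pos.2 (norm_pos_iff.2 hy)
  have h3 : HasFDerivAt (fun z : E4 => h (radial z))
      ((fderiv ℝ (fun z : E4 => h (radial z)) (‖y‖⁻¹ • y)).comp
        (‖y‖⁻¹ • ContinuousLinearMap.id ℝ E4)) y := by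
    have h4 : HasFDerivAt (fun z : E4 => ‖y‖⁻¹ • z) (‖y‖⁻¹ • ContinuousLinearMap.id ℝ E4) y :=
      (‖y‖⁻¹ • ContinuousLinearMap.id ℝ E4).hasFDerivAt
    have h5 := HasFDerivAt.comp y (g := fun z : E4 => h (radial z)) (f := fun z : E4 => ‖y‖⁻¹ • z)
      h1.hasFDerivAt h4
    refine h5.congr_of_eventuallyEq (Filter.Eventually.of_forall fun z => ?_)
    simp only [Function.comp, radial_smul hc]
  refine ⟨h3.differentiableAt, fun v => ?_⟩
  rw [h3.fderiv]
  refine (h2 (‖y‖⁻¹ • v)).trans (le_of_eq ?_)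
  rw [norm_smul, Real.norm_of_nonneg hc.le]
  ring

/-- A bound for the variation of a function along a path. -/
lemma SphereGradBound.sub_le {O : Set S3} {h b : S3 → ℝ} (hb : SphereGradBound O h b)
    (hbc : Continuous b) (hb0 : ∀ x, 0 ≤ b x) {γ γ' : ℝ → E4} {t₀ t₁ M : ℝ} (ht : t₀ ≤ t₁)
    (hγ : ∀ t ∈ Icc t₀ t₁, HasDerivAt γ (γ' t) t) (hγ0 : ∀ t ∈ Icc t₀ t₁, γ t ≠ 0)
    (hγO : ∀ t ∈ Icc t₀ t₁, radial (γ t) ∈ O) (hM : ∀ t ∈ Icc t₀ t₁, ‖γ' t‖ ≤ M * ‖γ t‖) :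
    |h (radial (γ t₁)) - h (radial (γ t₀))| ≤ M * ∫ t in t₀..t₁, b (radial (γ t)) := by
  -- The majorant in a mean value inequality. Its derivative dominates that of `h` along the path,
  -- because the bound `‖γ'‖ ≤ M ‖γ‖` cancels the factor `‖γ‖⁻¹` coming from homogeneity.
  let B : ℝ → ℝ := fun t => M * ∫ r in t₀..t, b (radial (γ r))
  have hbγ : ContinuousOn (fun t => b (radial (γ t))) (Icc t₀ t₁) := by
    refine hbc.comp_continuousOn (continuousOn_radial.comp ?_ hγ0)
    exact fun t ht => (hγ t ht).continuousAt.continuousWithinAt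
  have hder : ∀ t ∈ Icc t₀ t₁, HasDerivAt (fun r => h (radial (γ r)))
      (fderiv ℝ (fun z : E4 => h (radial z)) (γ t) (γ' t)) t := fun t ht =>
    (hb.of_radial (hγ0 t ht) (hγO t ht)).1.hasFDerivAt.comp_hasDerivAt t (hγ t ht)
  have hint : IntervalIntegrable (fun t => b (radial (γ t))) volume t₀ t₁ := by
    refine ContinuousOn.intervalIntegrable ?_
    rwa [uIcc_of_le ht]
  have key := image_norm_le_of_norm_deriv_right_le_deriv_boundary'
    (f := fun t => h (radial (γ t)) - h (radial (γ t₀))) (a := t₀) (b := t₁)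
    (f' := fun t => fderiv ℝ (fun z : E4 => h (radial z)) (γ t) (γ' t))
    (B := B) (B' := fun t => M * b (radial (γ t)))
    (fun t ht => ((hder t ht).sub_const _).continuousAt.continuousWithinAt)
    (fun t ht => ((hder t ⟨ht.1, ht.2.le⟩).sub_const _).hasDerivWithinAt)
    (by simp [B]) ?_ ?_ ?_ (right_mem_Icc.2 ht)
  · exact key
  · refine ContinuousOn.mul continuousOn_const ?_
    have := intervalIntegral.continuousOn_primitive_interval' hint (left_mem_uIcc)
    rwa [uIcc_of_le ht] at this
  · intro t ht
    refine HasDerivWithinAt.const_mul M ?_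
    have hint' : IntervalIntegrable (fun t => b (radial (γ t))) volume t₀ t :=
      hint.mono_set (by
        rw [uIcc_of_le ht.1, uIcc_of_le (ht.1.trans ht.2.le)]
        exact Icc_subset_Icc_right ht.2.le)
    refine intervalIntegral.integral_hasDerivWithinAt_right hint' (t := Ioi t) ?_ ?_
    · refine ⟨Ioc t t₁, Ioc_mem_nhdsGT ht.2, ?_⟩
      refine (hbγ.mono ?_).aestronglyMeasurable measurableSet_Ioc
      exact fun r hr => ⟨ht.1.trans hr.1.le, hr.2⟩
    · exact (hbγ t ⟨ht.1, ht.2.le⟩).mono_of_mem_nhdsWithin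
        (Filter.mem_of_superset (Ioc_mem_nhdsGT ht.2) fun r hr => ⟨ht.1.trans hr.1.le, hr.2⟩)
  · intro t ht
    have ht' : t ∈ Icc t₀ t₁ := ⟨ht.1, ht.2.le⟩
    refine ((hb.of_radial (hγ0 t ht') (hγO t ht')).2 _).trans ?_
    have h1 : 0 < ‖γ t‖ := norm_pos_iff.2 (hγ0 t ht')
    calc ‖γ t‖⁻¹ * b (radial (γ t)) * ‖γ' t‖ ≤ ‖γ t‖⁻¹ * b (radial (γ t)) * (M * ‖γ t‖) := by
          gcongr
          · exact mul_nonneg (by positivity) (hb0 _)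
          · exact hM t ht'
      _ = M * b (radial (γ t)) := by
          field_simp

/-- `b` bounds the norm of the gradient of the square root of `q`, in a form that makes sense at
the zeros of `q`. -/
def SqrtGradBound (q b : S3 → ℝ) : Prop :=
  ∀ x, 0 ≤ q x ∧ DifferentiableAt ℝ (fun y : E4 => q (radial y)) (x : E4) ∧
    ∀ v, |fderiv ℝ (fun y : E4 => q (radial y)) (x : E4) v| ≤ 2 * b x * √(q x) * ‖v‖

/-- Adding `ε` under the root makes it differentiable at the zeros of `q`, and `√q ≤ √(q + ε)` keeps
the gradient bound independent of `ε`. -/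
lemma SqrtGradBound.sphereGradBound {q b : S3 → ℝ} (hq : SqrtGradBound q b) (hb0 : ∀ x, 0 ≤ b x)
    {ε : ℝ} (hε : 0 < ε) : SphereGradBound univ (fun x => √(q x + ε)) b := by
  intro x _
  obtain ⟨h0, h1, h2⟩ := hq x
  have hr : radial (x : E4) = x := radial_coe x
  have hpos : 0 < q x + ε := by linarith
  have h3 := (h1.hasFDerivAt.add_const ε).sqrt (by rw [hr]; exact hpos.ne')
  refine ⟨h3.differentiableAt, fun v => ?_⟩
  have h4 : 0 < √(q x + ε) := Real.sqrt_pos.2 hpos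
  rw [h3.fderiv, hr]
  simp only [_root_.smul_apply, smul_eq_mul]
  rw [abs_mul, abs_of_pos (by positivity)]
  calc 1 / (2 * √(q x + ε)) * |fderiv ℝ (fun y : E4 => q (radial y)) (x : E4) v|
      ≤ 1 / (2 * √(q x + ε)) * (2 * b x * √(q x + ε) * ‖v‖) := by
        gcongr
        refine (h2 v).trans ?_
        have := hb0 x
        gcongr
        linarith
    _ = b x * ‖v‖ := by field_simp

/-- Let `ε → 0` in the estimate for `√(q + ε)`. Only the integrated inequality is asserted in the
limit, since `√q` need not be differentiable. -/
lemma SqrtGradBound.sub_le {q b : S3 → ℝ} (hq : SqrtGradBound q b)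
    (hbc : Continuous b) (hb0 : ∀ x, 0 ≤ b x) {γ γ' : ℝ → E4} {t₀ t₁ M : ℝ} (ht : t₀ ≤ t₁)
    (hγ : ∀ t ∈ Icc t₀ t₁, HasDerivAt γ (γ' t) t) (hγ0 : ∀ t ∈ Icc t₀ t₁, γ t ≠ 0)
    (hM : ∀ t ∈ Icc t₀ t₁, ‖γ' t‖ ≤ M * ‖γ t‖) :
    |√(q (radial (γ t₁))) - √(q (radial (γ t₀)))| ≤ M * ∫ t in t₀..t₁, b (radial (γ t)) := by
  have h1 : ∀ a : ℝ, Filter.Tendsto (fun ε : ℝ => √(a + ε)) (𝓝[>] 0) (𝓝 √a) := by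
    intro a
    have : ContinuousAt (fun ε : ℝ => √(a + ε)) 0 := by fun_prop
    simpa using this.tendsto.mono_left nhdsWithin_le_nhds
  refine le_of_tendsto ((h1 _).sub (h1 _)).abs ?_
  filter_upwards [self_mem_nhdsWithin] with ε hε
  exact (hq.sphereGradBound hb0 hε).sub_le hbc hb0 ht hγ hγ0 (fun _ _ => mem_univ _) hM

/-- Cauchy–Schwarz, in the form that a variance is nonnegative. -/
lemma sq_integral_le {f : ℝ → ℝ} (hf : ContinuousOn f (Icc 0 1)) :
    (∫ t in (0 : ℝ)..1, f t) ^ 2 ≤ ∫ t in (0 : ℝ)..1, f t ^ 2 := by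
  set c := ∫ t in (0 : ℝ)..1, f t with hc
  have hf' : ContinuousOn f (uIcc 0 1) := by rwa [uIcc_of_le zero_le_one]
  have h1 : 0 ≤ ∫ t in (0 : ℝ)..1, (f t - c) ^ 2 :=
    intervalIntegral.integral_nonneg zero_le_one fun t _ => sq_nonneg _
  have h2 : ∀ t, (f t - c) ^ 2 = f t ^ 2 - 2 * c * f t + c ^ 2 := fun t => by ring
  have i1 : IntervalIntegrable (fun t => f t ^ 2) volume 0 1 := (hf'.pow 2).intervalIntegrable
  have i2 : IntervalIntegrable (fun t => 2 * c * f t) volume 0 1 :=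
    (hf'.const_mul _).intervalIntegrable
  have i3 : IntervalIntegrable (fun t => f t ^ 2 - 2 * c * f t) volume 0 1 := i1.sub i2
  simp only [h2] at h1
  rw [intervalIntegral.integral_add i3 (by simp), intervalIntegral.integral_sub i1 i2,
    intervalIntegral.integral_const_mul, ← hc] at h1
  simp at h1
  linarith

/-- Cauchy–Schwarz turns a first order estimate along a segment into the squared form used by
`SegmentBound`. The distance `r` from the origin keeps segments in the region where `radial` is
continuous. -/
lemma enorm_sub_sq_le {b : S3 → ℝ} (hbc : Continuous b) {r : ℝ} (hr : 0 < r) {Q : Set E4}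
    (hQ : Convex ℝ Q) (hQr : ∀ y ∈ Q, r ≤ ‖y‖) {x y : E4} (hx : x ∈ Q) (hy : y ∈ Q) {a : ℝ}
    (ha : |a| ≤ (r⁻¹ * ‖y - x‖) * ∫ t in (0 : ℝ)..1, b (radial (x + t • (y - x)))) :
    ‖a‖ₑ ^ 2 ≤ ENNReal.ofReal (‖x - y‖ ^ 2) * ∫⁻ t in Icc (0 : ℝ) 1,
      ENNReal.ofReal ((r⁻¹) ^ 2) * ENNReal.ofReal (b (radial (x + t • (y - x))) ^ 2) := by
  have hseg : ∀ t ∈ Icc (0 : ℝ) 1, x + t • (y - x) ∈ Q := by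
    intro t ht
    have h4 : x + t • (y - x) = (1 - t) • x + t • y := by module
    rw [h4]
    exact hQ hx hy (by linarith [ht.2]) ht.1 (by ring)
  have hc : ContinuousOn (fun t : ℝ => b (radial (x + t • (y - x)))) (Icc 0 1) := by
    refine hbc.comp_continuousOn (continuousOn_radial.comp (by fun_prop) fun t ht => ?_)
    exact norm_pos_iff.1 (hr.trans_le (hQr _ (hseg t ht)))
  have h1 : a ^ 2 ≤ (r⁻¹ * ‖y - x‖) ^ 2 * ∫ t in (0 : ℝ)..1, b (radial (x + t • (y - x))) ^ 2 := by
    calc a ^ 2 = |a| ^ 2 := (sq_abs a).symm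
      _ ≤ ((r⁻¹ * ‖y - x‖) * ∫ t in (0 : ℝ)..1, b (radial (x + t • (y - x)))) ^ 2 := by gcongr
      _ ≤ _ := by
        rw [mul_pow]
        gcongr
        exact sq_integral_le hc
  have h2 : ∫⁻ t in Icc (0 : ℝ) 1, ENNReal.ofReal (b (radial (x + t • (y - x))) ^ 2)
      = ENNReal.ofReal (∫ t in (0 : ℝ)..1, b (radial (x + t • (y - x))) ^ 2) := by
    rw [intervalIntegral.integral_of_le zero_le_one, ← integral_Icc_eq_integral_Ioc,
      ofReal_integral_eq_lintegral_ofReal]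
    · exact (hc.pow 2).integrableOn_compact isCompact_Icc
    · exact Filter.Eventually.of_forall fun t => sq_nonneg _
  rw [lintegral_const_mul' _ _ ENNReal.ofReal_ne_top, h2, ← ENNReal.ofReal_mul (by positivity),
    ← ENNReal.ofReal_mul (by positivity), ← ofReal_norm, ← ENNReal.ofReal_pow (norm_nonneg _),
    Real.norm_eq_abs, sq_abs]
  refine ENNReal.ofReal_le_ofReal (h1.trans (le_of_eq ?_))
  rw [norm_sub_rev x y]
  ring

lemma SphereGradBound.segmentBound {O : Set S3} {h b : S3 → ℝ} (hb : SphereGradBound O h b)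
    (hbc : Continuous b) (hb0 : ∀ x, 0 ≤ b x) {r : ℝ} (hr : 0 < r) {Q : Set E4}
    (hQ : Convex ℝ Q) (hQr : ∀ y ∈ Q, r ≤ ‖y‖) (hQO : ∀ y ∈ Q, radial y ∈ O) :
    SegmentBound Q (fun y => h (radial y))
      (fun y => ENNReal.ofReal ((r⁻¹) ^ 2) * ENNReal.ofReal (b (radial y) ^ 2)) := by
  intro x hx y hy
  have hseg : ∀ t ∈ Icc (0 : ℝ) 1, x + t • (y - x) ∈ Q := by
    intro t ht
    have h4 : x + t • (y - x) = (1 - t) • x + t • y := by module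
    rw [h4]
    exact hQ hx hy (by linarith [ht.2]) ht.1 (by ring)
  refine enorm_sub_sq_le hbc hr hQ hQr hx hy ?_
  have h1 := hb.sub_le hbc hb0 (γ := fun t => x + t • (y - x)) (γ' := fun _ => y - x)
    (t₀ := 0) (t₁ := 1) (M := r⁻¹ * ‖y - x‖) zero_le_one
    (fun t _ => by simpa using ((hasDerivAt_id t).smul_const (y - x)).const_add x)
    (fun t ht => norm_pos_iff.1 (hr.trans_le (hQr _ (hseg t ht))))
    (fun t ht => hQO _ (hseg t ht))
    (fun t ht => by
      -- The segment has constant velocity `y - x` and stays outside the ball of radius `r`, whence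
      -- `M = r⁻¹ ‖y - x‖` in the path estimate.
      have h2 : 1 ≤ r⁻¹ * ‖x + t • (y - x)‖ := by
        rw [inv_mul_eq_div, one_le_div hr]
        exact hQr _ (hseg t ht)
      nlinarith [norm_nonneg (y - x)])
  rw [abs_sub_comm]
  simpa using h1

lemma SqrtGradBound.segmentBound {q b : S3 → ℝ} (hq : SqrtGradBound q b)
    (hbc : Continuous b) (hb0 : ∀ x, 0 ≤ b x) {r : ℝ} (hr : 0 < r) {Q : Set E4}
    (hQ : Convex ℝ Q) (hQr : ∀ y ∈ Q, r ≤ ‖y‖) :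
    SegmentBound Q (fun y => √(q (radial y)))
      (fun y => ENNReal.ofReal ((r⁻¹) ^ 2) * ENNReal.ofReal (b (radial y) ^ 2)) := by
  intro x hx y hy
  have hseg : ∀ t ∈ Icc (0 : ℝ) 1, x + t • (y - x) ∈ Q := by
    intro t ht
    have h4 : x + t • (y - x) = (1 - t) • x + t • y := by module
    rw [h4]
    exact hQ hx hy (by linarith [ht.2]) ht.1 (by ring)
  refine enorm_sub_sq_le hbc hr hQ hQr hx hy ?_
  have h1 := hq.sub_le hbc hb0 (γ := fun t => x + t • (y - x)) (γ' := fun _ => y - x)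
    (t₀ := 0) (t₁ := 1) (M := r⁻¹ * ‖y - x‖) zero_le_one
    (fun t _ => by simpa using ((hasDerivAt_id t).smul_const (y - x)).const_add x)
    (fun t ht => norm_pos_iff.1 (hr.trans_le (hQr _ (hseg t ht))))
    (fun t ht => by
      have h2 : 1 ≤ r⁻¹ * ‖x + t • (y - x)‖ := by
        rw [inv_mul_eq_div, one_le_div hr]
        exact hQr _ (hseg t ht)
      nlinarith [norm_nonneg (y - x)])
  rw [abs_sub_comm]
  simpa using h1

end SphereGradient

/-! ### The Poincaré inequality on the sphere relative to an open subset -/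

section GlobalPoincare


instance : IsFiniteMeasure surfaceMeasure := by unfold surfaceMeasure; infer_instance

instance : surfaceMeasure.IsOpenPosMeasure := by unfold surfaceMeasure; infer_instance

/-- The part of the cone over `O` between the spheres of radius `a` and `b`. -/
def conePart (a b : ℝ) (O : Set S3) : Set E4 := shell a b ∩ radial ⁻¹' O

lemma measurableSet_conePart (a b : ℝ) {O : Set S3} (hO : MeasurableSet O) :
    MeasurableSet (conePart a b O) :=
  (isOpen_shell a b).measurableSet.inter (measurable_radial hO)

lemma lintegral_conePart {a b : ℝ} {κ : ℝ≥0∞}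
    (hκ : ∀ φ : S3 → ℝ≥0∞, Measurable φ →
      ∫⁻ y in shell a b, φ (radial y) = κ * ∫⁻ x, φ x ∂surfaceMeasure)
    {O : Set S3} (hO : MeasurableSet O) {φ : S3 → ℝ≥0∞} (hφ : Measurable φ) :
    ∫⁻ y in conePart a b O, φ (radial y) = κ * ∫⁻ x in O, φ x ∂surfaceMeasure := by
  rw [← lintegral_indicator hO, ← hκ _ (hφ.indicator hO), conePart, inter_comm,
    ← Measure.restrict_restrict (measurable_radial hO),
    ← lintegral_indicator (measurable_radial hO)]
  rfl

lemma volume_conePart {a b : ℝ} {κ : ℝ≥0∞}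
    (hκ : ∀ φ : S3 → ℝ≥0∞, Measurable φ →
      ∫⁻ y in shell a b, φ (radial y) = κ * ∫⁻ x, φ x ∂surfaceMeasure)
    {O : Set S3} (hO : MeasurableSet O) : volume (conePart a b O) = κ * surfaceMeasure O := by
  have := lintegral_conePart hκ hO (φ := 1) measurable_one
  simpa using this

lemma norm_sub_coe_radial_lt {p : S3} {r ε : ℝ} {y : E4} (hy : y ∈ shell (1 - ε) (1 + ε))
    (h0 : ε ≤ 1) (hr : radial y ∈ Metric.ball p r) : ‖y - p‖ < r + ε := by
  have hy0 : y ≠ 0 := by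
    rintro rfl
    have := hy.1
    simp at this
    linarith
  have h1 : y = ‖y‖ • (radial y : E4) := by
    rw [coe_radial hy0, smul_smul, mul_inv_cancel₀ (norm_ne_zero_iff.2 hy0), one_smul]
  have h2 : ‖(radial y : E4) - p‖ < r := by
    rw [← dist_eq_norm]
    exact hr
  have h3 : ‖y - radial y‖ < ε := by
    have h4 : y - radial y = (‖y‖ - 1) • (radial y : E4) := by
      rw [sub_smul, ← h1, one_smul]
    rw [h4, norm_smul]
    have h5 : ‖(radial y : E4)‖ = 1 := by simp
    rw [h5, mul_one, Real.norm_eq_abs, abs_lt]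
    exact ⟨by linarith [hy.1], by linarith [hy.2]⟩
  have h6 : y - (p : E4) = (radial y - p) + (y - radial y) := by abel
  rw [h6]
  exact (norm_add_le _ _).trans_lt (by linarith)

lemma continuous_of_differentiableAt_radial {q : S3 → ℝ}
    (h : ∀ x : S3, DifferentiableAt ℝ (fun y : E4 => q (radial y)) (x : E4)) : Continuous q := by
  rw [continuous_iff_continuousAt]
  intro x
  have h1 : ContinuousAt (fun z : S3 => q (radial (z : E4))) x :=
    ContinuousAt.comp (f := fun z : S3 => (z : E4)) (h x).continuousAt
      continuous_subtype_val.continuousAt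
  simpa only [radial_coe] using h1

lemma SqrtGradBound.continuous {q b : S3 → ℝ} (hq : SqrtGradBound q b) : Continuous q :=
  continuous_of_differentiableAt_radial fun x => (hq x).2.1

/-- Thicken both sets radially by `1/4`: they then lie in the Euclidean ball of radius `1/2 = 1/4 +
1/4` about `p`, which is convex and avoids the origin. There the convex inequality compares the two
square integrals. The ball lies in the shell between `1/2` and `3/2`, so its energy is bounded by
the energy on `S³`; this is why two shell constants occur. -/
lemma exists_local_poincare (p : S3) {O₁ O₂ : Set S3} (h₁ : MeasurableSet O₁)
    (h₂ : MeasurableSet O₂) (hp₁ : O₁ ⊆ Metric.ball p (1 / 4)) (hp₂ : O₂ ⊆ Metric.ball p (1 / 4))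
    (hpos : surfaceMeasure O₂ ≠ 0) :
    ∃ C : ℝ≥0∞, C ≠ ⊤ ∧ ∀ q b : S3 → ℝ, SqrtGradBound q b → Continuous b → (∀ x, 0 ≤ b x) →
      ∫⁻ x in O₁, ‖√(q x)‖ₑ ^ 2 ∂surfaceMeasure
        ≤ C * (∫⁻ x in O₂, ‖√(q x)‖ₑ ^ 2 ∂surfaceMeasure
          + ∫⁻ x, ENNReal.ofReal (b x ^ 2) ∂surfaceMeasure) := by
  obtain ⟨κ, hκ0, hκt, hκ⟩ := exists_lintegral_shell (a := 1 - 1 / 4) (b := 1 + 1 / 4)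
    (by norm_num) (by norm_num)
  obtain ⟨κ', hκ'0, hκ't, hκ'⟩ := exists_lintegral_shell (a := 1 / 2) (b := 3 / 2)
    (by norm_num) (by norm_num)
  let B : Set E4 := Metric.ball (p : E4) (1 / 2)
  have hBn : ∀ y ∈ B, 1 / 2 < ‖y‖ ∧ ‖y‖ < 3 / 2 := by
    intro y hy
    have h1 : ‖y - p‖ < 1 / 2 := by simpa [B, dist_eq_norm] using hy
    have h2 : ‖(p : E4)‖ = 1 := by simp
    have h3 := norm_sub_norm_le (p : E4) y
    have h4 := norm_sub_norm_le y (p : E4)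
    rw [norm_sub_rev] at h3
    constructor <;> linarith
  have hsub : ∀ O ⊆ Metric.ball p (1 / 4), conePart (1 - 1 / 4) (1 + 1 / 4) O ⊆ B := by
    intro O hO y hy
    have := norm_sub_coe_radial_lt hy.1 (by norm_num) (hO hy.2)
    rw [Metric.mem_ball, dist_eq_norm]
    linarith
  set c₂ : ℝ≥0∞ := κ * surfaceMeasure O₂ with hc₂
  have hc₂0 : c₂ * κ ≠ 0 := mul_ne_zero (mul_ne_zero hκ0 hpos) hκ0
  have hc₂t : c₂ * κ ≠ ⊤ := ENNReal.mul_ne_top (ENNReal.mul_ne_top hκt (measure_ne_top _ _)) hκt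
  set K : ℝ≥0∞ := 2 * (ENNReal.ofReal (1 ^ 2) * 2 ^ Module.finrank ℝ E4 * volume B
    * (ENNReal.ofReal ((1 / 2)⁻¹ ^ 2) * κ')) with hK
  have hKt : K ≠ ⊤ := by
    have hB : volume B ≠ ⊤ := measure_ball_lt_top.ne
    finiteness
  refine ⟨(c₂ * κ)⁻¹ * (2 * (κ * surfaceMeasure O₁) * κ + K), ?_, ?_⟩
  · have : surfaceMeasure O₁ ≠ ⊤ := measure_ne_top _ _
    finiteness
  · intro q b hq hb hb0
    have hm : Measurable (fun y : E4 => √(q (radial y))) :=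
      (hq.continuous.sqrt.measurable).comp measurable_radial
    have hm2 : Measurable (fun x : S3 => ‖√(q x)‖ₑ ^ 2) :=
      hq.continuous.sqrt.measurable.enorm.pow_const 2
    have hbm : Measurable (fun x : S3 => ENNReal.ofReal (b x ^ 2)) :=
      (hb.pow 2).measurable.ennreal_ofReal
    have hseg := hq.segmentBound hb hb0 (r := 1 / 2) (by norm_num) (convex_ball (p : E4) (1 / 2))
      (fun y hy => (hBn y hy).1.le)
    have h1 := SegmentBound.lintegral_le (volume : Measure E4) (convex_ball (p : E4) (1 / 2))
      Metric.isOpen_ball.measurableSet (d := 1) (fun x hx y hy => by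
        have h2 : dist x y < 1 / 2 + 1 / 2 := by
          refine (dist_triangle_right x y p).trans_lt (add_lt_add hx hy)
        rw [← dist_eq_norm]
        linarith) ((hbm.comp measurable_radial).const_mul _) hseg
    have h2 := mul_lintegral_sq_le (volume : Measure E4) (hsub O₁ hp₁) (hsub O₂ hp₂) hm
    rw [lintegral_conePart hκ h₁ hm2, lintegral_conePart hκ h₂ hm2, volume_conePart hκ h₁,
      volume_conePart hκ h₂] at h2
    have h3 : ∫⁻ y in B, ENNReal.ofReal ((1 / 2)⁻¹ ^ 2) * ENNReal.ofReal (b (radial y) ^ 2)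
        ≤ ENNReal.ofReal ((1 / 2)⁻¹ ^ 2)
          * (κ' * ∫⁻ x, ENNReal.ofReal (b x ^ 2) ∂surfaceMeasure) := by
      rw [lintegral_const_mul' _ _ ENNReal.ofReal_ne_top, ← hκ' _ hbm]
      gcongr
      exact fun y hy => hBn y hy
    set X := ∫⁻ x in O₁, ‖√(q x)‖ₑ ^ 2 ∂surfaceMeasure
    set Y := ∫⁻ x in O₂, ‖√(q x)‖ₑ ^ 2 ∂surfaceMeasure
    set Z := ∫⁻ x, ENNReal.ofReal (b x ^ 2) ∂surfaceMeasure
    have h4 : (c₂ * κ) * X ≤ (2 * (κ * surfaceMeasure O₁) * κ + K) * (Y + Z) := by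
      calc (c₂ * κ) * X = c₂ * (κ * X) := by ring
        _ ≤ _ := h2
        _ ≤ 2 * (κ * surfaceMeasure O₁) * (κ * Y) + 2 * (ENNReal.ofReal (1 ^ 2)
            * 2 ^ Module.finrank ℝ E4 * volume B * (ENNReal.ofReal ((1 / 2)⁻¹ ^ 2) * (κ' * Z))) := by
          gcongr
          exact h1.trans (mul_le_mul_right h3 _)
        _ = (2 * (κ * surfaceMeasure O₁) * κ) * Y + K * Z := by
          rw [hK]
          ring
        _ ≤ _ := by
          rw [mul_add]
          gcongr
          · exact le_self_add
          · exact le_add_self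
    rw [mul_assoc]
    calc X = (c₂ * κ)⁻¹ * ((c₂ * κ) * X) := by
          rw [← mul_assoc, ENNReal.inv_mul_cancel hc₂0 hc₂t, one_mul]
      _ ≤ _ := by gcongr

instance : PreconnectedSpace S3 :=
  Subtype.preconnectedSpace (isPreconnected_sphere (by
    rw [← Module.finrank_eq_rank]
    simp) _ _)

/-- The Poincaré inequality on `S³`, relative to a non-empty open subset. -/
theorem exists_global_poincare {A : Set S3} (hA : IsOpen A) (hne : A.Nonempty) :
    ∃ C : ℝ≥0∞, C ≠ ⊤ ∧ ∀ q b : S3 → ℝ, SqrtGradBound q b → Continuous b → (∀ x, 0 ≤ b x) →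
      ∫⁻ x, ‖√(q x)‖ₑ ^ 2 ∂surfaceMeasure
        ≤ C * (∫⁻ x in A, ‖√(q x)‖ₑ ^ 2 ∂surfaceMeasure
          + ∫⁻ x, ENNReal.ofReal (b x ^ 2) ∂surfaceMeasure) := by
  let P : Set S3 → ℝ≥0∞ → Prop := fun O C => ∀ q b : S3 → ℝ, SqrtGradBound q b → Continuous b →
    (∀ x, 0 ≤ b x) → ∫⁻ x in O, ‖√(q x)‖ₑ ^ 2 ∂surfaceMeasure
        ≤ C * (∫⁻ x in A, ‖√(q x)‖ₑ ^ 2 ∂surfaceMeasure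
          + ∫⁻ x, ENNReal.ofReal (b x ^ 2) ∂surfaceMeasure)
  -- The points near which the inequality holds. This set is open and contains `A`; it is closed
  -- because an estimate on an open part of a ball of radius `1/4` extends to the ball.
  -- Connectedness makes it everything, and compactness leaves a finite sum of constants.
  let D : Set S3 := {x | ∃ O, IsOpen O ∧ x ∈ O ∧ ∃ C, C ≠ ⊤ ∧ P O C}
  have hDo : IsOpen D := by
    rw [isOpen_iff_forall_mem_open]
    rintro x ⟨O, hO, hx, C, hC, hP⟩
    exact ⟨O, fun y hy => ⟨O, hO, hy, C, hC, hP⟩, hO, hx⟩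
  have hDc : IsClosed D := by
    rw [← closure_subset_iff_isClosed]
    intro p hp
    obtain ⟨z, hz1, O, hO, hz2, C, hC, hP⟩ :=
      mem_closure_iff.1 hp (Metric.ball p (1 / 4)) Metric.isOpen_ball
        (Metric.mem_ball_self (by norm_num))
    have hO' : IsOpen (O ∩ Metric.ball p (1 / 4)) := hO.inter Metric.isOpen_ball
    obtain ⟨C', hC', hP'⟩ := exists_local_poincare p (O₁ := Metric.ball p (1 / 4))
      (O₂ := O ∩ Metric.ball p (1 / 4)) Metric.isOpen_ball.measurableSet hO'.measurableSet
      subset_rfl inter_subset_right (hO'.measure_pos _ ⟨z, hz2, hz1⟩).ne'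
    refine ⟨Metric.ball p (1 / 4), Metric.isOpen_ball, Metric.mem_ball_self (by norm_num),
      C' * (C + 1), by finiteness, fun q b hq hb hb0 => (hP' q b hq hb hb0).trans ?_⟩
    rw [mul_assoc]
    gcongr
    rw [add_mul, one_mul]
    gcongr
    · refine le_trans ?_ (hP q b hq hb hb0)
      exact lintegral_mono_set inter_subset_left
    · exact le_add_self
  have hDu : D = univ := by
    refine IsClopen.eq_univ ⟨hDc, hDo⟩ ?_
    obtain ⟨x, hx⟩ := hne
    refine ⟨x, A, hA, hx, 1, by simp, fun q b _ _ _ => ?_⟩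
    rw [one_mul]
    exact le_self_add
  have hD : ∀ x : S3, ∃ O, IsOpen O ∧ x ∈ O ∧ ∃ C, C ≠ ⊤ ∧ P O C := fun x => by
    have : x ∈ D := by rw [hDu]; trivial
    exact this
  choose O hO hxO C hC hP using hD
  obtain ⟨t, ht⟩ := isCompact_univ.elim_finite_subcover O hO
    (fun x _ => mem_iUnion.2 ⟨x, hxO x⟩)
  refine ⟨∑ x ∈ t, C x, by simpa using fun x _ => hC x, fun q b hq hb hb0 => ?_⟩
  rw [Finset.sum_mul]
  calc ∫⁻ x, ‖√(q x)‖ₑ ^ 2 ∂surfaceMeasure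
      = ∫⁻ x in ⋃ y ∈ t, O y, ‖√(q x)‖ₑ ^ 2 ∂surfaceMeasure := by
        rw [univ_subset_iff.1 ht, Measure.restrict_univ]
    _ ≤ ∑ y ∈ t, ∫⁻ x in O y, ‖√(q x)‖ₑ ^ 2 ∂surfaceMeasure := by
        rw [← lintegral_finsetSum_measure]
        refine lintegral_mono' ?_ le_rfl
        rw [← Measure.sum_coe_finset, ← Finset.set_biUnion_coe, biUnion_eq_iUnion]
        exact Measure.restrict_iUnion_le
    _ ≤ _ := Finset.sum_le_sum fun y _ => hP y q b hq hb hb0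

end GlobalPoincare

/-! ### Pointwise norms of twisted sections, extended by zero to the sphere -/

section PointwiseNorms

variable (𝕜 : Type*) [RCLike 𝕜]
  {F : Type*} [NormedAddCommGroup F] [NormedSpace ℝ F]
  {V : S3 → Type*} [TopologicalSpace (TotalSpace F V)]
  [∀ x, NormedAddCommGroup (V x)] [∀ x, InnerProductSpace ℝ (V x)]
  [FiberBundle F V] [VectorBundle ℝ F V]
  {U : TopologicalSpace.Opens S3}
  {I : U → Type*} [TopologicalSpace (TotalSpace ℝ I)]
  [∀ x, NormedAddCommGroup (I x)] [∀ x, InnerProductSpace ℝ (I x)]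
  [FiberBundle ℝ I] [VectorBundle ℝ ℝ I] [IsContinuousRiemannianBundle ℝ I]

open Classical in
/-- The extension by zero of a function on `U`. -/
def extendZero {U : TopologicalSpace.Opens S3} (f : U → ℝ) (y : S3) : ℝ :=
  if h : y ∈ U then f ⟨y, h⟩ else 0

@[simp] lemma extendZero_coe (f : U → ℝ) (y : U) : extendZero f (y : S3) = f y := by
  simp [extendZero]

lemma extendZero_of_notMem (f : U → ℝ) {y : S3} (hy : y ∉ U) : extendZero f y = 0 := by
  simp [extendZero, hy]

lemma extendZero_nonneg {f : U → ℝ} (hf : ∀ y, 0 ≤ f y) (y : S3) : 0 ≤ extendZero f y := by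
  by_cases h : y ∈ U
  · exact (hf ⟨y, h⟩).trans_eq (extendZero_coe f ⟨y, h⟩).symm
  · rw [extendZero_of_notMem f h]

/-- Outside of a compact subset of `U`, the extension by zero vanishes. -/
lemma eventually_extendZero_eq_zero {f : U → ℝ} {K : Set U} (hK : IsCompact K)
    (hf : ∀ y ∉ K, f y = 0) {x : S3} (hx : x ∉ Subtype.val '' K) :
    ∀ᶠ y in 𝓝 x, extendZero f y = 0 := by
  have h1 : IsClosed (Subtype.val '' K : Set S3) := (hK.image continuous_subtype_val).isClosed
  filter_upwards [h1.isOpen_compl.mem_nhds hx] with y hy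
  by_cases h : y ∈ U
  · refine (extendZero_coe f ⟨y, h⟩).trans (hf _ fun h2 => hy ⟨_, h2, rfl⟩)
  · exact extendZero_of_notMem f h

lemma continuous_extendZero {f : U → ℝ} {K : Set U} (hK : IsCompact K)
    (hf : ∀ y ∉ K, f y = 0) (hc : Continuous f) : Continuous (extendZero f) := by
  rw [continuous_iff_continuousAt]
  intro x
  by_cases hx : x ∈ Subtype.val '' K
  · obtain ⟨y, -, rfl⟩ := hx
    refine (U.2.isOpenEmbedding_subtypeVal.continuousAt_iff (g := extendZero f)).1 ?_
    refine hc.continuousAt.congr (Filter.Eventually.of_forall fun z => ?_)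
    exact (extendZero_coe f z).symm
  · refine (continuousAt_const (y := (0 : ℝ))).congr ?_
    filter_upwards [eventually_extendZero_eq_zero hK hf hx] with y hy using hy.symm

lemma norm_contract_eq {y : U} {a b : I y} (ha : ‖a‖ = 1) (hb : ‖b‖ = 1) (s : V y ⊗[ℝ] I y) :
    ‖contract a s‖ = ‖contract b s‖ := by
  rw [eq_smul_of_norm_eq_one y (b := b) ha, contract_smul_left, norm_smul]
  have h1 := congrArg norm (eq_smul_of_norm_eq_one y (b := b) ha)
  rw [norm_smul, ha, hb, mul_one] at h1
  rw [← h1, one_mul]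

/-- Unit vectors of a real line differ by a sign, which squaring removes. So the square of the
contraction with `σ` is globally defined, although the contraction itself depends on a local choice
of frame. -/
lemma sq_inner_contract_eq {y : U} {a b : I y} (ha : ‖a‖ = 1) (hb : ‖b‖ = 1) (v : V y)
    (s : V y ⊗[ℝ] I y) :
    (inner ℝ v (contract a s) : ℝ) ^ 2 = (inner ℝ v (contract b s) : ℝ) ^ 2 := by
  rw [eq_smul_of_norm_eq_one y (b := b) ha, contract_smul_left, inner_smul_right]
  have h1 := congrArg norm (eq_smul_of_norm_eq_one y (b := b) ha)
  rw [norm_smul, ha, hb, mul_one, Real.norm_eq_abs] at h1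
  rw [mul_pow, ← sq_abs (inner ℝ a b : ℝ), ← h1, one_pow, one_mul]

/-- The square of the pointwise norm of a section of `V ⊗ I`. -/
def normSq (s : RoughSection V I) : S3 → ℝ :=
  extendZero fun y => ‖contract (frame I y y) (s y)‖ ^ 2

/-- The square of the pointwise norm of the contraction of a section of `V ⊗ I` with a section
of `V`. -/
def pairSq (σ : ∀ x, V x) (s : RoughSection V I) : S3 → ℝ :=
  extendZero fun y => (inner ℝ (σ y) (contract (frame I y y) (s y)) : ℝ) ^ 2

lemma normSq_nonneg (s : RoughSection V I) (x : S3) : 0 ≤ normSq s x :=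
  extendZero_nonneg (fun _ => sq_nonneg _) x

lemma pairSq_nonneg (σ : ∀ x, V x) (s : RoughSection V I) (x : S3) : 0 ≤ pairSq σ s x :=
  extendZero_nonneg (fun _ => sq_nonneg _) x

lemma IsUnitFrameAt.normSq_eq {u : ∀ y : U, I y} {x : U} (hu : IsUnitFrameAt u x)
    (s : RoughSection V I) : normSq s (x : S3) = ‖localRep u s x‖ ^ 2 := by
  rw [normSq, extendZero_coe, localRep_apply,
    norm_contract_eq (isUnitFrameAt_frame x).norm_eq hu.norm_eq]

lemma IsUnitFrameAt.pairSq_eq {u : ∀ y : U, I y} {x : U} (hu : IsUnitFrameAt u x)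
    (σ : ∀ x, V x) (s : RoughSection V I) :
    pairSq σ s (x : S3) = (inner ℝ (σ x) (localRep u s x) : ℝ) ^ 2 := by
  rw [pairSq, extendZero_coe, localRep_apply,
    sq_inner_contract_eq (isUnitFrameAt_frame x).norm_eq hu.norm_eq]

lemma IsUnitFrameAt.eventually_coe {u : ∀ y : U, I y} {x : U} (hu : IsUnitFrameAt u x) :
    ∀ᶠ y in 𝓝 (x : S3), ∃ hy : y ∈ U, IsUnitFrameAt u ⟨y, hy⟩ :=
  eventually_of_coe hu.eventually

section Gradient

variable [IsContMDiffRiemannianBundle (𝓡 3) ∞ F V]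
  [FiniteDimensional ℝ F] [ContMDiffVectorBundle ∞ F V (𝓡 3)]
  (cov : CovariantDerivative (𝓡 3) F V)

/-- The square of the pointwise norm of the covariant derivative of a section of `V ⊗ I`. -/
def gradSq (s : RoughSection V I) : S3 → ℝ :=
  extendZero fun y => ∑ i : Fin 4, ‖contract (frame I y y)
    (nabla F cov s y (tangentProj y (EuclideanSpace.single i 1)))‖ ^ 2

lemma gradSq_nonneg (s : RoughSection V I) (x : S3) : 0 ≤ gradSq cov s x :=
  extendZero_nonneg (fun _ => Finset.sum_nonneg fun _ _ => sq_nonneg _) x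

lemma IsUnitFrameAt.gradSq_eq {u : ∀ y : U, I y} {x : U} (hu : IsUnitFrameAt u x)
    {s : RoughSection V I} (hs : IsSmooth F s) :
    gradSq cov s (x : S3) = ∑ i : Fin 4,
      ‖cov (localRep u s) (x : S3) (tangentProj x (EuclideanSpace.single i 1))‖ ^ 2 := by
  rw [gradSq, extendZero_coe]
  refine Finset.sum_congr rfl fun i _ => ?_
  rw [norm_contract_eq (isUnitFrameAt_frame x).norm_eq hu.norm_eq, nabla_eq F cov hs hu]
  simp [hu.norm_eq]

/-- The Hilbert–Schmidt norm dominates the operator norm: expand `v` in coordinates and apply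
Cauchy–Schwarz. -/
lemma norm_le_of_sum {W : Type*} [NormedAddCommGroup W] [InnerProductSpace ℝ W]
    (L : E4 →ₗ[ℝ] W) (v : E4) :
    ‖L v‖ ≤ √(∑ i : Fin 4, ‖L (EuclideanSpace.single i 1)‖ ^ 2) * ‖v‖ := by
  have h1 : v = ∑ i : Fin 4, v i • EuclideanSpace.single i (1 : ℝ) := by
    have := (EuclideanSpace.basisFun (Fin 4) ℝ).sum_repr v
    simpa using this.symm
  have h2 : ‖L v‖ ≤ ∑ i : Fin 4, ‖L (EuclideanSpace.single i 1)‖ * |v i| := by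
    conv_lhs => rw [h1, map_sum]
    refine (norm_sum_le _ _).trans (Finset.sum_le_sum fun i _ => ?_)
    rw [map_smul, norm_smul, mul_comm, Real.norm_eq_abs]
  refine h2.trans ((Real.sum_mul_le_sqrt_mul_sqrt _ _ _).trans (le_of_eq ?_))
  rw [EuclideanSpace.norm_eq]
  simp

variable {cov} in
lemma IsUnitFrameAt.norm_cov_le {u : ∀ y : U, I y} {x : U} (hu : IsUnitFrameAt u x)
    {s : RoughSection V I} (hs : IsSmooth F s) (v : E4) :
    ‖cov (localRep u s) (x : S3) (tangentProj x v)‖ ≤ √(gradSq cov s x) * ‖v‖ := by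
  rw [hu.gradSq_eq cov hs]
  exact norm_le_of_sum (((cov (localRep u s) (x : S3)) ∘L (tangentProj x)).toLinearMap) v

/-- The derivative of the inner product of two sections of `V`. -/
lemma fderiv_inner {cov : CovariantDerivative (𝓡 3) F V} (hcov : cov.IsMetricCompatible)
    {σ τ : ∀ x, V x} {x : S3}
    (hσ : MDifferentiableAt (𝓡 3) ((𝓡 3).prod 𝓘(ℝ, F)) (fun y => TotalSpace.mk' F y (σ y)) x)
    (hτ : MDifferentiableAt (𝓡 3) ((𝓡 3).prod 𝓘(ℝ, F)) (fun y => TotalSpace.mk' F y (τ y)) x) :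
    DifferentiableAt ℝ (fun y : E4 => (inner ℝ (σ (radial y)) (τ (radial y)) : ℝ)) (x : E4) ∧
    ∀ v, fderiv ℝ (fun y : E4 => (inner ℝ (σ (radial y)) (τ (radial y)) : ℝ)) (x : E4) v
      = inner ℝ (cov σ x (tangentProj x v)) (τ x) + inner ℝ (σ x) (cov τ x (tangentProj x v)) := by
  have h1 : MDifferentiableAt (𝓡 3) 𝓘(ℝ, ℝ) (fun y => (inner ℝ (σ y) (τ y) : ℝ)) x :=
    MDifferentiableAt.inner_bundle hσ hτ
  obtain ⟨h2, h3⟩ := fderiv_comp_radial_coe h1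
  refine ⟨h2, fun v => (h3 v).trans ?_⟩
  exact hcov.mvfderiv_inner_eq (fun y => tangentProj y v) hσ hτ

end Gradient

end PointwiseNorms

lemma eventually_radial {p : S3 → Prop} {x : S3} (h : ∀ᶠ y in 𝓝 x, p y) :
    ∀ᶠ y in 𝓝 (x : E4), p (radial y) := by
  have h1 : ContinuousAt radial (x : E4) := (contMDiffAt_radial (S3.ne_zero x)).continuousAt
  rw [ContinuousAt, radial_coe] at h1
  exact h1.eventually h

/-! ### Kato-type inequalities and global spanning sections -/

section GradientBounds

variable (𝕜 : Type*) [RCLike 𝕜]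
  {F : Type*} [NormedAddCommGroup F] [NormedSpace ℝ F]
  {V : S3 → Type*} [TopologicalSpace (TotalSpace F V)]
  [∀ x, NormedAddCommGroup (V x)] [∀ x, InnerProductSpace ℝ (V x)]
  [FiberBundle F V] [VectorBundle ℝ F V]
  {U : TopologicalSpace.Opens S3}
  {I : U → Type*} [TopologicalSpace (TotalSpace ℝ I)]
  [∀ x, NormedAddCommGroup (I x)] [∀ x, InnerProductSpace ℝ (I x)]
  [FiberBundle ℝ I] [VectorBundle ℝ ℝ I] [IsContinuousRiemannianBundle ℝ I]
  [IsContMDiffRiemannianBundle (𝓡 3) ∞ F V]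
  [FiniteDimensional ℝ F] [ContMDiffVectorBundle ∞ F V (𝓡 3)]
  {cov : CovariantDerivative (𝓡 3) F V}

/-- Kato's inequality: by metric compatibility `d|s|² = 2⟨∇s, s⟩`, which is at most `2|∇s||s|`. Away
from the support the extension by zero vanishes locally, so the bound holds across the complement of
`U` too. -/
lemma sqrtGradBound_normSq (hcov : cov.IsMetricCompatible) {s : RoughSection V I}
    (hs : IsSmooth F s) {K : Set U} (hK : IsCompact K) (hsK : ∀ y ∉ K, s y = 0) :
    SqrtGradBound (normSq s) (fun x => √(gradSq cov s x)) := by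
  intro x
  refine ⟨normSq_nonneg s x, ?_⟩
  by_cases hx : x ∈ Subtype.val '' K
  · obtain ⟨x, -, rfl⟩ := hx
    have hu := isUnitFrameAt_frame (I := I) x
    set u := frame I x
    have h1 : ∀ᶠ y in 𝓝 (x : S3), normSq s y
        = inner ℝ (localRep u s y) (localRep u s y) := by
      filter_upwards [hu.eventually_coe] with y ⟨hyU, hy⟩
      rw [real_inner_self_eq_norm_sq]
      exact hy.normSq_eq s
    have h2 := (hs x u hu).mdifferentiableAt (by simp)
    obtain ⟨h3, h4⟩ := fderiv_inner hcov h2 h2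
    have h5 := eventually_radial h1
    refine ⟨h3.congr_of_eventuallyEq h5, fun v => ?_⟩
    rw [Filter.EventuallyEq.fderiv_eq h5, h4, hu.normSq_eq s, Real.sqrt_sq (norm_nonneg _),
      real_inner_comm, ← two_mul, abs_mul, abs_two, mul_assoc, mul_assoc]
    gcongr
    refine (abs_real_inner_le_norm _ _).trans ?_
    rw [mul_comm ‖localRep u s (x : S3)‖, ← mul_assoc, mul_right_comm]
    gcongr
    exact hu.norm_cov_le hs v
  · have h1 := eventually_radial (eventually_extendZero_eq_zero
      (f := fun y => ‖contract (frame I y y) (s y)‖ ^ 2) hK (fun y hy => by simp [hsK y hy]) hx)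
    have h2 : (fun y : E4 => normSq s (radial y)) =ᶠ[𝓝 (x : E4)] fun _ => (0 : ℝ) := h1
    refine ⟨(differentiableAt_const 0).congr_of_eventuallyEq h2, fun v => ?_⟩
    rw [h2.fderiv_eq]
    simp only [fderiv_fun_const, Pi.zero_apply, _root_.zero_apply, abs_zero]
    positivity

/-- A bound for the first derivatives of a section of `V`. -/
def HasSectionBound (cov : CovariantDerivative (𝓡 3) F V) (σ : ∀ x, V x) (M : ℝ) : Prop :=
  0 ≤ M ∧ ∀ x, ‖σ x‖ ≤ M ∧ ∀ v, ‖cov σ x (tangentProj x v)‖ ≤ M * ‖v‖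

/-- Product rule for `⟨σ, s⟩`, with `σ` and `∇σ` bounded by `M`. -/
lemma abs_fderiv_pairing_le (hcov : cov.IsMetricCompatible) {σ : ∀ x, V x}
    (hσ : ContMDiff (𝓡 3) ((𝓡 3).prod 𝓘(ℝ, F)) ∞ (fun y => TotalSpace.mk' F y (σ y))) {M : ℝ}
    (hM : HasSectionBound cov σ M) {s : RoughSection V I} (hs : IsSmooth F s)
    {u : ∀ y : U, I y} {x : U} (hu : IsUnitFrameAt u x) :
    DifferentiableAt ℝ (fun y : E4 => (inner ℝ (σ (radial y)) (localRep u s (radial y)) : ℝ))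
      (x : S3) ∧ ∀ v, |fderiv ℝ (fun y : E4 => (inner ℝ (σ (radial y))
        (localRep u s (radial y)) : ℝ)) (x : S3) v|
        ≤ M * (√(normSq s x) + √(gradSq cov s x)) * ‖v‖ := by
  obtain ⟨h3, h4⟩ := fderiv_inner hcov ((hσ (x : S3)).mdifferentiableAt (by simp))
    ((hs x u hu).mdifferentiableAt (by simp))
  refine ⟨h3, fun v => ?_⟩
  rw [h4, hu.normSq_eq s, Real.sqrt_sq (norm_nonneg _)]
  obtain ⟨hM0, hM⟩ := hM
  obtain ⟨hM1, hM2⟩ := hM x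
  calc |(inner ℝ (cov σ (x : S3) (tangentProj x v)) (localRep u s (x : S3)) : ℝ)
        + inner ℝ (σ x) (cov (localRep u s) (x : S3) (tangentProj x v))|
      ≤ ‖cov σ (x : S3) (tangentProj x v)‖ * ‖localRep u s (x : S3)‖
        + ‖σ x‖ * ‖cov (localRep u s) (x : S3) (tangentProj x v)‖ :=
        (abs_add_le _ _).trans (add_le_add (abs_real_inner_le_norm _ _)
          (abs_real_inner_le_norm _ _))
    _ ≤ (M * ‖v‖) * ‖localRep u s (x : S3)‖ + M * (√(gradSq cov s x) * ‖v‖) := by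
        gcongr
        · exact hM2 v
        · exact hu.norm_cov_le hs v
    _ = _ := by ring

lemma sphereGradBound_pairing (hcov : cov.IsMetricCompatible) {σ : ∀ x, V x}
    (hσ : ContMDiff (𝓡 3) ((𝓡 3).prod 𝓘(ℝ, F)) ∞ (fun y => TotalSpace.mk' F y (σ y))) {M : ℝ}
    (hM : HasSectionBound cov σ M) {s : RoughSection V I} (hs : IsSmooth F s)
    {u : ∀ y : U, I y} {O : Set U} (hu : ∀ x ∈ O, IsUnitFrameAt u x) :
    SphereGradBound (Subtype.val '' O) (fun y => inner ℝ (σ y) (localRep u s y))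
      (fun x => M * (√(normSq s x) + √(gradSq cov s x))) := by
  rintro _ ⟨x, hx, rfl⟩
  exact abs_fderiv_pairing_le hcov hσ hM hs (hu x hx)

/-- The squared contraction is used because it needs no frame: on a linking circle of the graph the
line bundle has no global one. Locally it is the square of a real function, and `d(p²) = 2p dp`
reduces the bound to the product rule. -/
lemma sqrtGradBound_pairSq (hcov : cov.IsMetricCompatible) {σ : ∀ x, V x}
    (hσ : ContMDiff (𝓡 3) ((𝓡 3).prod 𝓘(ℝ, F)) ∞ (fun y => TotalSpace.mk' F y (σ y))) {M : ℝ}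
    (hM : HasSectionBound cov σ M) {s : RoughSection V I}
    (hs : IsSmooth F s) {K : Set U} (hK : IsCompact K) (hsK : ∀ y ∉ K, s y = 0) :
    SqrtGradBound (pairSq σ s) (fun x => M * (√(normSq s x) + √(gradSq cov s x))) := by
  have hM0 := hM.1
  intro x
  refine ⟨pairSq_nonneg σ s x, ?_⟩
  by_cases hx : x ∈ Subtype.val '' K
  · obtain ⟨x, -, rfl⟩ := hx
    have hu := isUnitFrameAt_frame (I := I) x
    set u := frame I x
    have h1 : ∀ᶠ y in 𝓝 (x : S3), pairSq σ s y
        = (inner ℝ (σ y) (localRep u s y) : ℝ) ^ 2 := by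
      filter_upwards [hu.eventually_coe] with y ⟨hyU, hy⟩
      exact hy.pairSq_eq σ s
    obtain ⟨h3, h4⟩ := abs_fderiv_pairing_le hcov hσ hM hs hu
    have h5 : (fun y : E4 => pairSq σ s (radial y)) =ᶠ[𝓝 ((x : S3) : E4)] _ :=
      eventually_radial h1
    have h6 := h3.hasFDerivAt.pow 2
    refine ⟨h6.differentiableAt.congr_of_eventuallyEq h5, fun v => ?_⟩
    rw [h5.fderiv_eq, h6.fderiv, hu.pairSq_eq σ s, Real.sqrt_sq_eq_abs]
    simp only [_root_.smul_apply, smul_eq_mul, nsmul_eq_mul, abs_mul]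
    have h7 := h4 v
    have h8 : ∀ z : S3, z = x → |(inner ℝ (σ z) (localRep u s z) : ℝ)|
        = |(inner ℝ (σ x) (localRep u s x) : ℝ)| := by
      rintro _ rfl
      rfl
    calc _ = 2 * |(inner ℝ (σ x) (localRep u s x) : ℝ)| * |fderiv ℝ (fun y : E4 =>
          (inner ℝ (σ (radial y)) (localRep u s (radial y)) : ℝ)) (x : S3) v| := by
            rw [← h8 _ (radial_coe x)]
            simp
      _ ≤ 2 * |(inner ℝ (σ x) (localRep u s x) : ℝ)|
          * (M * (√(normSq s x) + √(gradSq cov s x)) * ‖v‖) := by gcongr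
      _ = _ := by ring
  · have h1 := eventually_radial (eventually_extendZero_eq_zero
      (f := fun y => (inner ℝ (σ y) (contract (frame I y y) (s y)) : ℝ) ^ 2) hK
      (fun y hy => by simp [hsK y hy]) hx)
    have h2 : (fun y : E4 => pairSq σ s (radial y)) =ᶠ[𝓝 (x : E4)] fun _ => (0 : ℝ) := h1
    refine ⟨(differentiableAt_const 0).congr_of_eventuallyEq h2, fun v => ?_⟩
    rw [h2.fderiv_eq]
    simp only [fderiv_fun_const, Pi.zero_apply, _root_.zero_apply, abs_zero]
    positivity

lemma exists_hasSectionBound (hcov : cov.ContMDiffCovariantDerivative ∞) {σ : ∀ x, V x}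
    (hσ : ContMDiff (𝓡 3) ((𝓡 3).prod 𝓘(ℝ, F)) ∞ (fun y => TotalSpace.mk' F y (σ y))) :
    ∃ M, HasSectionBound cov σ M := by
  have key : ∀ τ : ∀ x, V x, ContMDiff (𝓡 3) ((𝓡 3).prod 𝓘(ℝ, F)) ∞
      (fun y => TotalSpace.mk' F y (τ y)) → Continuous fun x => ‖τ x‖ := by
    intro τ hτ
    have h1 : Continuous (fun x => √(inner ℝ (τ x) (τ x) : ℝ)) :=
      (continuous_iff_continuousAt.2 fun x => ((hτ x).inner_bundle (hτ x)).continuousAt).sqrt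
    simpa only [real_inner_self_eq_norm_sq, Real.sqrt_sq (norm_nonneg _)] using h1
  have hbd : ∀ f : S3 → ℝ, Continuous f → ∃ C, ∀ x, f x ≤ C := by
    intro f hf
    obtain ⟨C, hC⟩ := (isCompact_range hf).bddAbove
    exact ⟨C, fun x => hC ⟨x, rfl⟩⟩
  obtain ⟨C₁, hC₁⟩ := hbd _ (key σ hσ)
  obtain ⟨C₂, hC₂⟩ := hbd (fun x => √(∑ i : Fin 4,
      ‖cov σ x (tangentProj x (EuclideanSpace.single i 1))‖ ^ 2)) (by
    refine Continuous.sqrt (continuous_finsetSum _ fun i _ => (key (fun x =>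
      cov σ x (tangentProj x (EuclideanSpace.single i 1))) fun x => ?_).pow 2)
    exact contMDiffAt_cov F cov hcov (Filter.Eventually.of_forall fun y => hσ y) _)
  refine ⟨max 0 (max C₁ C₂), le_max_left _ _, fun x => ⟨?_, fun v => ?_⟩⟩
  · exact (hC₁ x).trans ((le_max_left _ _).trans (le_max_right _ _))
  · refine (norm_le_of_sum (((cov σ x) ∘L (tangentProj x)).toLinearMap) v).trans ?_
    gcongr
    exact (hC₂ x).trans ((le_max_right _ _).trans (le_max_right _ _))

variable (F V) in
/-- Finitely many global smooth sections of `V` that span all fibers. -/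
lemma exists_spanning_sections : ∃ (n : ℕ) (σ : Fin n → ∀ x, V x) (C : ℝ), 0 ≤ C ∧
    (∀ j, ContMDiff (𝓡 3) ((𝓡 3).prod 𝓘(ℝ, F)) ∞ (fun y => TotalSpace.mk' F y (σ j y))) ∧
    ∀ (x : S3) (v : V x), ‖v‖ ≤ C * ∑ j, |(inner ℝ (σ j x) v : ℝ)| := by
  let m := Module.finrank ℝ F
  let b := Module.finBasis ℝ F
  have hc : IsContinuousRiemannianBundle F V := by
    obtain ⟨g, hg, hg2⟩ := IsContMDiffRiemannianBundle.exists_contMDiff (IB := 𝓡 3) (n := ∞)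
      (F := F) (E := V)
    exact ⟨g, hg.continuous, hg2⟩
  have hloc : ∀ x : S3, ∃ σ : Fin m → ∀ x, V x, ∃ C : ℝ, 0 ≤ C ∧
      (∀ j, ContMDiff (𝓡 3) ((𝓡 3).prod 𝓘(ℝ, F)) ∞ (fun y => TotalSpace.mk' F y (σ j y))) ∧
      ∀ᶠ y in 𝓝 x, ∀ v : V y, ‖v‖ ≤ C * ∑ j, |(inner ℝ (σ j y) v : ℝ)| := by
    intro x
    -- Near each point a coordinate frame of the trivialization, cut off to global sections, spans;
    -- compactness of `S³` then leaves finitely many such frames.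
    let e := trivializationAt F V x
    have hx : e.baseSet ∈ 𝓝 x :=
      e.open_baseSet.mem_nhds (FiberBundle.mem_baseSet_trivializationAt' x)
    have hsm : ∀ j : Fin m, ∃ τ : ∀ x, V x,
        ContMDiff (𝓡 3) ((𝓡 3).prod 𝓘(ℝ, F)) ∞ (fun y => TotalSpace.mk' F y (τ y)) ∧
        ∀ᶠ y in 𝓝 x, τ y = e.symm y (b j) := by
      intro j
      refine exists_global F ?_
      filter_upwards [hx] with y hy
      have h1 := e.contMDiffOn_symm (n := ∞) (IB := 𝓡 3)
      have h2 : ContMDiffOn (𝓡 3) ((𝓡 3).prod 𝓘(ℝ, F)) ∞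
          (fun y => TotalSpace.mk' F y (e.symm y (b j))) e.baseSet := by
        have h3 : ContMDiffOn (𝓡 3) ((𝓡 3).prod 𝓘(ℝ, F)) ∞
          (fun y : S3 => e.toOpenPartialHomeomorph.symm (y, b j)) e.baseSet := by
          refine h1.comp (contMDiff_id.prodMk contMDiff_const).contMDiffOn ?_
          intro z hz
          simpa [e.mem_target] using hz
        refine h3.congr fun z hz => ?_
        exact e.mk_symm hz (b j)
      exact h2.contMDiffAt (e.open_baseSet.mem_nhds hy)
    choose σ hσ hσe using hsm
    obtain ⟨D, hD, hD'⟩ := eventually_norm_trivializationAt_lt F V x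
    let N : ℝ := ∑ j : Fin m, ‖(b.coord j).toContinuousLinearMap‖
    have hN : 0 ≤ N := Finset.sum_nonneg fun _ _ => norm_nonneg _
    refine ⟨σ, N * D, mul_nonneg hN hD.le, hσ, ?_⟩
    filter_upwards [hD', hx, Filter.eventually_all.2 hσe] with y hy1 hy2 hy3 v
    have h1 : v = ∑ j, b.repr (e.continuousLinearMapAt ℝ y v) j • σ j y := by
      have h2 : e.symmL ℝ y (e.continuousLinearMapAt ℝ y v) = v :=
        e.symmL_continuousLinearMapAt hy2 v
      conv_lhs => rw [← h2, ← b.sum_repr (e.continuousLinearMapAt ℝ y v), map_sum]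
      refine Finset.sum_congr rfl fun j _ => ?_
      rw [map_smul, hy3 j, e.symmL_apply hy2]
    have h2 : ∀ j, |b.repr (e.continuousLinearMapAt ℝ y v) j| ≤ N * D * ‖v‖ := by
      intro j
      have h3 := (b.coord j).toContinuousLinearMap.le_opNorm (e.continuousLinearMapAt ℝ y v)
      have h4 : ‖e.continuousLinearMapAt ℝ y v‖ ≤ D * ‖v‖ :=
        ContinuousLinearMap.le_of_opNorm_le _ hy1.le v
      have h5 : ‖(b.coord j).toContinuousLinearMap‖ ≤ N :=
        Finset.single_le_sum (f := fun j => ‖(b.coord j).toContinuousLinearMap‖)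
          (fun _ _ => norm_nonneg _) (Finset.mem_univ j)
      calc |b.repr (e.continuousLinearMapAt ℝ y v) j|
          ≤ ‖(b.coord j).toContinuousLinearMap‖ * ‖e.continuousLinearMapAt ℝ y v‖ := h3
        _ ≤ N * (D * ‖v‖) := by gcongr
        _ = _ := by ring
    -- Expand one factor of `⟨v, v⟩` in the frame; the coefficients are at most `N * D * ‖v‖`.
    -- Cancelling `‖v‖` gives the claim.
    have h3 : ‖v‖ ^ 2 ≤ (N * D * ∑ j, |(inner ℝ (σ j y) v : ℝ)|) * ‖v‖ := by
      rw [← real_inner_self_eq_norm_sq]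
      refine (congrArg (fun w => (inner ℝ w v : ℝ)) h1).trans_le ?_
      rw [sum_inner]
      simp only [inner_smul_left]
      rw [Finset.mul_sum, Finset.sum_mul]
      refine Finset.sum_le_sum fun j _ => ?_
      refine (le_abs_self _).trans ?_
      rw [abs_mul]
      calc _ ≤ N * D * ‖v‖ * |(inner ℝ (σ j y) v : ℝ)| := by
            gcongr
            exact h2 j
        _ = _ := by ring
    by_cases hv : ‖v‖ = 0
    · rw [hv]
      exact mul_nonneg (mul_nonneg hN hD.le) (Finset.sum_nonneg fun _ _ => abs_nonneg _)
    · have hv' : 0 < ‖v‖ := lt_of_le_of_ne (norm_nonneg _) (Ne.symm hv)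
      rw [sq] at h3
      exact le_of_mul_le_mul_right h3 hv'
  choose σ C hC hσ hσC using hloc
  obtain ⟨t, -, ht⟩ := isCompact_univ.elim_nhds_subcover _ fun x _ => hσC x
  let J := t × Fin m
  let eJ : Fin (Fintype.card J) ≃ J := (Fintype.equivFin J).symm
  refine ⟨Fintype.card J, fun j => σ (eJ j).1 (eJ j).2, ∑ x ∈ t, C x,
    Finset.sum_nonneg fun x _ => hC x, fun j => hσ _ _, fun y v => ?_⟩
  obtain ⟨x, hx, hy⟩ := mem_iUnion₂.1 (ht (mem_univ y))
  refine (hy v).trans ?_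
  have h1 : ∑ j, |(inner ℝ (σ (eJ j).1 (eJ j).2 y) v : ℝ)|
      = ∑ p : J, |(inner ℝ (σ p.1 p.2 y) v : ℝ)| :=
    eJ.sum_comp fun p : J => |(inner ℝ (σ p.1 p.2 y) v : ℝ)|
  rw [h1, Fintype.sum_prod_type]
  refine mul_le_mul (Finset.single_le_sum (fun x _ => hC x) hx) ?_
    (Finset.sum_nonneg fun _ _ => abs_nonneg _) (Finset.sum_nonneg fun x _ => hC x)
  exact Finset.single_le_sum (f := fun x : t => ∑ j : Fin m, |(inner ℝ (σ x j y) v : ℝ)|)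
    (fun x _ => Finset.sum_nonneg fun _ _ => abs_nonneg _) (Finset.mem_univ (⟨x, hx⟩ : t))

lemma norm_le_sum_pairSq {n : ℕ} {σ : Fin n → ∀ x, V x} {C : ℝ}
    (hC : ∀ (x : S3) (v : V x), ‖v‖ ≤ C * ∑ j, |(inner ℝ (σ j x) v : ℝ)|)
    (s : RoughSection V I) (y : S3) : √(normSq s y) ≤ C * ∑ j, √(pairSq (σ j) s y) := by
  by_cases h : y ∈ U
  · have hu := isUnitFrameAt_frame (I := I) ⟨y, h⟩
    have h1 := hu.normSq_eq s
    have h2 := fun j => hu.pairSq_eq (σ j) s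
    simp only at h1 h2
    simp only [h1, h2, Real.sqrt_sq_eq_abs, abs_norm]
    exact hC _ _
  · simp [normSq, pairSq, extendZero_of_notMem _ h]

section Scalars

variable [∀ x, InnerProductSpace 𝕜 (V x)] [∀ x, IsScalarTower ℝ 𝕜 (V x)] [SmoothScalars 𝕜 F V]
  (cov)

lemma re_nablaInner_self (s : RoughSection V I) (y : U) :
    RCLike.re (nablaInner 𝕜 F cov s s y) = gradSq cov s (y : S3) := by
  rw [gradSq, extendZero_coe, nablaInner, map_sum]
  exact Finset.sum_congr rfl fun i _ => inner_self_eq_norm_sq _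

lemma continuous_gradSq [MetricConnection 𝕜 F V cov] {s : RoughSection V I} (hs : IsSmooth F s) {K : Set U}
    (hK : IsCompact K) (hsK : ∀ y ∉ K, s y = 0) : Continuous (gradSq cov s) := by
  refine continuous_extendZero hK (fun y hy => ?_) ?_
  · have h1 : ∀ᶠ z in 𝓝 y, s z = 0 := by
      filter_upwards [hK.isClosed.isOpen_compl.mem_nhds hy] with z hz
      exact hsK z hz
    simp [nabla_eq_zero F cov h1]
  · have h1 := RCLike.continuous_re.comp (continuous_nablaInner 𝕜 F cov hs hs)
    refine h1.congr fun y => ?_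
    refine (re_nablaInner_self 𝕜 cov s y).trans ?_
    rw [gradSq, extendZero_coe]

end Scalars

end GradientBounds

/-! ### Estimates along rotation circles -/

section Rotation


/-- The rotation by the angle `θ` in the plane spanned by the orthonormal vectors `a` and `b`. -/
def planeMap (a b : E4) (θ : ℝ) : E4 →ₗ[ℝ] E4 :=
  LinearMap.id
    + (((Real.cos θ - 1) • (innerₗ E4 a) - Real.sin θ • (innerₗ E4 b)).smulRight a
    + (Real.sin θ • (innerₗ E4 a) + (Real.cos θ - 1) • (innerₗ E4 b)).smulRight b)

lemma planeMap_apply (a b : E4) (θ : ℝ) (y : E4) : planeMap a b θ y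
    = y + (((Real.cos θ - 1) * inner ℝ a y - Real.sin θ * inner ℝ b y) • a
      + (Real.sin θ * inner ℝ a y + (Real.cos θ - 1) * inner ℝ b y) • b) := by
  simp [planeMap]

variable {a b : E4}

lemma norm_planeMap (ha : ‖a‖ = 1) (hb : ‖b‖ = 1) (hab : inner ℝ a b = (0 : ℝ)) (θ : ℝ) (y : E4) :
    ‖planeMap a b θ y‖ = ‖y‖ := by
  rw [← sq_eq_sq₀ (norm_nonneg _) (norm_nonneg _), planeMap_apply, ← real_inner_self_eq_norm_sq,
    ← real_inner_self_eq_norm_sq]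
  have haa : inner ℝ a a = (1 : ℝ) := by rw [real_inner_self_eq_norm_sq, ha, one_pow]
  have hbb : inner ℝ b b = (1 : ℝ) := by rw [real_inner_self_eq_norm_sq, hb, one_pow]
  have hba : inner ℝ b a = (0 : ℝ) := by rw [real_inner_comm, hab]
  simp only [inner_add_left, inner_add_right, inner_smul_left, inner_smul_right, haa, hbb, hab,
    hba, RCLike.conj_to_real, real_inner_comm a y, real_inner_comm b y]
  have h1 := Real.sin_sq_add_cos_sq θ
  linear_combination ((inner ℝ a y : ℝ) ^ 2 + (inner ℝ b y : ℝ) ^ 2) * h1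

/-- The rotation in the plane spanned by `a` and `b`, as a linear isometry. -/
def planeRotation (ha : ‖a‖ = 1) (hb : ‖b‖ = 1) (hab : inner ℝ a b = (0 : ℝ)) (θ : ℝ) :
    E4 ≃ₗᵢ[ℝ] E4 :=
  LinearIsometry.toLinearIsometryEquiv ⟨planeMap a b θ, norm_planeMap ha hb hab θ⟩ rfl

variable (ha : ‖a‖ = 1) (hb : ‖b‖ = 1) (hab : inner ℝ a b = (0 : ℝ))

lemma coe_rotate_planeRotation (θ : ℝ) (x : S3) :
    (rotate (planeRotation ha hb hab θ) x : E4) = planeMap a b θ x := rfl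

lemma continuous_rotate_planeRotation :
    Continuous fun p : S3 × ℝ => rotate (planeRotation ha hb hab p.2) p.1 := by
  refine Continuous.subtype_mk (f := fun p : S3 × ℝ => planeMap a b p.2 p.1) ?_ _
  simp only [planeMap_apply]
  fun_prop

lemma hasDerivAt_planeMap (y : E4) (θ : ℝ) : HasDerivAt (fun t => planeMap a b t y)
    ((-Real.sin θ * inner ℝ a y - Real.cos θ * inner ℝ b y) • a
      + (Real.cos θ * inner ℝ a y - Real.sin θ * inner ℝ b y) • b) θ := by
  simp only [planeMap_apply]
  have hc := Real.hasDerivAt_cos θ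
  have hs := Real.hasDerivAt_sin θ
  refine HasDerivAt.const_add y (HasDerivAt.add (HasDerivAt.smul_const ?_ a)
    (HasDerivAt.smul_const ?_ b))
  · exact ((hc.sub_const 1).mul_const _).sub (hs.mul_const _)
  · refine ((hs.mul_const _).add ((hc.sub_const 1).mul_const _)).congr_deriv ?_
    ring

include ha hb hab in
lemma norm_deriv_planeMap_le (y : E4) (θ : ℝ) {ε : ℝ} (hε : 0 ≤ ε)
    (hy : (inner ℝ a y : ℝ) ^ 2 + (inner ℝ b y : ℝ) ^ 2 ≤ ε ^ 2) :
    ‖(-Real.sin θ * inner ℝ a y - Real.cos θ * inner ℝ b y) • a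
      + (Real.cos θ * inner ℝ a y - Real.sin θ * inner ℝ b y) • b‖ ≤ ε := by
  rw [← sq_le_sq₀ (norm_nonneg _) hε, ← real_inner_self_eq_norm_sq]
  have haa : inner ℝ a a = (1 : ℝ) := by rw [real_inner_self_eq_norm_sq, ha, one_pow]
  have hbb : inner ℝ b b = (1 : ℝ) := by rw [real_inner_self_eq_norm_sq, hb, one_pow]
  have hba : inner ℝ b a = (0 : ℝ) := by rw [real_inner_comm, hab]
  simp only [inner_add_left, inner_add_right, inner_smul_left, inner_smul_right, haa, hbb, hab,
    hba, RCLike.conj_to_real]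
  have h1 := Real.sin_sq_add_cos_sq θ
  refine le_of_eq_of_le ?_ hy
  linear_combination ((inner ℝ a y : ℝ) ^ 2 + (inner ℝ b y : ℝ) ^ 2) * h1

include ha hb hab in
/-- A function whose components vanish somewhere on a short circle is controlled by its gradient
along the circle. -/
lemma le_integral_of_exists_zero {n : ℕ} {q : Fin n → S3 → ℝ} {f d : S3 → ℝ} {C M ε : ℝ}
    (hC : 0 ≤ C) (hM : 0 ≤ M) (hε : 0 ≤ ε) (hf : Continuous f) (hd : Continuous d)
    (hf0 : ∀ x, 0 ≤ f x) (hd0 : ∀ x, 0 ≤ d x)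
    (hq : ∀ j, SqrtGradBound (q j) (fun x => M * (f x + d x)))
    (hfq : ∀ y, f y ≤ C * ∑ j, √(q j y)) (hsmall : C * (n * (ε * M)) * (2 * Real.pi) ≤ 1 / 2)
    {x : S3} {c : ℝ → S3} (hcc : Continuous c) (hcx : ∀ t, (c t : E4) = planeMap a b t x)
    (hx : (inner ℝ a (x : E4) : ℝ) ^ 2 + (inner ℝ b (x : E4) : ℝ) ^ 2 ≤ ε ^ 2)
    (hz : ∀ j, ∃ t ∈ Icc (-Real.pi) Real.pi, q j (c t) = 0) :
    f x ≤ 2 * (C * (n * (ε * M))) * ∫ t in (-Real.pi)..Real.pi, d (c t) := by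
  have hπ := Real.pi_pos
  have hrad : ∀ t, radial (planeMap a b t x) = c t := fun t => by
    rw [← hcx, radial_coe]
  have hnorm : ∀ t, ‖planeMap a b t x‖ = 1 := fun t => by
    rw [norm_planeMap ha hb hab]
    simp
  have hg0 : ∀ t, 0 ≤ M * (f (c t) + d (c t)) := fun t =>
    mul_nonneg hM (add_nonneg (hf0 _) (hd0 _))
  have hgc : Continuous fun t => M * (f (c t) + d (c t)) :=
    ((hf.comp hcc).add (hd.comp hcc)).const_mul M
  -- The orbit of `x` is a circle of radius at most `ε`, hence of speed at most `ε`, so each `√(q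
  -- j)` varies by at most `ε` times the integral of its gradient bound over the full circle.
  have hpath : ∀ j, ∀ t₀ t₁, t₀ ≤ t₁ → t₀ ∈ Icc (-Real.pi) Real.pi → t₁ ∈ Icc (-Real.pi) Real.pi →
      |√(q j (c t₁)) - √(q j (c t₀))|
        ≤ ε * ∫ t in (-Real.pi)..Real.pi, M * (f (c t) + d (c t)) := by
    intro j t₀ t₁ h01 h0 h1
    have h2 := (hq j).sub_le ((hf.add hd).const_mul M)
      (fun y => mul_nonneg hM (add_nonneg (hf0 y) (hd0 y)))
      (γ := fun t => planeMap a b t x) (M := ε) h01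
      (fun t _ => hasDerivAt_planeMap (x : E4) t)
      (fun t _ => by
        rw [← norm_ne_zero_iff, hnorm]
        exact one_ne_zero)
      (fun t _ => by
        rw [hnorm, mul_one]
        exact norm_deriv_planeMap_le ha hb hab (x : E4) t hε hx)
    simp only [hrad] at h2
    refine h2.trans ?_
    gcongr
    exact intervalIntegral.integral_mono_interval h0.1 h01 h1.2
      (Filter.Eventually.of_forall hg0) (hgc.intervalIntegrable _ _)
  -- Start each path at a zero of `q j`, then sum the `n` estimates; `f` is controlled by this sum.
  have hbound : ∀ t ∈ Icc (-Real.pi) Real.pi, f (c t)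
      ≤ C * (n * (ε * M)) * ∫ t in (-Real.pi)..Real.pi, (f (c t) + d (c t)) := by
    intro t ht
    have h1 : ∀ j, √(q j (c t)) ≤ ε * ∫ t in (-Real.pi)..Real.pi, M * (f (c t) + d (c t)) := by
      intro j
      obtain ⟨t', ht', h0⟩ := hz j
      have h2 : |√(q j (c t)) - √(q j (c t'))|
          ≤ ε * ∫ t in (-Real.pi)..Real.pi, M * (f (c t) + d (c t)) := by
        rcases le_total t' t with h | h
        · exact hpath j t' t h ht' ht
        · rw [abs_sub_comm]
          exact hpath j t t' h ht ht'
      simp only [h0, Real.sqrt_zero, sub_zero] at h2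
      exact (le_abs_self _).trans h2
    refine (hfq (c t)).trans ?_
    calc C * ∑ j, √(q j (c t))
        ≤ C * ∑ _j : Fin n, ε * ∫ t in (-Real.pi)..Real.pi, M * (f (c t) + d (c t)) := by
          gcongr with j
          exact h1 j
      _ = _ := by
          rw [intervalIntegral.integral_const_mul]
          simp
          ring
  -- Evaluate at a maximum of `f` on the circle. The integral of `f` is at most `2π` times this
  -- maximum, and the smallness hypothesis makes that term at most half of the left side, so it is
  -- absorbed.
  obtain ⟨t₀, ht₀, hmax⟩ := isCompact_Icc.exists_isMaxOn (s := Icc (-Real.pi) Real.pi)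
    ⟨0, by constructor <;> linarith⟩ (hf.comp hcc).continuousOn
  have hmax' : ∀ t ∈ Icc (-Real.pi) Real.pi, f (c t) ≤ f (c t₀) := fun t ht => hmax ht
  have hfi : ∫ t in (-Real.pi)..Real.pi, f (c t) ≤ 2 * Real.pi * f (c t₀) := by
    have h1 : ∫ t in (-Real.pi)..Real.pi, f (c t) ≤ ∫ _t in (-Real.pi)..Real.pi, f (c t₀) :=
      intervalIntegral.integral_mono_on (by linarith) ((hf.comp hcc).intervalIntegrable _ _)
        intervalIntegrable_const hmax'
    rw [intervalIntegral.integral_const, smul_eq_mul] at h1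
    exact h1.trans_eq (by ring)
  have hsplit : ∫ t in (-Real.pi)..Real.pi, (f (c t) + d (c t))
      = (∫ t in (-Real.pi)..Real.pi, f (c t)) + ∫ t in (-Real.pi)..Real.pi, d (c t) :=
    intervalIntegral.integral_add ((hf.comp hcc).intervalIntegrable _ _)
      ((hd.comp hcc).intervalIntegrable _ _)
  set k := C * (n * (ε * M)) with hk
  have hk0 : 0 ≤ k := by positivity
  have h1 := hbound t₀ ht₀
  rw [hsplit, mul_add] at h1
  have h2 : k * ∫ t in (-Real.pi)..Real.pi, f (c t) ≤ 1 / 2 * f (c t₀) := by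
    calc _ ≤ k * (2 * Real.pi * f (c t₀)) := by gcongr
      _ = (k * (2 * Real.pi)) * f (c t₀) := by ring
      _ ≤ _ := by
        have := hf0 (c t₀)
        gcongr
  have h3 : f x ≤ f (c t₀) := by
    have h4 := hmax' 0 ⟨by linarith, hπ.le⟩
    have h5 : c 0 = x := Subtype.ext (by simp [hcx, planeMap_apply])
    rwa [h5] at h4
  refine h3.trans ?_
  rw [mul_assoc]
  linarith

/-- Cauchy–Schwarz on an interval of length `2π`, from integrating the square of `2π g - c` with `c`
the integral of `g`. -/
lemma sq_integral_pi_le {g : ℝ → ℝ} (hgc : Continuous g) :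
    (∫ t in (-Real.pi)..Real.pi, g t) ^ 2
      ≤ 2 * Real.pi * ∫ t in (-Real.pi)..Real.pi, g t ^ 2 := by
  have hπ := Real.pi_pos
  set c := (∫ t in (-Real.pi)..Real.pi, g t) with hc
  have h1 : 0 ≤ ∫ t in (-Real.pi)..Real.pi, (2 * Real.pi * g t - c) ^ 2 :=
    intervalIntegral.integral_nonneg (by linarith) fun t _ => sq_nonneg _
  have h2 : ∀ t, (2 * Real.pi * g t - c) ^ 2
      = (2 * Real.pi) ^ 2 * g t ^ 2 - 4 * Real.pi * c * g t + c ^ 2 := fun t => by ring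
  have i1 : IntervalIntegrable (fun t => (2 * Real.pi) ^ 2 * g t ^ 2) volume
    (-Real.pi) Real.pi := ((hgc.pow 2).const_mul _).intervalIntegrable _ _
  have i2 : IntervalIntegrable (fun t => 4 * Real.pi * c * g t) volume
    (-Real.pi) Real.pi := (hgc.const_mul _).intervalIntegrable _ _
  have i3 : IntervalIntegrable (fun t => (2 * Real.pi) ^ 2 * g t ^ 2 - 4 * Real.pi * c * g t)
    volume (-Real.pi) Real.pi := i1.sub i2
  simp only [h2] at h1
  rw [intervalIntegral.integral_add i3 (by simp), intervalIntegral.integral_sub i1 i2,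
    intervalIntegral.integral_const_mul, intervalIntegral.integral_const_mul, ← hc,
    intervalIntegral.integral_const, smul_eq_mul] at h1
  have h3 : 0 ≤ 2 * Real.pi * (2 * Real.pi * (∫ t in (-Real.pi)..Real.pi, g t ^ 2) - c ^ 2) := by
    linarith
  have h4 := nonneg_of_mul_nonneg_right h3 (by positivity)
  linarith

/-- Integration of an estimate along circles over a family of circles. -/
lemma lintegral_le_of_le_integral_rotation {W : Set S3} (hW : MeasurableSet W) {f d : S3 → ℝ}
    (hd : Continuous d) {c : ℝ → S3 → S3}
    (hcont : Continuous fun p : S3 × ℝ => c p.2 p.1)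
    (hmp : ∀ t, MeasurePreserving (c t) surfaceMeasure surfaceMeasure) (hf0 : ∀ x, 0 ≤ f x) {k : ℝ}
    (h : ∀ x ∈ W, f x
      ≤ k * ∫ t in (-Real.pi)..Real.pi, d (c t x)) :
    ∫⁻ x in W, ‖f x‖ₑ ^ 2 ∂surfaceMeasure ≤ ENNReal.ofReal (k ^ 2 * (2 * Real.pi))
      * (ENNReal.ofReal (2 * Real.pi) * ∫⁻ x, ENNReal.ofReal (d x ^ 2) ∂surfaceMeasure) := by
  have hπ := Real.pi_pos
  have hpt : ∀ x ∈ W, ‖f x‖ₑ ^ 2 ≤ ENNReal.ofReal (k ^ 2 * (2 * Real.pi))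
      * ∫⁻ t in Ioc (-Real.pi) Real.pi,
        ENNReal.ofReal (d (c t x) ^ 2) := by
    intro x hx
    set g : ℝ → ℝ := fun t => d (c t x) with hg
    have hgc : Continuous g := hd.comp (hcont.comp (f := fun t => (x, t)) (by fun_prop))
    have hcs := sq_integral_pi_le hgc
    have h2 : ∫⁻ t in Ioc (-Real.pi) Real.pi, ENNReal.ofReal (g t ^ 2)
        = ENNReal.ofReal (∫ t in (-Real.pi)..Real.pi, g t ^ 2) := by
      rw [intervalIntegral.integral_of_le (by linarith),
        ofReal_integral_eq_lintegral_ofReal]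
      · exact ((hgc.pow 2).intervalIntegrable (-Real.pi) Real.pi).1
      · exact Filter.Eventually.of_forall fun t => sq_nonneg _
    rw [h2, ← ENNReal.ofReal_mul (by positivity), ← ofReal_norm,
      ← ENNReal.ofReal_pow (norm_nonneg _), Real.norm_eq_abs, sq_abs]
    refine ENNReal.ofReal_le_ofReal ?_
    calc f x ^ 2 ≤ (k * ∫ t in (-Real.pi)..Real.pi, g t) ^ 2 := by
          have := h x hx
          have := hf0 x
          gcongr
      _ = k ^ 2 * (∫ t in (-Real.pi)..Real.pi, g t) ^ 2 := by ring
      _ ≤ k ^ 2 * (2 * Real.pi * ∫ t in (-Real.pi)..Real.pi, g t ^ 2) := by gcongr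
      _ = _ := by ring
  refine (setLIntegral_mono' hW hpt).trans ?_
  rw [lintegral_const_mul' _ _ ENNReal.ofReal_ne_top]
  gcongr
  have hdm : Measurable fun x => ENNReal.ofReal (d x ^ 2) := (hd.pow 2).measurable.ennreal_ofReal
  have hm : Measurable fun p : S3 × ℝ =>
      ENNReal.ofReal (d (c p.2 p.1) ^ 2) :=
    hdm.comp hcont.measurable
  -- Enlarge `W` to the sphere and exchange the integrals: each map `c t` preserves the measure, so
  -- the inner integral does not depend on `t`.
  calc _ ≤ ∫⁻ x, (∫⁻ t in Ioc (-Real.pi) Real.pi,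
        ENNReal.ofReal (d (c t x) ^ 2)) ∂surfaceMeasure :=
        setLIntegral_le_lintegral _ _
    _ = ∫⁻ t in Ioc (-Real.pi) Real.pi, ∫⁻ x,
        ENNReal.ofReal (d (c t x) ^ 2) ∂surfaceMeasure :=
        lintegral_lintegral_swap hm.aemeasurable
    _ = ∫⁻ t in Ioc (-Real.pi) Real.pi, ∫⁻ x, ENNReal.ofReal (d x ^ 2) ∂surfaceMeasure := by
        congr 1
        funext t
        exact (hmp t).lintegral_comp hdm
    _ ≤ _ := by
        rw [setLIntegral_const, mul_comm, Real.volume_Ioc]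
        rw [sub_neg_eq_add, ← two_mul]

end Rotation

/-! ### Explicit disks bounded by rotation circles -/

section LinkingDisk

variable (B : OrthonormalBasis (Fin 4) ℝ E4) (x : E4)

/-- A plane transversal to the first two basis vectors, parametrized such that the point `1`
corresponds to `x`. -/
def linkingPlane (w : ℂ) : E4 :=
  ((inner ℝ (B 0) x : ℝ) • B 0 + (inner ℝ (B 1) x : ℝ) • B 1)
    + ((w.re * inner ℝ (B 2) x - w.im * inner ℝ (B 3) x) • B 2
      + (w.re * inner ℝ (B 3) x + w.im * inner ℝ (B 2) x) • B 3)

/-- The disk in the three-sphere that bounds the circle through `x` around the plane spanned by the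
first two basis vectors. -/
def linkingDisk (w : ℂ) : S3 := radial (linkingPlane B x w)

lemma norm_sq_eq_sum_inner (y : E4) : ‖y‖ ^ 2 = (inner ℝ (B 0) y : ℝ) ^ 2
    + (inner ℝ (B 1) y : ℝ) ^ 2 + (inner ℝ (B 2) y : ℝ) ^ 2 + (inner ℝ (B 3) y : ℝ) ^ 2 := by
  have h := B.sum_sq_norm_inner_right y
  rw [Fin.sum_univ_four] at h
  simp only [Real.norm_eq_abs, sq_abs] at h
  exact h.symm

lemma ext_inner_basis {y z : E4} (h : ∀ i, inner ℝ (B i) y = (inner ℝ (B i) z : ℝ)) : y = z := by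
  rw [← B.sum_repr' y, ← B.sum_repr' z]
  simp only [h]

lemma inner_linkingPlane_zero (w : ℂ) :
    inner ℝ (B 0) (linkingPlane B x w) = (inner ℝ (B 0) x : ℝ) := by
  simp [linkingPlane, inner_add_right, inner_smul_right]

lemma inner_linkingPlane_one (w : ℂ) :
    inner ℝ (B 1) (linkingPlane B x w) = (inner ℝ (B 1) x : ℝ) := by
  simp [linkingPlane, inner_add_right, inner_smul_right]

lemma inner_linkingPlane_two (w : ℂ) : inner ℝ (B 2) (linkingPlane B x w)
    = (w.re * inner ℝ (B 2) x - w.im * inner ℝ (B 3) x : ℝ) := by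
  simp [linkingPlane, inner_add_right, inner_smul_right]

lemma inner_linkingPlane_three (w : ℂ) : inner ℝ (B 3) (linkingPlane B x w)
    = (w.re * inner ℝ (B 3) x + w.im * inner ℝ (B 2) x : ℝ) := by
  simp [linkingPlane, inner_add_right, inner_smul_right]

lemma norm_sq_linkingPlane (w : ℂ) : ‖linkingPlane B x w‖ ^ 2 = (inner ℝ (B 0) x : ℝ) ^ 2
    + (inner ℝ (B 1) x : ℝ) ^ 2
    + ‖w‖ ^ 2 * ((inner ℝ (B 2) x : ℝ) ^ 2 + (inner ℝ (B 3) x : ℝ) ^ 2) := by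
  rw [norm_sq_eq_sum_inner B, inner_linkingPlane_zero, inner_linkingPlane_one,
    inner_linkingPlane_two, inner_linkingPlane_three, Complex.sq_norm, Complex.normSq_apply]
  ring

variable {x} (hx0 : 0 < (inner ℝ (B 0) x : ℝ))
include hx0

lemma linkingPlane_ne_zero (w : ℂ) : linkingPlane B x w ≠ 0 := by
  intro h
  have h1 := inner_linkingPlane_zero B x w
  rw [h, inner_zero_right] at h1
  exact hx0.ne h1

lemma coe_linkingDisk (w : ℂ) :
    (linkingDisk B x w : E4) = ‖linkingPlane B x w‖⁻¹ • linkingPlane B x w :=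
  coe_radial (linkingPlane_ne_zero B hx0 w)

lemma contDiff_linkingDisk : ContDiff ℝ ∞ fun w => (linkingDisk B x w : E4) := by
  simp only [coe_linkingDisk B hx0]
  have h1 : ContDiff ℝ ∞ (linkingPlane B x) := by
    unfold linkingPlane
    have hre : ContDiff ℝ ∞ Complex.re := Complex.reCLM.contDiff
    have him : ContDiff ℝ ∞ Complex.im := Complex.imCLM.contDiff
    fun_prop
  exact ((h1.norm ℝ (linkingPlane_ne_zero B hx0)).inv fun w =>
    norm_ne_zero_iff.2 (linkingPlane_ne_zero B hx0 w)).smul h1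

/-- The plane keeps the first two coordinates of `x` and normalization keeps their ratio. Thus the
disk lies in a linear hyperplane, and intersections with an edge are zeros of one linear function.
-/
lemma inner_one_linkingDisk (w : ℂ) :
    (inner ℝ (B 0) x : ℝ) * inner ℝ (B 1) (linkingDisk B x w : E4)
      = (inner ℝ (B 1) x : ℝ) * inner ℝ (B 0) (linkingDisk B x w : E4) := by
  rw [coe_linkingDisk B hx0, inner_smul_right, inner_smul_right, inner_linkingPlane_zero,
    inner_linkingPlane_one]
  ring

/-- A left inverse of the parametrization of the disk. -/
def linkingDiskInv (x y : E4) : ℂ :=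
  ((inner ℝ (B 0) y : ℝ)⁻¹ * (inner ℝ (B 0) x : ℝ)) •
    ((Complex.equivRealProdCLM.symm (inner ℝ (B 2) y, inner ℝ (B 3) y))
      * (Complex.equivRealProdCLM.symm (inner ℝ (B 2) x, inner ℝ (B 3) x))⁻¹)

variable (hx2 : 0 < (inner ℝ (B 2) x : ℝ))
include hx2

/-- The first coordinate reveals the normalizing factor; then `w` is the quotient of the complex
numbers formed by the last two coordinates. Positivity of the third coordinate of `x` makes the
divisor nonzero. -/
lemma linkingDiskInv_linkingDisk (w : ℂ) : linkingDiskInv B x (linkingDisk B x w) = w := by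
  have hk : ‖linkingPlane B x w‖⁻¹ ≠ 0 :=
    inv_ne_zero (norm_ne_zero_iff.2 (linkingPlane_ne_zero B hx0 w))
  have hξ : (Complex.equivRealProdCLM.symm
      ((inner ℝ (B 2) x : ℝ), (inner ℝ (B 3) x : ℝ))) ≠ 0 := by
    intro h
    have := congrArg Complex.re h
    simp at this
    exact hx2.ne' this
  have hprod : Complex.equivRealProdCLM.symm
      ((w.re * inner ℝ (B 2) x - w.im * inner ℝ (B 3) x : ℝ),
        (w.re * inner ℝ (B 3) x + w.im * inner ℝ (B 2) x : ℝ))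
      = w * Complex.equivRealProdCLM.symm
      ((inner ℝ (B 2) x : ℝ), (inner ℝ (B 3) x : ℝ)) := by
    apply Complex.ext <;> simp
  rw [linkingDiskInv, coe_linkingDisk B hx0, inner_smul_right, inner_smul_right, inner_smul_right,
    inner_linkingPlane_zero, inner_linkingPlane_two, inner_linkingPlane_three]
  rw [← smul_eq_mul (a := ‖linkingPlane B x w‖⁻¹) (b := w.re * _ - _),
    ← smul_eq_mul (a := ‖linkingPlane B x w‖⁻¹) (b := w.re * _ + _), ← Prod.smul_mk, map_smul,
    hprod, smul_mul_assoc, mul_assoc, mul_inv_cancel₀ hξ, mul_one, smul_smul]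
  have h2 : (‖linkingPlane B x w‖⁻¹ * (inner ℝ (B 0) x : ℝ))⁻¹ * (inner ℝ (B 0) x : ℝ)
      * ‖linkingPlane B x w‖⁻¹ = 1 := by
    have h3 := hx0.ne'
    have h4 := inv_ne_zero hk
    rw [inv_inv] at h4
    field_simp
  rw [h2, one_smul]

/-- A left inverse that is differentiable at the image point makes the differential injective, by
the chain rule. -/
lemma injective_fderiv_linkingDisk (w : ℂ) :
    Function.Injective (fderiv ℝ (fun w => (linkingDisk B x w : E4)) w) := by
  have h0 : (inner ℝ (B 0) (linkingDisk B x w : E4) : ℝ) ≠ 0 := by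
    rw [coe_linkingDisk B hx0, inner_smul_right, inner_linkingPlane_zero]
    exact mul_ne_zero (inv_ne_zero (norm_ne_zero_iff.2 (linkingPlane_ne_zero B hx0 w))) hx0.ne'
  have hG : DifferentiableAt ℝ (linkingDiskInv B x) (linkingDisk B x w : E4) := by
    unfold linkingDiskInv
    refine DifferentiableAt.smul (DifferentiableAt.mul_const (DifferentiableAt.inv (innerSL ℝ (B 0)).differentiableAt h0)
      _) (DifferentiableAt.mul_const ?_ _)
    exact Complex.equivRealProdCLM.symm.differentiableAt.comp _
      ((innerSL ℝ (B 2)).differentiableAt.prodMk (innerSL ℝ (B 3)).differentiableAt)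
  have hD : DifferentiableAt ℝ (fun w => (linkingDisk B x w : E4)) w :=
    (contDiff_linkingDisk B hx0).differentiable (by simp) w
  have h1 := fderiv_comp w hG hD
  have h2 : linkingDiskInv B x ∘ (fun w => (linkingDisk B x w : E4)) = id :=
    funext (linkingDiskInv_linkingDisk B hx0 hx2)
  rw [h2, fderiv_id] at h1
  intro v v' hv
  have h3 := congrArg (fun L : ℂ →L[ℝ] ℂ => L v) h1
  have h4 := congrArg (fun L : ℂ →L[ℝ] ℂ => L v') h1
  simp only [ContinuousLinearMap.comp_apply, ContinuousLinearMap.id_apply] at h3 h4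
  rw [h3, h4, hv]

omit hx2 in
-- For `‖w‖ ≤ 1` the point of the plane has norm at most `‖x‖ = 1`, so normalizing it can only
-- increase its first coordinate. The closed disk thus stays in the cap cut out by the first
-- coordinate of `x`.
lemma le_inner_linkingDisk (hx : ‖x‖ = 1) {w : ℂ} (hw : ‖w‖ ≤ 1) :
    (inner ℝ (B 0) x : ℝ) ≤ inner ℝ (B 0) (linkingDisk B x w : E4) := by
  rw [coe_linkingDisk B hx0, inner_smul_right, inner_linkingPlane_zero]
  refine le_mul_of_one_le_left hx0.le ?_
  refine (one_le_inv₀ (norm_pos_iff.2 (linkingPlane_ne_zero B hx0 w))).2 ?_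
  rw [← sq_le_sq₀ (norm_nonneg _) zero_le_one, norm_sq_linkingPlane, one_pow]
  have h1 := norm_sq_eq_sum_inner B x
  rw [hx, one_pow] at h1
  have h2 : ‖w‖ ^ 2 ≤ 1 := by
    rw [sq_le_one_iff_abs_le_one, abs_norm]
    exact hw
  have h3 : 0 ≤ (inner ℝ (B 2) x : ℝ) ^ 2 + (inner ℝ (B 3) x : ℝ) ^ 2 := by positivity
  nlinarith

/-- Divide `y` by the ratio `k` of first coordinates to reach the plane and read off `z` from the
last two coordinates. That point has norm `1 / k < 1`, whereas `‖z‖ ≥ 1` would force norm at least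
`1`. -/
lemma exists_linkingDisk_eq (hx : ‖x‖ = 1) {y : S3}
    (hy0 : (inner ℝ (B 0) x : ℝ) < inner ℝ (B 0) (y : E4))
    (hy1 : (inner ℝ (B 0) x : ℝ) * inner ℝ (B 1) (y : E4)
      = (inner ℝ (B 1) x : ℝ) * inner ℝ (B 0) (y : E4)) :
    ∃ z, ‖z‖ < 1 ∧ linkingDisk B x z = y := by
  set ξ : ℂ := ⟨inner ℝ (B 2) x, inner ℝ (B 3) x⟩ with hξ
  have hξ0 : ξ ≠ 0 := by
    intro h
    have := congrArg Complex.re h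
    exact hx2.ne' this
  set k : ℝ := inner ℝ (B 0) (y : E4) / inner ℝ (B 0) x with hk
  have hk1 : 1 < k := (one_lt_div hx0).2 hy0
  have hk0 : 0 < k := one_pos.trans hk1
  set z : ℂ := (⟨inner ℝ (B 2) (y : E4), inner ℝ (B 3) (y : E4)⟩ : ℂ) / (k * ξ) with hz
  have hz1 : k * (z * ξ) = ⟨inner ℝ (B 2) (y : E4), inner ℝ (B 3) (y : E4)⟩ := by
    rw [hz]
    have : (k : ℂ) ≠ 0 := by exact_mod_cast hk0.ne'
    field_simp
  have hre := congrArg Complex.re hz1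
  have him := congrArg Complex.im hz1
  simp only [Complex.mul_re, Complex.mul_im, Complex.ofReal_re, Complex.ofReal_im, hξ, zero_mul,
    sub_zero, add_zero] at hre him
  have hy : (y : E4) = k • linkingPlane B x z := by
    apply ext_inner_basis B
    intro i
    rw [inner_smul_right]
    fin_cases i
    · change inner ℝ (B 0) (y : E4) = k * inner ℝ (B 0) _
      rw [inner_linkingPlane_zero, hk, div_mul_cancel₀ _ hx0.ne']
    · change inner ℝ (B 1) (y : E4) = k * inner ℝ (B 1) _
      rw [inner_linkingPlane_one, hk, div_mul_eq_mul_div, eq_div_iff hx0.ne']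
      linarith
    · change inner ℝ (B 2) (y : E4) = k * inner ℝ (B 2) _
      rw [inner_linkingPlane_two, ← hre]
    · change inner ℝ (B 3) (y : E4) = k * inner ℝ (B 3) _
      rw [inner_linkingPlane_three, ← him]
  have hn : ‖(y : E4)‖ = 1 := by simp
  have hkn : k * ‖linkingPlane B x z‖ = 1 := by
    rw [hy, norm_smul, Real.norm_eq_abs, abs_of_pos hk0] at hn
    exact hn
  refine ⟨z, ?_, ?_⟩
  · by_contra! hz1
    have h1 : 1 ≤ ‖linkingPlane B x z‖ := by
      rw [← sq_le_sq₀ zero_le_one (norm_nonneg _), norm_sq_linkingPlane, one_pow]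
      have h1 := norm_sq_eq_sum_inner B x
      rw [hx, one_pow] at h1
      have h2 : 1 ≤ ‖z‖ ^ 2 := one_le_pow₀ hz1
      have h3 : 0 ≤ (inner ℝ (B 2) x : ℝ) ^ 2 + (inner ℝ (B 3) x : ℝ) ^ 2 := by positivity
      nlinarith
    nlinarith
  · apply Subtype.ext
    rw [coe_linkingDisk B hx0, hy, inv_eq_of_mul_eq_one_left hkn]

omit hx2 in
-- Multiplying by `exp (iθ)` rotates the last two coordinates, and the result already has norm one.
-- So the boundary of the disk is the orbit of `x`.
lemma linkingDisk_exp (hx : ‖x‖ = 1) (θ : ℝ) :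
    (linkingDisk B x (Circle.exp θ) : E4) = planeMap (B 2) (B 3) θ x := by
  have h1 : linkingPlane B x (Circle.exp θ) = planeMap (B 2) (B 3) θ x := by
    apply ext_inner_basis B
    have hre : ((Circle.exp θ : Circle) : ℂ).re = Real.cos θ := by
      rw [Circle.coe_exp, Complex.exp_ofReal_mul_I_re]
    have him : ((Circle.exp θ : Circle) : ℂ).im = Real.sin θ := by
      rw [Circle.coe_exp, Complex.exp_ofReal_mul_I_im]
    intro i
    rw [planeMap_apply]
    fin_cases i
    · change inner ℝ (B 0) _ = inner ℝ (B 0) _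
      rw [inner_linkingPlane_zero]
      simp [inner_add_right, inner_smul_right]
    · change inner ℝ (B 1) _ = inner ℝ (B 1) _
      rw [inner_linkingPlane_one]
      simp [inner_add_right, inner_smul_right]
    · change inner ℝ (B 2) _ = inner ℝ (B 2) _
      rw [inner_linkingPlane_two, hre, him]
      simp [inner_add_right, inner_smul_right]
      ring
    · change inner ℝ (B 3) _ = inner ℝ (B 3) _
      rw [inner_linkingPlane_three, hre, him]
      simp [inner_add_right, inner_smul_right]
      ring
  have h2 : ‖linkingPlane B x (Circle.exp θ)‖ = 1 := by
    rw [h1, norm_planeMap (B.orthonormal.1 2) (B.orthonormal.1 3) (by simp), hx]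
  rw [coe_linkingDisk B hx0, h2, inv_one, one_smul, h1]

end LinkingDisk

/-! ### Short rotation circles around an edge are linking circles -/

section LinkingCircle

variable {Γ : EmbeddedGraph}

/-- A rotation circle around an edge is a linking circle. -/
lemma exists_isLinkingCircle (B : OrthonormalBasis (Fin 4) ℝ E4) {x : S3}
    (hx0 : 0 < (inner ℝ (B 0) (x : E4) : ℝ)) (hx2 : 0 < (inner ℝ (B 2) (x : E4) : ℝ))
    {e : Fin Γ.numEdges} {t₀ : ℝ} (ht₀ : t₀ ∈ Ioo (0 : ℝ) 1)
    (h0 : (inner ℝ (B 0) (x : E4) : ℝ) < inner ℝ (B 0) (Γ.arc e t₀ : E4))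
    (h1 : (inner ℝ (B 0) (x : E4) : ℝ) * inner ℝ (B 1) (Γ.arc e t₀ : E4)
      = (inner ℝ (B 1) (x : E4) : ℝ) * inner ℝ (B 0) (Γ.arc e t₀ : E4))
    (hd : (inner ℝ (B 0) (x : E4) : ℝ) * inner ℝ (B 1) (deriv (fun r => (Γ.arc e r : E4)) t₀)
      ≠ (inner ℝ (B 1) (x : E4) : ℝ) * inner ℝ (B 0) (deriv (fun r => (Γ.arc e r : E4)) t₀))
    (hu : ∀ y ∈ Γ.carrier, (inner ℝ (B 0) (x : E4) : ℝ) ≤ inner ℝ (B 0) (y : E4) →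
      (inner ℝ (B 0) (x : E4) : ℝ) * inner ℝ (B 1) (y : E4)
      = (inner ℝ (B 1) (x : E4) : ℝ) * inner ℝ (B 0) (y : E4) → y = Γ.arc e t₀) :
    ∃ c : Circle → Γ.compl, Γ.IsLinkingCircle c ∧
      ∀ θ, ((c (Circle.exp θ) : S3) : E4) = planeMap (B 2) (B 3) θ x := by
  have hx : ‖(x : E4)‖ = 1 := by simp
  obtain ⟨z₀, hz₀, hDz₀⟩ := exists_linkingDisk_eq B hx0 hx2 hx h0 h1
  have hinj : Function.Injective (linkingDisk B (x : E4)) := by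
    intro z z' h
    rw [← linkingDiskInv_linkingDisk B hx0 hx2 z, h, linkingDiskInv_linkingDisk B hx0 hx2 z']
  -- The closed disk lies in the cap and in the hyperplane, where by `hu` the graph has only the
  -- point on the edge.
  have hmem : ∀ z : ℂ, ‖z‖ ≤ 1 → (linkingDisk B (x : E4) z ∈ Γ.carrier ↔ z = z₀) := by
    intro z hz
    constructor
    · intro h
      apply hinj
      rw [hDz₀]
      exact hu _ h (le_inner_linkingDisk B hx0 hx hz) (inner_one_linkingDisk B hx0 z)
    · rintro rfl
      rw [hDz₀]
      exact Or.inr (mem_iUnion.2 ⟨e, t₀, Ioo_subset_Icc_self ht₀, rfl⟩)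
  refine ⟨fun z => ⟨linkingDisk B (x : E4) z, fun h => ?_⟩, ?_, fun θ =>
    linkingDisk_exp B hx0 hx θ⟩
  · have h3 := (hmem z (Circle.norm_coe z).le).1 h
    rw [← h3, Circle.norm_coe] at hz₀
    exact lt_irrefl _ hz₀
  refine ⟨linkingDisk B (x : E4), contDiff_linkingDisk B hx0, hinj.injOn,
    fun z _ => injective_fderiv_linkingDisk B hx0 hx2 z, fun z => rfl, z₀, by simpa using hz₀, e, t₀,
    ht₀, hDz₀, fun z hz => hmem z (by simpa using hz), ?_⟩
  -- Transversality: the linear function defining the hyperplane vanishes identically on the disk,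
  -- hence on its tangent vectors, but not on the velocity of the edge.
  rintro ⟨v, hv⟩
  apply hd
  have hD : HasFDerivAt (fun w => (linkingDisk B (x : E4) w : E4))
      (fderiv ℝ (fun w => (linkingDisk B (x : E4) w : E4)) z₀) z₀ :=
    ((contDiff_linkingDisk B hx0).differentiable (by simp) z₀).hasFDerivAt
  have hL : ∀ i, HasFDerivAt (fun w => inner ℝ (B i) (linkingDisk B (x : E4) w : E4))
      ((innerSL ℝ (B i)).comp (fderiv ℝ (fun w => (linkingDisk B (x : E4) w : E4)) z₀)) z₀ :=
    fun i => (innerSL ℝ (B i)).hasFDerivAt.comp z₀ hD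
  have h4 := (hL 1).const_mul (inner ℝ (B 0) (x : E4) : ℝ)
  have h5 := (hL 0).const_mul (inner ℝ (B 1) (x : E4) : ℝ)
  have h6 := h4.unique (h5.congr_of_eventuallyEq (Filter.Eventually.of_forall fun w =>
    inner_one_linkingDisk B hx0 w))
  have h7 := congrArg (fun L : ℂ →L[ℝ] ℝ => L v) h6
  simpa [hv] using h7

/-- The points on short circles around an edge form a neighborhood of some point. -/
lemma exists_eventually_isLinkingCircle (hpos : 0 < Γ.numEdges) {ε : ℝ} (hε : 0 < ε) :
    ∃ (B : OrthonormalBasis (Fin 4) ℝ E4) (x₀ : S3), ∀ᶠ x : S3 in 𝓝 x₀,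
      (inner ℝ (B 2) (x : E4) : ℝ) ^ 2 + (inner ℝ (B 3) (x : E4) : ℝ) ^ 2 ≤ ε ^ 2 ∧
      ∃ c : Circle → Γ.compl, Γ.IsLinkingCircle c ∧
        ∀ θ, ((c (Circle.exp θ) : S3) : E4) = planeMap (B 2) (B 3) θ x := by
  let e : Fin Γ.numEdges := ⟨0, hpos⟩
  set γ : ℝ → E4 := fun t => (Γ.arc e t : E4) with hγ
  have hγ1 : ∀ t, ‖γ t‖ = 1 := fun t => by simp [hγ]
  have hsm : ContDiffOn ℝ ∞ γ (Ioo 0 1) := (Γ.smooth e).mono Ioo_subset_Icc_self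
  have hder : ∀ t ∈ Ioo (0 : ℝ) 1, HasDerivAt γ (deriv γ t) t := fun t ht =>
    ((hsm.contDiffAt (isOpen_Ioo.mem_nhds ht)).differentiableAt (by simp)).hasDerivAt
  have hcd : ContinuousOn (deriv γ) (Ioo 0 1) :=
    hsm.continuousOn_deriv_of_isOpen isOpen_Ioo (by simp)
  have hmid : (1 / 2 : ℝ) ∈ Ioo (0 : ℝ) 1 := by norm_num
  set p := γ (1 / 2) with hp
  set τ := deriv γ (1 / 2) with hτ
  have hτ0 : τ ≠ 0 := by
    have h1 := Γ.immersed e (1 / 2) (Ioo_subset_Icc_self hmid)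
    rwa [derivWithin_of_mem_nhds (Icc_mem_nhds hmid.1 hmid.2)] at h1
  have hpτ : inner ℝ p τ = (0 : ℝ) := by
    have h1 := (hder _ hmid).inner ℝ (hder _ hmid)
    have h2 : (fun t => (inner ℝ (γ t) (γ t) : ℝ)) = fun _ => 1 := by
      funext t
      rw [real_inner_self_eq_norm_sq, hγ1, one_pow]
    rw [h2] at h1
    have h3 := h1.unique (hasDerivAt_const (1 / 2 : ℝ) (1 : ℝ))
    have h4 : inner ℝ τ p = (inner ℝ p τ : ℝ) := real_inner_comm _ _
    change inner ℝ p τ + inner ℝ τ p = (0 : ℝ) at h3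
    linarith
  -- A basis adapted to the midpoint of the edge: the point itself, the unit tangent, and the plane
  -- normal to both, in which the rotations take place.
  obtain ⟨B, hB0, hB1⟩ : ∃ B : OrthonormalBasis (Fin 4) ℝ E4, B 0 = p ∧ B 1 = ‖τ‖⁻¹ • τ := by
    have hv : Orthonormal ℝ (({0, 1} : Set (Fin 4)).domRestrict ![p, ‖τ‖⁻¹ • τ, p, p]) := by
      have hp1 : ‖p‖ = 1 := hγ1 _
      have hn1 : ‖‖τ‖⁻¹ • τ‖ = 1 := norm_smul_inv_norm (𝕜 := ℝ) hτ0
      have hτp : inner ℝ τ p = (0 : ℝ) := by rw [real_inner_comm, hpτ]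
      have h : ∀ i j : Fin 4, i ∈ ({0, 1} : Set (Fin 4)) → j ∈ ({0, 1} : Set (Fin 4)) →
          inner ℝ (![p, ‖τ‖⁻¹ • τ, p, p] i) (![p, ‖τ‖⁻¹ • τ, p, p] j)
            = if i = j then (1 : ℝ) else 0 := by
        rintro i j (rfl | rfl) (rfl | rfl) <;>
          simp [inner_smul_left, inner_smul_right, hpτ, hτp, hp1, hn1]
      rw [orthonormal_iff_ite]
      rintro ⟨i, hi⟩ ⟨j, hj⟩
      exact (h i j hi hj).trans (by simp)
    obtain ⟨B, hB⟩ := hv.exists_orthonormalBasis_extension_of_card_eq (by simp)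
    exact ⟨B, hB 0 (by simp), hB 1 (by simp)⟩
  have hB1τ : 0 < (inner ℝ (B 1) τ : ℝ) := by
    rw [hB1, inner_smul_left, real_inner_self_eq_norm_sq]
    have := norm_pos_iff.2 hτ0
    simp only [RCLike.conj_to_real]
    positivity
  have hB0p : inner ℝ (B 0) p = (1 : ℝ) := by rw [hB0, real_inner_self_eq_norm_sq, hγ1, one_pow]
  have hBp : ∀ i, i ≠ 0 → inner ℝ (B i) p = (0 : ℝ) := fun i hi => by
    rw [← hB0, B.inner_eq_ite, if_neg hi]
  -- On a window of parameters the edge moves strictly in the direction `B 1`; this will give a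
  -- unique, transversal intersection.
  obtain ⟨δ₁, hδ₁, hδ₁', hpos₁⟩ : ∃ δ₁ : ℝ, 0 < δ₁ ∧ δ₁ ≤ 1 / 4 ∧
      ∀ t ∈ Icc (1 / 2 - δ₁) (1 / 2 + δ₁), 0 < (inner ℝ (B 1) (deriv γ t) : ℝ) := by
    have h1 : ContinuousAt (fun t => (inner ℝ (B 1) (deriv γ t) : ℝ)) (1 / 2) :=
      (innerSL ℝ (B 1)).continuous.continuousAt.comp
        (hcd.continuousAt (isOpen_Ioo.mem_nhds hmid))
    obtain ⟨r, hr, hr'⟩ := Metric.eventually_nhds_iff.1 (h1.eventually_const_lt hB1τ)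
    refine ⟨min (r / 2) (1 / 4), by positivity, min_le_right _ _, fun t ht => hr' ?_⟩
    have h2 := min_le_left (r / 2) (1 / 4 : ℝ)
    rw [Real.dist_eq, abs_lt]
    constructor <;> linarith [ht.1, ht.2]
  have hIoo : Icc (1 / 2 - δ₁) (1 / 2 + δ₁) ⊆ Ioo (0 : ℝ) 1 := fun t ht =>
    ⟨by linarith [ht.1], by linarith [ht.2]⟩
  have hγc : ContinuousOn γ (Icc (1 / 2 - δ₁) (1 / 2 + δ₁)) := fun t ht =>
    (hder t (hIoo ht)).continuousAt.continuousWithinAt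
  -- A cap around `p` that meets the graph only in this window: the rest of the graph is a closed
  -- set `Z` not containing `p`.
  obtain ⟨c₁, hc₁0, hc₁1, hc₁⟩ : ∃ c₁ : ℝ, 0 < c₁ ∧ c₁ < 1 ∧ ∀ y ∈ Γ.carrier,
      c₁ ≤ inner ℝ (B 0) (y : E4) → ∃ t ∈ Icc (1 / 2 - δ₁) (1 / 2 + δ₁), y = Γ.arc e t := by
    have hac : ∀ e', ContinuousOn (Γ.arc e') (Icc 0 1) := fun e' =>
      Topology.IsInducing.subtypeVal.continuousOn_iff.2 (Γ.smooth e').continuousOn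
    set Z : Set S3 := ↑Γ.vertices ∪ ((⋃ e' : {e' // e' ≠ e}, Γ.arc e' '' Icc 0 1)
      ∪ Γ.arc e '' (Icc 0 1 \ Ioo (1 / 2 - δ₁) (1 / 2 + δ₁))) with hZ
    have hZc : IsClosed Z := by
      refine Γ.vertices.finite_toSet.isClosed.union (IsClosed.union
        (isClosed_iUnion_of_finite fun e' => (isCompact_Icc.image_of_continuousOn (hac _)).isClosed)
        ?_)
      exact ((isCompact_Icc.diff isOpen_Ioo).image_of_continuousOn
        ((hac e).mono sdiff_subset)).isClosed
    have hpZ : Γ.arc e (1 / 2) ∉ Z := by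
      rintro (h | h | ⟨t, ht, h⟩)
      · exact Γ.interior_notMem e _ hmid h
      · obtain ⟨e', t, ht, h⟩ := mem_iUnion.1 h
        exact Γ.disjoint e e' e'.2.symm _ hmid t ht h.symm
      · have := Γ.injective e ht.1 (Ioo_subset_Icc_self hmid) h
        rw [this] at ht
        exact ht.2 ⟨by linarith, by linarith⟩
    obtain ⟨r, hr, hr'⟩ := Metric.mem_nhds_iff.1 (hZc.isOpen_compl.mem_nhds hpZ)
    have hr2 : 0 < min r 1 := lt_min hr one_pos
    have hr3 := min_le_right r 1
    -- For unit vectors `‖y - p‖² = 2 - 2⟨y, p⟩`, so this height of the cap forces `‖y - p‖² ≤ (min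
    -- r 1)² / 2`.
    refine ⟨1 - (min r 1) ^ 2 / 4, by nlinarith, by nlinarith, fun y hy hy0 => ?_⟩
    have hyZ : y ∉ Z := by
      refine hr' (Metric.mem_ball.2 (lt_of_lt_of_le ?_ (min_le_left r 1)))
      rw [Subtype.dist_eq, dist_eq_norm, ← sq_lt_sq₀ (norm_nonneg _) hr2.le, norm_sub_sq_real]
      have h1 : ‖(y : E4)‖ = 1 := by simp
      have h2 : ‖(Γ.arc e (1 / 2) : E4)‖ = 1 := by simp
      have h3 : inner ℝ (y : E4) (Γ.arc e (1 / 2) : E4) = (inner ℝ (B 0) (y : E4) : ℝ) := by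
        rw [hB0, real_inner_comm]
      rw [h1, h2, h3]
      nlinarith
    rcases hy with hy | hy
    · exact absurd (Or.inl hy) hyZ
    · obtain ⟨e', t, ht, rfl⟩ := mem_iUnion.1 hy
      by_cases he : e' = e
      · subst he
        refine ⟨t, ?_, rfl⟩
        by_contra h
        exact hyZ (Or.inr (Or.inr ⟨t, ⟨ht, fun h' => h (Ioo_subset_Icc_self h')⟩, rfl⟩))
      · exact absurd (show Γ.arc e' t ∈ Z from
          Or.inr (Or.inl (mem_iUnion.2 ⟨⟨e', he⟩, t, ht, rfl⟩))) hyZ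
  -- `s` is the radius of the circle through `x₀`: below `ε`, and so small that `x₀`, whose height
  -- is `√(1 - s²)`, lies in the cap.
  obtain ⟨s, hs0, hs1, hsε, hsc⟩ : ∃ s : ℝ, 0 < s ∧ s < 1 ∧ s < ε ∧ c₁ < √(1 - s ^ 2) := by
    have h1 : Continuous fun s : ℝ => √(1 - s ^ 2) := by fun_prop
    have h2 : ∀ᶠ s : ℝ in 𝓝 0, c₁ < √(1 - s ^ 2) :=
      h1.continuousAt.eventually_const_lt (by simpa using hc₁1)
    have h3 : ∀ᶠ s : ℝ in 𝓝[>] 0, 0 < s ∧ s < 1 ∧ s < ε ∧ c₁ < √(1 - s ^ 2) := by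
      filter_upwards [self_mem_nhdsWithin, nhdsWithin_le_nhds h2,
        nhdsWithin_le_nhds (eventually_lt_nhds one_pos),
        nhdsWithin_le_nhds (eventually_lt_nhds hε)] with s h h' h'' h'''
      exact ⟨h, h'', h''', h'⟩
    exact h3.exists
  set κ := √(1 - s ^ 2) with hκ
  have hκ2 : κ ^ 2 = 1 - s ^ 2 := Real.sq_sqrt (by nlinarith)
  have hκ0 : 0 < κ := hc₁0.trans hsc
  have hκ1 : κ < 1 := by nlinarith
  have hin : ∀ i, inner ℝ (B i) (κ • B 0 + s • B 2)
      = κ * (if i = 0 then 1 else 0) + s * (if i = 2 then 1 else 0) := fun i => by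
    rw [inner_add_right, inner_smul_right, inner_smul_right, B.inner_eq_ite, B.inner_eq_ite]
  let x₀ : S3 := ⟨κ • B 0 + s • B 2, by
    rw [mem_sphere_zero_iff_norm, ← sq_eq_sq₀ (norm_nonneg _) zero_le_one,
      norm_sq_eq_sum_inner B, hin, hin, hin, hin]
    simp
    linarith⟩
  have hx0 : inner ℝ (B 0) (x₀ : E4) = κ := (hin 0).trans (by simp)
  have hx1 : inner ℝ (B 1) (x₀ : E4) = (0 : ℝ) := (hin 1).trans (by simp)
  have hx2 : inner ℝ (B 2) (x₀ : E4) = s := (hin 2).trans (by simp)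
  have hx3 : inner ℝ (B 3) (x₀ : E4) = (0 : ℝ) := (hin 3).trans (by simp)
  have hic : ∀ i, Continuous fun x : S3 => (inner ℝ (B i) (x : E4) : ℝ) := fun i => by fun_prop
  obtain ⟨δ, hδ, hδδ, hκδ⟩ : ∃ δ : ℝ, 0 < δ ∧ δ ≤ δ₁ ∧
      ∀ t ∈ Icc (1 / 2 - δ) (1 / 2 + δ), κ < inner ℝ (B 0) (γ t) := by
    have h1 : ContinuousAt (fun t => (inner ℝ (B 0) (γ t) : ℝ)) (1 / 2) :=
      (innerSL ℝ (B 0)).continuous.continuousAt.comp (hder _ hmid).continuousAt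
    obtain ⟨r, hr, hr'⟩ := Metric.eventually_nhds_iff.1 (h1.eventually_const_lt
      (show κ < inner ℝ (B 0) (γ (1 / 2)) by rw [← hp, hB0p]; exact hκ1))
    refine ⟨min (r / 2) δ₁, by positivity, min_le_right _ _, fun t ht => hr' ?_⟩
    have h2 := min_le_left (r / 2) δ₁
    rw [Real.dist_eq, abs_lt]
    constructor <;> linarith [ht.1, ht.2]
  have hδs : Icc (1 / 2 - δ) (1 / 2 + δ) ⊆ Icc (1 / 2 - δ₁) (1 / 2 + δ₁) :=
    Icc_subset_Icc (by linarith) (by linarith)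
  -- `f x t` vanishes exactly when the edge at parameter `t` lies in the hyperplane containing the
  -- disk of `x`.
  set f : S3 → ℝ → ℝ := fun x t => inner ℝ (B 0) (x : E4) * inner ℝ (B 1) (γ t)
    - inner ℝ (B 1) (x : E4) * inner ℝ (B 0) (γ t) with hf
  have hfd : ∀ x, ∀ t ∈ Ioo (0 : ℝ) 1, HasDerivAt (f x) (inner ℝ (B 0) (x : E4) *
      inner ℝ (B 1) (deriv γ t) - inner ℝ (B 1) (x : E4) * inner ℝ (B 0) (deriv γ t)) t := by
    intro x t ht
    have h1 : ∀ i, HasDerivAt (fun t => (inner ℝ (B i) (γ t) : ℝ)) (inner ℝ (B i) (deriv γ t)) t :=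
      fun i => (innerSL ℝ (B i)).hasFDerivAt.comp_hasDerivAt t (hder t ht)
    exact ((h1 1).const_mul _).sub ((h1 0).const_mul _)
  have hmono : ∀ x : S3, (∀ t ∈ Icc (1 / 2 - δ₁) (1 / 2 + δ₁), 0 < inner ℝ (B 0) (x : E4) *
      inner ℝ (B 1) (deriv γ t) - inner ℝ (B 1) (x : E4) * inner ℝ (B 0) (deriv γ t)) →
      StrictMonoOn (f x) (Icc (1 / 2 - δ₁) (1 / 2 + δ₁)) := by
    intro x h
    refine strictMonoOn_of_deriv_pos (convex_Icc _ _) (fun t ht =>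
      (hfd x t (hIoo ht)).continuousAt.continuousWithinAt) fun t ht => ?_
    rw [interior_Icc] at ht
    rw [(hfd x t (hIoo (Ioo_subset_Icc_self ht))).deriv]
    exact h t (Ioo_subset_Icc_self ht)
  have hf0 : f x₀ (1 / 2) = 0 := by
    simp only [hf, hx1, ← hp, hBp 1 (by decide)]
    ring
  have hmono₀ := hmono x₀ (fun t ht => by
    rw [hx0, hx1, zero_mul, sub_zero]
    exact mul_pos hκ0 (hpos₁ t ht))
  have hmem : (1 / 2 : ℝ) ∈ Icc (1 / 2 - δ₁) (1 / 2 + δ₁) := ⟨by linarith, by linarith⟩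
  have hleft : f x₀ (1 / 2 - δ) < 0 :=
    hf0 ▸ hmono₀ (hδs (left_mem_Icc.2 (by linarith))) hmem (by linarith)
  have hright : 0 < f x₀ (1 / 2 + δ) :=
    hf0 ▸ hmono₀ hmem (hδs (right_mem_Icc.2 (by linarith))) (by linarith)
  have hfc : ∀ t, Continuous fun x => f x t := fun t =>
    ((hic 0).mul continuous_const).sub ((hic 1).mul continuous_const)
  -- The conditions satisfied by `x₀` are open, uniformly in `t` because the window is compact, so
  -- they persist for nearby `x`.
  have hevd : ∀ᶠ x : S3 in 𝓝 x₀, ∀ t ∈ Icc (1 / 2 - δ₁) (1 / 2 + δ₁), 0 < inner ℝ (B 0) (x : E4) *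
      inner ℝ (B 1) (deriv γ t) - inner ℝ (B 1) (x : E4) * inner ℝ (B 0) (deriv γ t) := by
    refine isCompact_Icc.eventually_forall_of_forall_eventually fun t ht => ?_
    have h1 : ∀ i, ContinuousAt (fun z : S3 × ℝ => (inner ℝ (B i) (deriv γ z.2) : ℝ)) (x₀, t) :=
      fun i => (innerSL ℝ (B i)).continuous.continuousAt.comp
        (ContinuousAt.comp (f := fun z : S3 × ℝ => z.2) (x := (x₀, t))
          (hcd.continuousAt (isOpen_Ioo.mem_nhds (hIoo ht))) continuousAt_snd)
    have h2 : ∀ i, ContinuousAt (fun z : S3 × ℝ => (inner ℝ (B i) (z.1 : E4) : ℝ)) (x₀, t) :=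
      fun i => ((hic i).comp continuous_fst).continuousAt
    refine (((h2 0).mul (h1 1)).sub ((h2 1).mul (h1 0))).eventually_const_lt ?_
    change 0 < inner ℝ (B 0) (x₀ : E4) * inner ℝ (B 1) (deriv γ t)
      - inner ℝ (B 1) (x₀ : E4) * inner ℝ (B 0) (deriv γ t)
    rw [hx0, hx1, zero_mul, sub_zero]
    exact mul_pos hκ0 (hpos₁ t ht)
  have hevκ : ∀ᶠ x : S3 in 𝓝 x₀, ∀ t ∈ Icc (1 / 2 - δ) (1 / 2 + δ),
      (inner ℝ (B 0) (x : E4) : ℝ) < inner ℝ (B 0) (γ t) := by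
    refine isCompact_Icc.eventually_forall_of_forall_eventually fun t ht => ?_
    have h1 : ContinuousAt (fun z : S3 × ℝ => (inner ℝ (B 0) (γ z.2) : ℝ)) (x₀, t) :=
      (innerSL ℝ (B 0)).continuous.continuousAt.comp
        (ContinuousAt.comp (f := fun z : S3 × ℝ => z.2) (x := (x₀, t))
          (hder t (hIoo (hδs ht))).continuousAt continuousAt_snd)
    have h2 : ContinuousAt (fun z : S3 × ℝ => (inner ℝ (B 0) (z.1 : E4) : ℝ)) (x₀, t) :=
      ((hic 0).comp continuous_fst).continuousAt
    refine h2.eventually_lt h1 ?_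
    rw [hx0]
    exact hκδ t ht
  refine ⟨B, x₀, ?_⟩
  filter_upwards [hevd, hevκ,
    (hfc (1 / 2 - δ)).continuousAt.eventually_lt_const hleft,
    (hfc (1 / 2 + δ)).continuousAt.eventually_const_lt hright,
    (hic 0).continuousAt.eventually_const_lt (show c₁ < inner ℝ (B 0) (x₀ : E4) by rwa [hx0]),
    (hic 2).continuousAt.eventually_const_lt (show 0 < inner ℝ (B 2) (x₀ : E4) by rwa [hx2]),
    (((hic 2).pow 2).add ((hic 3).pow 2)).continuousAt.eventually_lt_const
      (show (inner ℝ (B 2) (x₀ : E4) : ℝ) ^ 2 + (inner ℝ (B 3) (x₀ : E4) : ℝ) ^ 2 < ε ^ 2 by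
        rw [hx2, hx3]
        nlinarith)] with x h1 h2 h3 h4 h5 h6 h7
  refine ⟨h7.le, ?_⟩
  have hm := hmono x h1
  -- The sign change yields an intersection parameter in the smaller window, where the edge is
  -- higher than `x`; strict monotonicity on the larger window makes it unique.
  obtain ⟨t₀, ht₀, hft₀⟩ := intermediate_value_Icc (by linarith : 1 / 2 - δ ≤ 1 / 2 + δ)
    (fun t ht => (hfd x t (hIoo (hδs ht))).continuousAt.continuousWithinAt :
      ContinuousOn (f x) (Icc (1 / 2 - δ) (1 / 2 + δ))) ⟨h3.le, h4.le⟩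
  refine exists_isLinkingCircle B (hc₁0.trans h5) h6 (hIoo (hδs ht₀)) (h2 t₀ ht₀)
    (sub_eq_zero.1 hft₀) (fun h => (h1 t₀ (hδs ht₀)).ne' (sub_eq_zero.2 h)) ?_
  intro y hy hy0 hy1
  obtain ⟨t, ht, rfl⟩ := hc₁ y hy (h5.le.trans hy0)
  rw [hm.injOn ht (hδs ht₀) ((sub_eq_zero.2 hy1).trans hft₀.symm)]

end LinkingCircle

/-! ### Zeros forced by the Möbius bundle, and the two norms as integrals over the sphere -/

lemma enorm_sqrt_sq {q : ℝ} (hq : 0 ≤ q) : ‖√q‖ₑ ^ 2 = ENNReal.ofReal q := by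
  rw [Real.enorm_eq_ofReal (Real.sqrt_nonneg q), ← ENNReal.ofReal_pow (Real.sqrt_nonneg q),
    Real.sq_sqrt hq]

lemma lintegral_extendZero {U : TopologicalSpace.Opens S3} (f : U → ℝ) :
    ∫⁻ x, ENNReal.ofReal (extendZero f x) ∂surfaceMeasure
      = ∫⁻ y, ENNReal.ofReal (f y) ∂(measureOn U) := by
  have hU : MeasurableSet (U : Set S3) := U.2.measurableSet
  have h1 := lintegral_subtype_comap (μ := surfaceMeasure) hU
    (fun x => ENNReal.ofReal (extendZero f x))
  have h2 : ∫⁻ y, ENNReal.ofReal (f y) ∂(measureOn U)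
      = ∫⁻ y : (U : Set S3), ENNReal.ofReal (extendZero f (y : S3))
        ∂(surfaceMeasure.comap Subtype.val) :=
    lintegral_congr fun y => by rw [← extendZero_coe f y]
  rw [h2, h1, ← lintegral_indicator hU]
  refine lintegral_congr fun x => ?_
  by_cases hx : x ∈ (U : Set S3)
  · rw [indicator_of_mem hx]
  · rw [indicator_of_notMem hx, extendZero_of_notMem f hx, ENNReal.ofReal_zero]

section Poincare

variable (𝕜 : Type*) [RCLike 𝕜]
  {F : Type*} [NormedAddCommGroup F] [NormedSpace ℝ F]
  {V : S3 → Type*} [TopologicalSpace (TotalSpace F V)]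
  [∀ x, NormedAddCommGroup (V x)] [∀ x, InnerProductSpace ℝ (V x)]
  [FiberBundle F V] [VectorBundle ℝ F V]
  {U : TopologicalSpace.Opens S3}
  {I : U → Type*} [TopologicalSpace (TotalSpace ℝ I)]
  [∀ x, NormedAddCommGroup (I x)] [∀ x, InnerProductSpace ℝ (I x)]
  [FiberBundle ℝ I] [VectorBundle ℝ ℝ I] [IsContinuousRiemannianBundle ℝ I]
  [IsContMDiffRiemannianBundle (𝓡 3) ∞ F V]

lemma continuousAt_smul_section {f : U → ℝ} {v : ∀ y : U, I y} {x : U} (hf : ContinuousAt f x)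
    (hv : ContinuousAt (fun z : U => TotalSpace.mk' ℝ z (v z)) x) :
    ContinuousAt (fun z : U => TotalSpace.mk' ℝ z (f z • v z)) x := by
  rw [FiberBundle.continuousAt_totalSpace] at hv ⊢
  refine ⟨hv.1, ?_⟩
  have h1 := hf.mul hv.2
  refine h1.congr ?_
  filter_upwards [(trivializationAt ℝ I x).open_baseSet.mem_nhds
    (FiberBundle.mem_baseSet_trivializationAt' x)] with z hz
  exact (((trivializationAt ℝ I x).linear ℝ hz).map_smul (f z) (v z)).symm

/-- On a closed curve over which the line bundle is the Möbius bundle, the contraction of a section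
of `V ⊗ I` with a section of `V` has a zero. -/
lemma IsMoebius.exists_pairSq_eq_zero {c : Circle → U} (hm : IsMoebius I c) (hc : Continuous c)
    {σ : ∀ x, V x}
    (hσ : ContMDiff (𝓡 3) ((𝓡 3).prod 𝓘(ℝ, F)) ∞ (fun y => TotalSpace.mk' F y (σ y)))
    {s : RoughSection V I} (hs : IsSmooth F s) : ∃ z, pairSq σ s (c z : S3) = 0 := by
  by_contra! h
  -- Contraction with `σ` turns `s` into a section of `I`. The frame enters twice, so its sign
  -- cancels and `k` is continuous; without zeros along `c` it would trivialize the restricted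
  -- bundle.
  let k : ∀ y : U, I y := fun y => (inner ℝ (σ y) (contract (frame I y y) (s y)) : ℝ) • frame I y y
  have hk : Continuous fun y : U => TotalSpace.mk' ℝ y (k y) := by
    rw [continuous_iff_continuousAt]
    intro x
    have hu := isUnitFrameAt_frame (I := I) x
    set u := frame I x with hudef
    have h1 : ContinuousAt (fun y : U => (inner ℝ (σ y) (localRep u s (y : S3)) : ℝ)) x :=
      ContinuousAt.comp (f := fun y : U => (y : S3))
        ((hσ (x : S3)).inner_bundle (hs x u hu)).continuousAt continuous_subtype_val.continuousAt
    refine (continuousAt_smul_section h1 (Filter.Eventually.self_of_nhds hu).2).congr ?_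
    filter_upwards [hu] with y hy
    have h2 := eq_smul_of_norm_eq_one y (a := u y) (b := frame I y y) hy.1
    have h3 := congrArg norm h2
    rw [norm_smul, hy.1, (isUnitFrameAt_frame y).norm_eq, mul_one, Real.norm_eq_abs] at h3
    have h4 : (inner ℝ (u y) (frame I y y) : ℝ) * inner ℝ (u y) (frame I y y) = 1 := by
      rw [← abs_mul_abs_self, ← h3, mul_one]
    have h5 : k y = (inner ℝ (σ y) (localRep u s (y : S3)) : ℝ) • u y := by
      simp only [k]
      rw [h2, contract_smul_left, inner_smul_right, smul_smul, localRep_apply, mul_right_comm, h4,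
        one_mul]
    rw [h5]
  refine hm ⟨fun z => k (c z), hk.comp hc, fun z hz => h z ?_⟩
  have h1 : frame I (c z) (c z) ≠ 0 := by
    rw [← norm_ne_zero_iff, (isUnitFrameAt_frame (c z)).norm_eq]
    exact one_ne_zero
  have h2 := (smul_eq_zero.1 hz).resolve_right h1
  rw [pairSq, extendZero_coe, h2, zero_pow two_ne_zero]

variable [FiniteDimensional ℝ F] [ContMDiffVectorBundle ∞ F V (𝓡 3)]
  {cov : CovariantDerivative (𝓡 3) F V}

/-- Used to give finitely many sections a common bound. -/
lemma HasSectionBound.mono {σ : ∀ x, V x} {M M' : ℝ} (h : HasSectionBound cov σ M) (hM : M ≤ M') :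
    HasSectionBound cov σ M' :=
  ⟨h.1.trans hM, fun x => ⟨((h.2 x).1).trans hM, fun v => ((h.2 x).2 v).trans (by gcongr)⟩⟩

variable (F V) in
/-- Spanning sections with common bounds. -/
lemma exists_spanning_sections_bound (hcov : cov.ContMDiffCovariantDerivative ∞) :
    ∃ (n : ℕ) (σ : Fin n → ∀ x, V x) (C M : ℝ), 0 ≤ C ∧ 0 ≤ M ∧
    (∀ j, ContMDiff (𝓡 3) ((𝓡 3).prod 𝓘(ℝ, F)) ∞ (fun y => TotalSpace.mk' F y (σ j y))) ∧
    (∀ j, HasSectionBound cov (σ j) M) ∧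
    ∀ (x : S3) (v : V x), ‖v‖ ≤ C * ∑ j, |(inner ℝ (σ j x) v : ℝ)| := by
  obtain ⟨n, σ, C, hC, hσ, hσC⟩ := exists_spanning_sections F V
  choose M hM using fun j => exists_hasSectionBound hcov (hσ j)
  refine ⟨n, σ, C, ∑ j, M j, hC, Finset.sum_nonneg fun j _ => (hM j).1, hσ, fun j => ?_, hσC⟩
  exact (hM j).mono (Finset.single_le_sum (fun j _ => (hM j).1) (Finset.mem_univ j))

variable [∀ x, InnerProductSpace 𝕜 (V x)] [∀ x, IsScalarTower ℝ 𝕜 (V x)] [SmoothScalars 𝕜 F V]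

variable {𝕜}

lemma ofReal_norm_toL_sq (s : testSections 𝕜 F V I) : ENNReal.ofReal (‖toL s‖ ^ 2)
    = ∫⁻ x, ENNReal.ofReal (normSq s.1 x) ∂surfaceMeasure := by
  have h1 : ‖toL s‖ = ‖(show PreL 𝕜 F V I from s : PreL 𝕜 F V I)‖ :=
    UniformSpace.Completion.norm_coe _
  rw [h1, norm_sq_preL, normSq, lintegral_extendZero, ofReal_integral_eq_lintegral_ofReal]
  · exact integrable_contract_sq 𝕜 F s
  · exact Filter.Eventually.of_forall fun y => sq_nonneg _

variable (cov) in
lemma ofReal_norm_toH_sq [MetricConnection 𝕜 F V cov] (s : testSections 𝕜 F V I) :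
    ENNReal.ofReal (‖toH cov s‖ ^ 2)
      = ∫⁻ x, ENNReal.ofReal (gradSq cov s.1 x) ∂surfaceMeasure := by
  rw [← inner_self_eq_norm_sq (𝕜 := 𝕜), inner_toH, innerH,
    ← integral_re (integrable_nablaInner 𝕜 F cov s s)]
  have h0 : ∀ y : U, RCLike.re (nablaInner 𝕜 F cov s.1 s.1 y) = ∑ i : Fin 4,
      ‖contract (frame I y y)
        (nabla F cov s.1 y (tangentProj y (EuclideanSpace.single i 1)))‖ ^ 2 := fun y => by
    rw [re_nablaInner_self, gradSq, extendZero_coe]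
  rw [gradSq, lintegral_extendZero, ofReal_integral_eq_lintegral_ofReal]
  · exact lintegral_congr fun y => by rw [h0]
  · exact (integrable_nablaInner 𝕜 F cov s s).re
  · refine Filter.Eventually.of_forall fun y => ?_
    simp only [h0]
    exact Finset.sum_nonneg fun _ _ => sq_nonneg _

end Poincare

/-! ### The Dirichlet norm dominates the `L²` norm -/

section LinkingPoincare

variable (𝕜 : Type*) [RCLike 𝕜] {Γ : EmbeddedGraph}
  {I : Γ.compl → Type*} [TopologicalSpace (TotalSpace ℝ I)]
  [∀ x, NormedAddCommGroup (I x)] [∀ x, InnerProductSpace ℝ (I x)]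
  [FiberBundle ℝ I] [VectorBundle ℝ ℝ I] [IsContinuousRiemannianBundle ℝ I]
  {F : Type*} [NormedAddCommGroup F] [NormedSpace ℝ F] [FiniteDimensional ℝ F]
  {V : S3 → Type*} [TopologicalSpace (TotalSpace F V)]
  [∀ x, NormedAddCommGroup (V x)] [∀ x, InnerProductSpace ℝ (V x)]
  [∀ x, InnerProductSpace 𝕜 (V x)] [∀ x, IsScalarTower ℝ 𝕜 (V x)]
  [FiberBundle F V] [VectorBundle ℝ F V] [ContMDiffVectorBundle ∞ F V (𝓡 3)]
  [IsContMDiffRiemannianBundle (𝓡 3) ∞ F V] [SmoothScalars 𝕜 F V]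
  (cov : CovariantDerivative (𝓡 3) F V) [hcov : MetricConnection 𝕜 F V cov]

lemma EmbeddedGraph.IsLinkingCircle.continuous {c : Circle → Γ.compl} (hc : Γ.IsLinkingCircle c) :
    Continuous c := by
  obtain ⟨D, hD, -, -, hcD, -⟩ := hc
  refine Topology.IsInducing.subtypeVal.continuous_iff.2
    (Topology.IsInducing.subtypeVal.continuous_iff.2 ?_)
  refine (hD.continuous.comp continuous_subtype_val).congr fun z => ?_
  exact congrArg Subtype.val (hcD z).symm

/-- The Poincaré inequality for sections twisted by a line bundle that restricts to the Möbius
bundle on the linking circles. -/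
theorem exists_norm_toL_le (hpos : 0 < Γ.numEdges)
    (hI : ∀ c, Γ.IsLinkingCircle c → IsMoebius I c) :
    ∃ C : ℝ, 0 ≤ C ∧ ∀ s : testSections 𝕜 F V I, ‖toL s‖ ≤ C * ‖toH cov s‖ := by
  have hπ := Real.pi_pos
  obtain ⟨n, σ, C, M, hC, hM, hσ, hσM, hσC⟩ := exists_spanning_sections_bound F V hcov.smooth
  -- The radius `ε` is chosen so that the absorption constant `C n ε M 2π = X / (2X + 1)` is at most
  -- `1/2`.
  set X : ℝ := C * n * M * (2 * Real.pi) with hX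
  have hX0 : 0 ≤ X := by positivity
  set ε : ℝ := 1 / (2 * X + 1) with hε
  have hε0 : 0 < ε := by positivity
  have hsmall : C * (n * (ε * M)) * (2 * Real.pi) ≤ 1 / 2 := by
    have h1 : C * (n * (ε * M)) * (2 * Real.pi) = X / (2 * X + 1) := by rw [hX, hε]; ring
    rw [h1, div_le_iff₀ (by positivity)]
    linarith
  obtain ⟨B, x₀, hx₀⟩ := exists_eventually_isLinkingCircle hpos hε0
  obtain ⟨W, hW, hWo, hxW⟩ := eventually_nhds_iff.1 hx₀
  obtain ⟨C', hC', hpoinc⟩ := exists_global_poincare hWo ⟨x₀, hxW⟩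
  have ha := B.orthonormal.1 2
  have hb := B.orthonormal.1 3
  have hab : inner ℝ (B 2) (B 3) = (0 : ℝ) := by simp
  set κ : ℝ := 2 * (C * (n * (ε * M))) with hκ
  set A : ℝ≥0∞ := ENNReal.ofReal (κ ^ 2 * (2 * Real.pi)) * ENNReal.ofReal (2 * Real.pi) with hA
  have hA' : A ≠ ⊤ := ENNReal.mul_ne_top ENNReal.ofReal_ne_top ENNReal.ofReal_ne_top
  have hfin : C' * (A + 1) ≠ ⊤ :=
    ENNReal.mul_ne_top hC' (ENNReal.add_ne_top.2 ⟨hA', ENNReal.one_ne_top⟩)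
  refine ⟨√(C' * (A + 1)).toReal, Real.sqrt_nonneg _, fun s => ?_⟩
  obtain ⟨hs, K, hK, hsK⟩ := s.2
  have hd : Continuous fun x => √(gradSq cov s.1 x) := (continuous_gradSq 𝕜 cov hs hK hsK).sqrt
  have hf : Continuous fun x => √(normSq s.1 x) :=
    (sqrtGradBound_normSq hcov.metric hs hK hsK).continuous.sqrt
  have hgr : ∀ x, ENNReal.ofReal (√(gradSq cov s.1 x) ^ 2) = ENNReal.ofReal (gradSq cov s.1 x) :=
    fun x => by rw [Real.sq_sqrt (gradSq_nonneg cov s.1 x)]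
  have h1 := hpoinc (normSq s.1) (fun x => √(gradSq cov s.1 x))
    (sqrtGradBound_normSq hcov.metric hs hK hsK) hd (fun x => Real.sqrt_nonneg _)
  have h2 := lintegral_le_of_le_integral_rotation hWo.measurableSet hd
    (c := fun t x => rotate (planeRotation ha hb hab t) x)
    (continuous_rotate_planeRotation ha hb hab) (fun t => measurePreserving_rotate _)
    (f := fun x => √(normSq s.1 x)) (fun x => Real.sqrt_nonneg _) (k := κ) (fun x hx => by
      obtain ⟨hxε, c, hc, hcx⟩ := hW x hx
      refine le_integral_of_exists_zero ha hb hab hC hM hε0.le hf hd (fun x => Real.sqrt_nonneg _)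
        (fun x => Real.sqrt_nonneg _) (fun j => sqrtGradBound_pairSq hcov.metric (hσ j) (hσM j)
          hs hK hsK) (norm_le_sum_pairSq hσC s.1) hsmall
        ((continuous_rotate_planeRotation ha hb hab).comp (f := fun t => (x, t)) (by fun_prop))
        (fun t => coe_rotate_planeRotation ha hb hab t x) hxε fun j => ?_
      -- The zero on the linking circle, located by its argument, which lies in the interval of
      -- integration.
      obtain ⟨z, hz⟩ := (hI c hc).exists_pairSq_eq_zero hc.continuous (hσ j) hs
      refine ⟨Complex.arg z, ⟨(Complex.neg_pi_lt_arg _).le, Complex.arg_le_pi _⟩, ?_⟩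
      have h3 : rotate (planeRotation ha hb hab (Complex.arg z)) x = (c z : S3) := by
        apply Subtype.ext
        rw [coe_rotate_planeRotation, ← hcx, Circle.exp_arg]
      rw [h3, hz])
  simp only [hgr, enorm_sqrt_sq (normSq_nonneg s.1 _), ← ofReal_norm_toH_sq cov s,
    ← ofReal_norm_toL_sq s] at h1 h2
  -- The global Poincaré inequality bounds the `L²` norm by the mass on `W` plus the energy, and the
  -- circles bound the mass on `W` by the energy.
  have h3 : ENNReal.ofReal (‖toL s‖ ^ 2) ≤ C' * (A + 1) * ENNReal.ofReal (‖toH cov s‖ ^ 2) := by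
    refine h1.trans ?_
    rw [mul_assoc, add_mul, one_mul, hA, mul_assoc (ENNReal.ofReal _)]
    gcongr
  rw [← ENNReal.ofReal_toReal hfin, ← ENNReal.ofReal_mul ENNReal.toReal_nonneg,
    ENNReal.ofReal_le_ofReal_iff (by positivity)] at h3
  rw [← sq_le_sq₀ (norm_nonneg _) (by positivity), mul_pow, Real.sq_sqrt ENNReal.toReal_nonneg]
  exact h3

end LinkingPoincare

/-! ### Cubical cells, and the mass on sets of small measure -/

section Grid

/-- The cubes of side `ρ` with vertices in the lattice `ρ ℤ⁴`. -/
def cell (ρ : ℝ) (k : Fin 4 → ℤ) : Set E4 := {y | ∀ i, ⌊y i / ρ⌋ = k i}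

lemma mem_cell {ρ : ℝ} (hρ : 0 < ρ) {k : Fin 4 → ℤ} {y : E4} :
    y ∈ cell ρ k ↔ ∀ i, k i * ρ ≤ y i ∧ y i < (k i + 1) * ρ := by
  simp only [cell, Set.mem_ofPred_eq, Int.floor_eq_iff, le_div_iff₀ hρ, div_lt_iff₀ hρ]

lemma pairwise_disjoint_cell (ρ : ℝ) : Pairwise (Function.onFun Disjoint (cell ρ)) := by
  intro k l hkl
  refine Set.disjoint_left.2 fun y hk hl => hkl ?_
  funext i
  rw [← hk i, hl i]

lemma measurableSet_cell (ρ : ℝ) (k : Fin 4 → ℤ) : MeasurableSet (cell ρ k) := by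
  have h : cell ρ k = ⋂ i, {y : E4 | ⌊y i / ρ⌋ = k i} := by
    ext y
    simp [cell]
  rw [h]
  refine MeasurableSet.iInter fun i => ?_
  have h1 : Measurable fun y : E4 => ⌊y i / ρ⌋ := Int.measurable_floor.comp (by fun_prop)
  exact h1 (measurableSet_singleton _)

lemma convex_cell {ρ : ℝ} (hρ : 0 < ρ) (k : Fin 4 → ℤ) : Convex ℝ (cell ρ k) := by
  intro x hx y hy a b ha hb hab
  rw [mem_cell hρ] at hx hy ⊢
  intro i
  simp only [PiLp.add_apply, PiLp.smul_apply, smul_eq_mul]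
  obtain ⟨h1, h2⟩ := hx i
  obtain ⟨h3, h4⟩ := hy i
  have e : b = 1 - a := by linarith
  subst e
  constructor
  · nlinarith
  · rcases ha.eq_or_lt with rfl | ha
    · linarith
    · nlinarith

/-- Four coordinates, each differing by at most `ρ`; the diagonal of a four-dimensional cube is
twice its side. -/
lemma norm_sub_le_of_mem_cell {ρ : ℝ} (hρ : 0 < ρ) {k : Fin 4 → ℤ} {x y : E4} (hx : x ∈ cell ρ k)
    (hy : y ∈ cell ρ k) : ‖x - y‖ ≤ 2 * ρ := by
  rw [mem_cell hρ] at hx hy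
  rw [← sq_le_sq₀ (norm_nonneg _) (by positivity), EuclideanSpace.real_norm_sq_eq,
    Fin.sum_univ_four]
  have h : ∀ i, (x - y) i ^ 2 ≤ ρ ^ 2 := fun i => by
    obtain ⟨h1, h2⟩ := hx i
    obtain ⟨h3, h4⟩ := hy i
    rw [PiLp.sub_apply]
    exact sq_le_sq' (by linarith) (by linarith)
  linarith [h 0, h 1, h 2, h 3]

lemma volume_cell_ne_zero {ρ : ℝ} (hρ : 0 < ρ) (k : Fin 4 → ℤ) : volume (cell ρ k) ≠ 0 := by
  let O : Set E4 := {y | ∀ i, k i * ρ < y i ∧ y i < (k i + 1) * ρ}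
  have hO : IsOpen O := by
    simp only [O, ofPred_forall]
    refine isOpen_iInter_of_finite fun i => ?_
    have hi : Continuous fun y : E4 => y i := by fun_prop
    exact (isOpen_lt continuous_const hi).inter (isOpen_lt hi continuous_const)
  have hne : O.Nonempty := ⟨WithLp.toLp 2 fun i => (k i + 1 / 2) * ρ, fun i => by
    constructor <;> simp only <;> nlinarith⟩
  have hsub : O ⊆ cell ρ k := fun y hy => (mem_cell hρ).2 fun i => ⟨(hy i).1.le, (hy i).2⟩
  exact ((hO.measure_pos volume hne).trans_le (measure_mono hsub)).ne'

/-- Finitely many cells cover a shell. -/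
lemma exists_finset_cell {ρ : ℝ} (hρ : 0 < ρ) (hρ' : ρ ≤ 1 / 4) :
    ∃ T : Finset (Fin 4 → ℤ), shell 1 2 ⊆ ⋃ k ∈ T, cell ρ k ∧
      ∀ k ∈ T, cell ρ k ⊆ shell (1 / 2) (5 / 2) := by
  let S : Set (Fin 4 → ℤ) := {k | (cell ρ k ∩ shell 1 2).Nonempty}
  have hS : S.Finite := by
    refine (Set.finite_Icc (fun _ : Fin 4 => ⌊-2 / ρ⌋) (fun _ => ⌊2 / ρ⌋)).subset ?_
    rintro k ⟨y, hy, hy1, hy2⟩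
    have h : ∀ i, |y i| ≤ 2 := fun i => (PiLp.norm_apply_le y i).trans hy2.le
    constructor
    · intro i
      rw [← hy i]
      exact Int.floor_le_floor (by gcongr; exact (abs_le.1 (h i)).1)
    · intro i
      rw [← hy i]
      exact Int.floor_le_floor (by gcongr; exact (abs_le.1 (h i)).2)
  refine ⟨hS.toFinset, fun y hy => ?_, fun k hk y hy => ?_⟩
  · refine mem_iUnion₂.2 ⟨fun i => ⌊y i / ρ⌋, hS.mem_toFinset.2 ⟨y, fun i => rfl, hy⟩, fun i => rfl⟩
  · obtain ⟨z, hz, hz1, hz2⟩ := hS.mem_toFinset.1 hk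
    -- A cell has diameter at most `2ρ ≤ 1/2`, so one meeting the shell between `1` and `2` stays
    -- between `1/2` and `5/2`.
    have h1 := norm_sub_le_of_mem_cell hρ hy hz
    have h2 := norm_sub_norm_le z y
    have h3 := norm_sub_norm_le y z
    rw [norm_sub_rev] at h2
    constructor <;> linarith

lemma volume_ne_top_of_subset_shell {Q : Set E4} {a b : ℝ} (hQ : Q ⊆ shell a b) :
    volume Q ≠ ⊤ := by
  have h : Q ⊆ Metric.ball 0 b := fun y hy => by simpa using (hQ hy).2
  exact ((measure_mono h).trans_lt measure_ball_lt_top).ne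

lemma sum_lintegral_cell_le {ρ : ℝ} {T : Finset (Fin 4 → ℤ)}
    {A : Set E4} (hT : ∀ k ∈ T, cell ρ k ⊆ A) (g : E4 → ℝ≥0∞) :
    ∑ k ∈ T, ∫⁻ y in cell ρ k, g y ≤ ∫⁻ y in A, g y := by
  rw [← lintegral_biUnion_finset (fun k _ l _ h => pairwise_disjoint_cell ρ h)
    (fun k _ => measurableSet_cell ρ k)]
  exact lintegral_mono_set (iUnion₂_subset hT)

lemma exists_cell_side {K δ : ℝ≥0∞} (hK : K ≠ ⊤) (hδ : δ ≠ 0) :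
    ∃ ρ : ℝ, 0 < ρ ∧ ρ ≤ 1 / 4 ∧ K * ENNReal.ofReal ((2 * ρ) ^ 2) ≤ δ := by
  have h1 : Filter.Tendsto (fun ρ : ℝ => K * ENNReal.ofReal ((2 * ρ) ^ 2)) (𝓝[>] 0) (𝓝 0) := by
    have h2 : Continuous fun ρ : ℝ => K * ENNReal.ofReal ((2 * ρ) ^ 2) :=
      (ENNReal.continuous_const_mul hK).comp (ENNReal.continuous_ofReal.comp (by fun_prop))
    simpa using (h2.tendsto 0).mono_left nhdsWithin_le_nhds
  have h3 : ∀ᶠ ρ : ℝ in 𝓝[>] 0, 0 < ρ ∧ ρ ≤ 1 / 4 ∧ K * ENNReal.ofReal ((2 * ρ) ^ 2) ≤ δ := by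
    filter_upwards [self_mem_nhdsWithin, nhdsWithin_le_nhds
      (eventually_le_nhds (show (0 : ℝ) < 1 / 4 by norm_num)),
      h1.eventually_le_const (pos_iff_ne_zero.2 hδ)] with ρ h h' h''
    exact ⟨h, h', h''⟩
  exact h3.exists

/-- The integral of a square over a set of small measure is small compared to the energy. -/
theorem exists_small_set_bound {ε : ℝ≥0∞} (hε : ε ≠ 0) :
    ∃ η : ℝ≥0∞, η ≠ 0 ∧ ∀ N : Set S3, MeasurableSet N → surfaceMeasure N ≤ η →
      ∀ q b : S3 → ℝ, SqrtGradBound q b → Continuous b → (∀ x, 0 ≤ b x) →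
      ∫⁻ x in N, ‖√(q x)‖ₑ ^ 2 ∂surfaceMeasure
        ≤ ε * (∫⁻ x, ‖√(q x)‖ₑ ^ 2 ∂surfaceMeasure
          + ∫⁻ x, ENNReal.ofReal (b x ^ 2) ∂surfaceMeasure) := by
  obtain ⟨κ, hκ0, hκt, hκ⟩ := exists_lintegral_shell (a := 1) (b := 2) (by norm_num) (by norm_num)
  obtain ⟨κ', hκ'0, hκ't, hκ'⟩ := exists_lintegral_shell (a := 1 / 2) (b := 5 / 2)
    (by norm_num) (by norm_num)
  -- The error allowed in each cell, arranged so that passing to `ℝ⁴` through `κ` and back through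
  -- `κ'` yields `ε`.
  set δ : ℝ≥0∞ := κ'⁻¹ * (κ * ε) with hδ
  have hδ0 : δ ≠ 0 := mul_ne_zero (ENNReal.inv_ne_zero.2 hκ't) (mul_ne_zero hκ0 hε)
  have hδκ : δ * κ' = κ * ε := by
    rw [hδ, mul_comm, ← mul_assoc, ENNReal.mul_inv_cancel hκ'0 hκ't, one_mul]
  set K : ℝ≥0∞ := 2 * (2 ^ Module.finrank ℝ E4 * ENNReal.ofReal ((1 / 2)⁻¹ ^ 2)) with hK
  obtain ⟨ρ, hρ, hρ', hρδ⟩ := exists_cell_side (K := K) (by finiteness) hδ0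
  obtain ⟨T, hTcov, hTsub⟩ := exists_finset_cell hρ hρ'
  -- The smallest volume of the cells in use. With the bound on `N` below, the cone part over `N`
  -- occupies at most the fraction `δ / 2` of any of them.
  set m : ℝ≥0∞ := T.inf fun k => volume (cell ρ k) with hm
  have hm0 : m ≠ 0 := by
    rw [← pos_iff_ne_zero, hm, Finset.lt_inf_iff ENNReal.zero_lt_top]
    exact fun k _ => pos_iff_ne_zero.2 (volume_cell_ne_zero hρ k)
  refine ⟨κ⁻¹ * (δ / 2 * m), mul_ne_zero (ENNReal.inv_ne_zero.2 hκt)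
    (mul_ne_zero (ENNReal.div_ne_zero.2 ⟨hδ0, by simp⟩) hm0), ?_⟩
  intro N hN hNη q b hq hb hb0
  set A : Set E4 := conePart 1 2 N with hA
  have hAm : MeasurableSet A := measurableSet_conePart 1 2 hN
  have hvA : volume A ≤ δ / 2 * m := by
    rw [hA, volume_conePart hκ hN]
    calc κ * surfaceMeasure N ≤ κ * (κ⁻¹ * (δ / 2 * m)) := by gcongr
      _ = _ := by rw [← mul_assoc, ENNReal.mul_inv_cancel hκ0 hκt, one_mul]
  have hFm : Measurable fun y : E4 => √(q (radial y)) :=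
    hq.continuous.sqrt.measurable.comp measurable_radial
  have hqm : Measurable fun x : S3 => ‖√(q x)‖ₑ ^ 2 :=
    hq.continuous.sqrt.measurable.enorm.pow_const 2
  have hbm : Measurable fun x : S3 => ENNReal.ofReal (b x ^ 2) :=
    (hb.pow 2).measurable.ennreal_ofReal
  set g : E4 → ℝ≥0∞ := fun y =>
    ENNReal.ofReal ((1 / 2)⁻¹ ^ 2) * ENNReal.ofReal (b (radial y) ^ 2) with hg
  have hgm : Measurable g := (hbm.comp measurable_radial).const_mul _
  -- Comparing the cell with its small part: the volume fraction controls the first term, and the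
  -- squared diameter of the cell controls the oscillation.
  have hcell : ∀ k ∈ T, ∫⁻ y in cell ρ k ∩ A, ‖√(q (radial y))‖ₑ ^ 2
      ≤ (δ * ∫⁻ y in cell ρ k, ‖√(q (radial y))‖ₑ ^ 2)
        + 2 * (ENNReal.ofReal ((2 * ρ) ^ 2) * 2 ^ Module.finrank ℝ E4 * ∫⁻ y in cell ρ k, g y) := by
    intro k hk
    have hv0 := volume_cell_ne_zero hρ k
    have hvt := volume_ne_top_of_subset_shell (hTsub k hk)
    have hseg := hq.segmentBound hb hb0 (r := 1 / 2) (by norm_num) (convex_cell hρ k)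
      (fun y hy => (hTsub k hk hy).1.le)
    have h1 := SegmentBound.lintegral_le (volume : Measure E4) (convex_cell hρ k)
      (measurableSet_cell ρ k) (fun x hx y hy => norm_sub_le_of_mem_cell hρ hx hy) hgm hseg
    have h2 := mul_lintegral_sq_le (volume : Measure E4) (A := cell ρ k ∩ A) (B := cell ρ k)
      inter_subset_left subset_rfl hFm
    rw [← ENNReal.mul_le_mul_iff_right hv0 hvt]
    refine h2.trans ?_
    have h3 : 2 * volume (cell ρ k ∩ A) ≤ volume (cell ρ k) * δ := by
      calc 2 * volume (cell ρ k ∩ A) ≤ 2 * (δ / 2 * volume (cell ρ k)) := by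
            gcongr
            exact (measure_mono inter_subset_right).trans
              (hvA.trans (by gcongr; exact Finset.inf_le hk))
        _ = _ := by
            rw [← mul_assoc, ENNReal.mul_div_cancel two_ne_zero ENNReal.ofNat_ne_top, mul_comm]
    rw [mul_add, ← mul_assoc]
    refine add_le_add (by gcongr) ?_
    calc _ ≤ 2 * (ENNReal.ofReal ((2 * ρ) ^ 2) * 2 ^ Module.finrank ℝ E4 * volume (cell ρ k)
          * ∫⁻ y in cell ρ k, g y) := by gcongr
      _ = _ := by ring
  have hsum : ∫⁻ y in A, ‖√(q (radial y))‖ₑ ^ 2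
      ≤ ∑ k ∈ T, ∫⁻ y in cell ρ k ∩ A, ‖√(q (radial y))‖ₑ ^ 2 := by
    rw [← lintegral_biUnion_finset (fun k _ l _ h => (pairwise_disjoint_cell ρ h).mono
      inter_subset_left inter_subset_left) (fun k _ => (measurableSet_cell ρ k).inter hAm)]
    refine lintegral_mono_set fun y hy => ?_
    obtain ⟨k, hk, hyk⟩ := mem_iUnion₂.1 (hTcov hy.1)
    exact mem_iUnion₂.2 ⟨k, hk, hyk, hy⟩
  rw [lintegral_conePart hκ hN hqm] at hsum
  rw [← ENNReal.mul_le_mul_iff_right hκ0 hκt]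
  calc _ ≤ ∑ k ∈ T, ((δ * ∫⁻ y in cell ρ k, ‖√(q (radial y))‖ₑ ^ 2)
        + 2 * (ENNReal.ofReal ((2 * ρ) ^ 2) * 2 ^ Module.finrank ℝ E4
          * ∫⁻ y in cell ρ k, g y)) := hsum.trans (Finset.sum_le_sum hcell)
    _ = (δ * ∑ k ∈ T, ∫⁻ y in cell ρ k, ‖√(q (radial y))‖ₑ ^ 2)
        + 2 * (ENNReal.ofReal ((2 * ρ) ^ 2) * 2 ^ Module.finrank ℝ E4
          * ∑ k ∈ T, ∫⁻ y in cell ρ k, g y) := by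
      rw [Finset.sum_add_distrib, Finset.mul_sum, Finset.mul_sum, Finset.mul_sum]
    _ ≤ (δ * ∫⁻ y in shell (1 / 2) (5 / 2), ‖√(q (radial y))‖ₑ ^ 2)
        + 2 * (ENNReal.ofReal ((2 * ρ) ^ 2) * 2 ^ Module.finrank ℝ E4
          * ∫⁻ y in shell (1 / 2) (5 / 2), g y) := by
      gcongr <;> exact sum_lintegral_cell_le hTsub _
    _ = δ * (κ' * ∫⁻ x, ‖√(q x)‖ₑ ^ 2 ∂surfaceMeasure)
        + (K * ENNReal.ofReal ((2 * ρ) ^ 2))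
          * (κ' * ∫⁻ x, ENNReal.ofReal (b x ^ 2) ∂surfaceMeasure) := by
      have hgi : ∫⁻ y in shell (1 / 2) (5 / 2), g y = ENNReal.ofReal ((1 / 2)⁻¹ ^ 2)
          * (κ' * ∫⁻ x, ENNReal.ofReal (b x ^ 2) ∂surfaceMeasure) := by
        rw [← hκ' _ hbm]
        exact lintegral_const_mul _ (hbm.comp measurable_radial)
      rw [hκ' _ hqm, hgi, hK]
      ring
    _ ≤ δ * (κ' * ∫⁻ x, ‖√(q x)‖ₑ ^ 2 ∂surfaceMeasure)
        + δ * (κ' * ∫⁻ x, ENNReal.ofReal (b x ^ 2) ∂surfaceMeasure) := by gcongr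
    _ = _ := by rw [← mul_add, ← mul_add, ← mul_assoc, hδκ, mul_assoc]

end Grid

/-- Write the difference of directions as `‖z‖⁻¹` times `(y - z) + (‖z‖ - ‖y‖) y / ‖y‖`; both
summands have norm at most `‖y - z‖`. This converts the diameter of a cell into a diameter on the
sphere. -/
lemma dist_radial_le {y z : E4} (hy : y ≠ 0) (hz : 1 ≤ ‖z‖) :
    dist (radial y) (radial z) ≤ 2 * ‖y - z‖ := by
  have hz0 : z ≠ 0 := norm_pos_iff.1 (one_pos.trans_le hz)
  have hy1 := norm_ne_zero_iff.2 hy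
  have hz1 := norm_ne_zero_iff.2 hz0
  have h1 : ‖y‖⁻¹ • y - ‖z‖⁻¹ • z = ‖z‖⁻¹ • ((y - z) + (‖z‖ - ‖y‖) • (‖y‖⁻¹ • y)) := by
    have h2 : ‖z‖⁻¹ * ((‖z‖ - ‖y‖) * ‖y‖⁻¹) + ‖z‖⁻¹ = ‖y‖⁻¹ := by field_simp; ring
    conv_lhs => rw [← h2, add_smul]
    rw [smul_add, smul_sub, smul_smul, smul_smul, mul_assoc]
    abel
  rw [Subtype.dist_eq, dist_eq_norm, coe_radial hy, coe_radial hz0, h1, norm_smul, norm_inv,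
    norm_norm]
  have h3 : ‖(y - z) + (‖z‖ - ‖y‖) • (‖y‖⁻¹ • y)‖ ≤ 2 * ‖y - z‖ := by
    refine (norm_add_le _ _).trans ?_
    have h4 : ‖(‖z‖ - ‖y‖) • (‖y‖⁻¹ • y)‖ ≤ ‖y - z‖ := by
      rw [norm_smul, norm_smul, norm_inv, norm_norm, inv_mul_cancel₀ hy1, mul_one,
        Real.norm_eq_abs, norm_sub_rev y z]
      exact abs_norm_sub_norm_le z y
    linarith
  calc _ ≤ 1 * (2 * ‖y - z‖) := by
        gcongr
        exact inv_le_one_of_one_le₀ hz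
    _ = _ := one_mul _

/-! ### Contractions on cells over which the line bundle has a unit frame -/

section CellPairing

variable {F : Type*} [NormedAddCommGroup F] [NormedSpace ℝ F]
  {V : S3 → Type*} [TopologicalSpace (TotalSpace F V)]
  [∀ x, NormedAddCommGroup (V x)] [∀ x, InnerProductSpace ℝ (V x)]
  [FiberBundle F V] [VectorBundle ℝ F V]
  {U : TopologicalSpace.Opens S3}
  {I : U → Type*} [TopologicalSpace (TotalSpace ℝ I)]
  [∀ x, NormedAddCommGroup (I x)] [∀ x, InnerProductSpace ℝ (I x)]
  [FiberBundle ℝ I] [VectorBundle ℝ ℝ I] [IsContinuousRiemannianBundle ℝ I]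
  [IsContMDiffRiemannianBundle (𝓡 3) ∞ F V]
  [FiniteDimensional ℝ F] [ContMDiffVectorBundle ∞ F V (𝓡 3)]
  {cov : CovariantDerivative (𝓡 3) F V}

/-- The contraction of a section of `V ⊗ I` with a section of `V` and a section of `I`, as a
homogeneous function on a subset of `ℝ⁴`. -/
def pairing (σ : ∀ x, V x) (u : ∀ y : U, I y) (s : RoughSection V I) (y : E4) : ℝ :=
  inner ℝ (σ (radial y)) (localRep u s (radial y))

lemma pairing_sub (σ : ∀ x, V x) (u : ∀ y : U, I y) (s t : RoughSection V I) (y : E4) :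
    pairing σ u (s - t) y = pairing σ u s y - pairing σ u t y := by
  have h : localRep u (s - t) (radial y) = localRep u s (radial y) - localRep u t (radial y) := by
    by_cases h : radial y ∈ U <;> simp [localRep, h]
  rw [pairing, h, inner_sub_right]
  rfl

variable {σ : ∀ x, V x} {M : ℝ} {u : ∀ y : U, I y} {Q : Set E4} {s : RoughSection V I}

lemma abs_pairing_le (hM : HasSectionBound cov σ M)
    (hQu : ∀ y ∈ Q, ∃ x : U, IsUnitFrameAt u x ∧ (x : S3) = radial y) {y : E4} (hy : y ∈ Q) :
    |pairing σ u s y| ≤ M * √(normSq s (radial y)) := by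
  obtain ⟨x, hx, hxy⟩ := hQu y hy
  rw [pairing, ← hxy, hx.normSq_eq, Real.sqrt_sq (norm_nonneg _)]
  exact (abs_real_inner_le_norm _ _).trans (by gcongr; exact (hM.2 _).1)

variable (hcov : cov.IsMetricCompatible)
  (hσ : ContMDiff (𝓡 3) ((𝓡 3).prod 𝓘(ℝ, F)) ∞ (fun y => TotalSpace.mk' F y (σ y)))
  (hM : HasSectionBound cov σ M) (hs : IsSmooth F s)
  (hQs : Q ⊆ shell (1 / 2) (5 / 2))
  (hQu : ∀ y ∈ Q, ∃ x : U, IsUnitFrameAt u x ∧ (x : S3) = radial y)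
include hcov hσ hM hs hQs hQu

lemma continuousOn_pairing : ContinuousOn (pairing σ u s) Q := by
  intro y hy
  have hy0 : y ≠ 0 := by
    rintro rfl
    have := (hQs hy).1
    norm_num at this
  have h := sphereGradBound_pairing hcov hσ hM hs (u := u) (O := {x | IsUnitFrameAt u x})
    (fun x hx => hx)
  obtain ⟨x, hx, hxy⟩ := hQu y hy
  exact ((h.of_radial hy0 ⟨x, hx, hxy⟩).1).continuousAt.continuousWithinAt

variable (hQm : MeasurableSet Q)
include hQm

lemma memLp_pairing (hsc : Continuous (normSq s)) : MemLp (pairing σ u s) 2 (volume.restrict Q) := by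
  have hfin : IsFiniteMeasure (volume.restrict Q) :=
    ⟨by simpa using (volume_ne_top_of_subset_shell hQs).lt_top⟩
  obtain ⟨B, hB⟩ : ∃ B, ∀ x, √(normSq s x) ≤ B := by
    obtain ⟨B, hB⟩ := (isCompact_range hsc.sqrt).bddAbove
    exact ⟨B, fun x => hB (mem_range_self x)⟩
  refine MemLp.of_bound ((continuousOn_pairing hcov hσ hM hs hQs hQu).aestronglyMeasurable hQm)
    (M * B) ?_
  refine (ae_restrict_iff' hQm).2 (Filter.Eventually.of_forall fun y hy => ?_)
  have h0 := hM.1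
  exact (abs_pairing_le hM hQu hy).trans (by gcongr; exact hB _)

/-- Over a cell with a frame the contraction is a genuine real function rather than one defined up
to sign, so its mean is meaningful and the convex Poincaré inequality applies. -/
lemma mul_lintegral_pairing_le (hQ : Convex ℝ Q) {d : ℝ}
    (hd : ∀ x ∈ Q, ∀ y ∈ Q, ‖x - y‖ ≤ d) (hsc : Continuous (normSq s))
    (hsg : Continuous (gradSq cov s)) :
    volume Q * ∫⁻ y in Q, ‖pairing σ u s y‖ₑ ^ 2
      ≤ ENNReal.ofReal ((∫ y in Q, pairing σ u s y) ^ 2)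
        + ENNReal.ofReal (d ^ 2) * 2 ^ Module.finrank ℝ E4 * volume Q
          * ∫⁻ y in Q, ENNReal.ofReal ((1 / 2)⁻¹ ^ 2) * ENNReal.ofReal
            ((M * (√(normSq s (radial y)) + √(gradSq cov s (radial y)))) ^ 2) := by
  have h := sphereGradBound_pairing hcov hσ hM hs (u := u) (O := {x | IsUnitFrameAt u x})
    (fun x hx => hx)
  have h0 := hM.1
  have hbc : Continuous fun x => M * (√(normSq s x) + √(gradSq cov s x)) :=
    (hsc.sqrt.add hsg.sqrt).const_mul M
  have hbm : Measurable fun x =>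
      ENNReal.ofReal ((M * (√(normSq s x) + √(gradSq cov s x))) ^ 2) :=
    (hbc.pow 2).measurable.ennreal_ofReal
  have hseg := h.segmentBound hbc (fun x => by positivity) (r := 1 / 2) (by norm_num) hQ
    (fun y hy => (hQs hy).1.le) (fun y hy => by
      obtain ⟨x, hx, hxy⟩ := hQu y hy
      exact ⟨x, hx, hxy⟩)
  have h1 := SegmentBound.lintegral_le (volume : Measure E4) hQ hQm hd
    ((hbm.comp measurable_radial).const_mul _) hseg
  have h2 := mul_lintegral_sq_le_mean (volume : Measure E4) (volume_ne_top_of_subset_shell hQs)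
    (memLp_pairing hcov hσ hM hs hQs hQu hQm hsc)
  exact h2.trans (by gcongr; exact h1)

/-- From `t ≤ 1 + t²`. A bound affine in the square integral suffices to bound the functional on the
unit ball. -/
lemma enorm_integral_pairing_le (hsc : Continuous (normSq s)) :
    ‖∫ y in Q, pairing σ u s y‖ₑ ≤ volume Q
      + ENNReal.ofReal (M ^ 2) * ∫⁻ y in Q, ENNReal.ofReal (normSq s (radial y)) := by
  refine (enorm_integral_le_lintegral_enorm _).trans ?_
  have h0 := hM.1
  have hm : Measurable fun y : E4 => ENNReal.ofReal (normSq s (radial y)) :=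
    hsc.measurable.ennreal_ofReal.comp measurable_radial
  calc ∫⁻ y in Q, ‖pairing σ u s y‖ₑ
      ≤ ∫⁻ y in Q, (1 + ENNReal.ofReal (M ^ 2) * ENNReal.ofReal (normSq s (radial y))) := by
        refine setLIntegral_mono' hQm fun y hy => ?_
        have h1 := abs_pairing_le (s := s) hM hQu hy
        have h2 := Real.sq_sqrt (normSq_nonneg s (radial y))
        have h3 := Real.sqrt_nonneg (normSq s (radial y))
        rw [← ENNReal.ofReal_mul (by positivity), ← ENNReal.ofReal_one,
          ← ENNReal.ofReal_add zero_le_one (by have := normSq_nonneg s (radial y); positivity),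
          ← ofReal_norm, Real.norm_eq_abs]
        refine ENNReal.ofReal_le_ofReal (h1.trans ?_)
        nlinarith [sq_nonneg (M * √(normSq s (radial y)) - 1)]
    _ = _ := by
        rw [lintegral_add_left measurable_const, lintegral_const_mul _ hm]
        simp

omit hσ hM in
-- The spanning property and Cauchy–Schwarz bound `|s|²` by the squares of `n` contractions. Each is
-- controlled by its integral over the cell and by `d²` times the energy, so up to `O(d²)` only
-- finitely many numbers matter.
lemma lintegral_normSq_le_sum_pairing {n : ℕ} {σ : Fin n → ∀ x, V x} {C : ℝ}
    (hσ : ∀ j, ContMDiff (𝓡 3) ((𝓡 3).prod 𝓘(ℝ, F)) ∞ (fun y => TotalSpace.mk' F y (σ j y)))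
    (hM : ∀ j, HasSectionBound cov (σ j) M)
    (hσC : ∀ (x : S3) (v : V x), ‖v‖ ≤ C * ∑ j, |(inner ℝ (σ j x) v : ℝ)|)
    (hQ : Convex ℝ Q) (hQ0 : volume Q ≠ 0) {d : ℝ}
    (hd : ∀ x ∈ Q, ∀ y ∈ Q, ‖x - y‖ ≤ d) (hsc : Continuous (normSq s))
    (hsg : Continuous (gradSq cov s)) :
    ∫⁻ y in Q, ENNReal.ofReal (normSq s (radial y))
      ≤ ENNReal.ofReal (C ^ 2 * n) * (volume Q)⁻¹
          * (∑ j, ENNReal.ofReal ((∫ y in Q, pairing (σ j) u s y) ^ 2))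
        + ENNReal.ofReal (C ^ 2 * n) * (n * (2 ^ Module.finrank ℝ E4
          * (ENNReal.ofReal ((1 / 2)⁻¹ ^ 2) * ENNReal.ofReal (2 * M ^ 2)))) * ENNReal.ofReal (d ^ 2)
          * ∫⁻ y in Q, (ENNReal.ofReal (normSq s (radial y))
            + ENNReal.ofReal (gradSq cov s (radial y))) := by
  have hQt := volume_ne_top_of_subset_shell hQs
  have h1 : ∫⁻ y in Q, ENNReal.ofReal (normSq s (radial y))
      ≤ ∫⁻ y in Q, ENNReal.ofReal (C ^ 2 * n) * ∑ j, ‖pairing (σ j) u s y‖ₑ ^ 2 := by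
    refine setLIntegral_mono' hQm fun y hy => ?_
    obtain ⟨x, hx, hxy⟩ := hQu y hy
    have h2 : normSq s (radial y) ≤ C ^ 2 * n * ∑ j, pairing (σ j) u s y ^ 2 := by
      rw [← hxy, hx.normSq_eq]
      have h3 := hσC x (localRep u s x)
      have h4 := sq_sum_le_card_mul_sum_sq (s := Finset.univ)
        (f := fun j => |(inner ℝ (σ j x) (localRep u s x) : ℝ)|)
      simp only [Finset.card_univ, Fintype.card_fin, sq_abs] at h4
      calc _ ≤ (C * ∑ j, |(inner ℝ (σ j x) (localRep u s x) : ℝ)|) ^ 2 := by gcongr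
        _ = C ^ 2 * (∑ j, |(inner ℝ (σ j x) (localRep u s x) : ℝ)|) ^ 2 := by ring
        _ ≤ C ^ 2 * (n * ∑ j, (inner ℝ (σ j x) (localRep u s x) : ℝ) ^ 2) := by gcongr
        _ = _ := by
          have h5 : ∀ j, pairing (σ j) u s y = inner ℝ (σ j x) (localRep u s x) := fun j => by
            rw [pairing, ← hxy]
          simp only [h5]
          ring
    refine (ENNReal.ofReal_le_ofReal h2).trans_eq ?_
    rw [ENNReal.ofReal_mul (by positivity), ENNReal.ofReal_sum_of_nonneg fun _ _ => sq_nonneg _]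
    congr 1
    refine Finset.sum_congr rfl fun j _ => ?_
    rw [← ofReal_norm, ← ENNReal.ofReal_pow (norm_nonneg _), Real.norm_eq_abs, sq_abs]
  have hpm : ∀ j, AEMeasurable (fun y => ‖pairing (σ j) u s y‖ₑ ^ 2) (volume.restrict Q) := fun j =>
    ((memLp_pairing hcov (hσ j) (hM j) hs hQs hQu hQm hsc).aestronglyMeasurable.enorm).pow_const 2
  rw [lintegral_const_mul' _ _ ENNReal.ofReal_ne_top, lintegral_finsetSum' _ fun j _ => hpm j] at h1
  set E : ℝ≥0∞ := ∫⁻ y in Q, (ENNReal.ofReal (normSq s (radial y))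
            + ENNReal.ofReal (gradSq cov s (radial y))) with hE
  have hgrad : ∫⁻ y in Q, ENNReal.ofReal ((1 / 2)⁻¹ ^ 2) * ENNReal.ofReal
      ((M * (√(normSq s (radial y)) + √(gradSq cov s (radial y)))) ^ 2)
      ≤ ENNReal.ofReal ((1 / 2)⁻¹ ^ 2) * ENNReal.ofReal (2 * M ^ 2) * E := by
    rw [hE, ← lintegral_const_mul' _ _ (by finiteness)]
    refine lintegral_mono fun y => ?_
    rw [mul_assoc]
    gcongr
    have e1 := normSq_nonneg s (radial y)
    have e2 := gradSq_nonneg cov s (radial y)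
    rw [← ENNReal.ofReal_add e1 e2, ← ENNReal.ofReal_mul (by positivity)]
    refine ENNReal.ofReal_le_ofReal ?_
    have e3 := Real.sq_sqrt e1
    have e4 := Real.sq_sqrt e2
    rw [mul_pow]
    have e5 : (√(normSq s (radial y)) + √(gradSq cov s (radial y))) ^ 2
        ≤ 2 * (normSq s (radial y) + gradSq cov s (radial y)) := by
      nlinarith [sq_nonneg (√(normSq s (radial y)) - √(gradSq cov s (radial y)))]
    calc _ ≤ M ^ 2 * (2 * (normSq s (radial y) + gradSq cov s (radial y))) := by gcongr
      _ = _ := by ring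
  have hj : ∀ j, ∫⁻ y in Q, ‖pairing (σ j) u s y‖ₑ ^ 2
      ≤ (volume Q)⁻¹ * ENNReal.ofReal ((∫ y in Q, pairing (σ j) u s y) ^ 2)
        + 2 ^ Module.finrank ℝ E4 * (ENNReal.ofReal ((1 / 2)⁻¹ ^ 2) * ENNReal.ofReal (2 * M ^ 2))
          * ENNReal.ofReal (d ^ 2) * E := by
    intro j
    rw [← ENNReal.mul_le_mul_iff_right hQ0 hQt, mul_add, ← mul_assoc,
      ENNReal.mul_inv_cancel hQ0 hQt, one_mul]
    refine (mul_lintegral_pairing_le hcov (hσ j) (hM j) hs hQs hQu hQm hQ hd hsc hsg).trans ?_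
    refine add_le_add le_rfl ?_
    calc _ ≤ ENNReal.ofReal (d ^ 2) * 2 ^ Module.finrank ℝ E4 * volume Q
          * (ENNReal.ofReal ((1 / 2)⁻¹ ^ 2) * ENNReal.ofReal (2 * M ^ 2) * E) := by gcongr
      _ = _ := by ring
  refine h1.trans ?_
  calc _ ≤ ENNReal.ofReal (C ^ 2 * n) * ∑ j, ((volume Q)⁻¹
        * ENNReal.ofReal ((∫ y in Q, pairing (σ j) u s y) ^ 2)
        + 2 ^ Module.finrank ℝ E4 * (ENNReal.ofReal ((1 / 2)⁻¹ ^ 2) * ENNReal.ofReal (2 * M ^ 2))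
          * ENNReal.ofReal (d ^ 2) * E) := by
        gcongr with j
        exact hj j
    _ = _ := by
      rw [Finset.sum_add_distrib, ← Finset.mul_sum, Finset.sum_const, Finset.card_univ,
        Fintype.card_fin, nsmul_eq_mul]
      ring

end CellPairing

/-- The crude estimate of a sum of products by a product of sums gives one constant for all cells.
-/
lemma sum_le_sum_mul_sum_add {ι : Type*} {T : Finset ι} {a w S e : ι → ℝ≥0∞} {D : ℝ≥0∞}
    (h : ∀ k ∈ T, a k ≤ w k * S k + D * e k) :
    ∑ k ∈ T, a k ≤ (∑ k ∈ T, w k) * ∑ k ∈ T, S k + D * ∑ k ∈ T, e k := by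
  refine (Finset.sum_le_sum h).trans ?_
  rw [Finset.sum_add_distrib, ← Finset.mul_sum, Finset.sum_mul]
  gcongr with k hk
  exact Finset.single_le_sum_of_canonicallyOrdered (f := S) hk

/-! ### Control by finitely many functionals, and total boundedness -/

section LocalCompactness

variable (𝕜 : Type*) [RCLike 𝕜]
  {F : Type*} [NormedAddCommGroup F] [NormedSpace ℝ F] [FiniteDimensional ℝ F]
  {V : S3 → Type*} [TopologicalSpace (TotalSpace F V)]
  [∀ x, NormedAddCommGroup (V x)] [∀ x, InnerProductSpace ℝ (V x)]
  [∀ x, InnerProductSpace 𝕜 (V x)] [∀ x, IsScalarTower ℝ 𝕜 (V x)]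
  [FiberBundle F V] [VectorBundle ℝ F V] [ContMDiffVectorBundle ∞ F V (𝓡 3)]
  [IsContMDiffRiemannianBundle (𝓡 3) ∞ F V] [SmoothScalars 𝕜 F V]
  {U : TopologicalSpace.Opens S3}
  {I : U → Type*} [TopologicalSpace (TotalSpace ℝ I)]
  [∀ x, NormedAddCommGroup (I x)] [∀ x, InnerProductSpace ℝ (I x)]
  [FiberBundle ℝ I] [VectorBundle ℝ ℝ I] [IsContinuousRiemannianBundle ℝ I]
  (cov : CovariantDerivative (𝓡 3) F V) [hcov : MetricConnection 𝕜 F V cov]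

/-- On a compact set, the square of the norm is controlled by finitely many linear functionals, up
to a small multiple of the energy. -/
theorem exists_functionals {K : Set U} (hK : IsCompact K) {ε : ℝ≥0∞} (hε : ε ≠ 0) :
    ∃ (J : Type) (_ : Fintype J) (Λ : J → testSections 𝕜 F V I → ℝ) (c B : ℝ≥0∞), c ≠ ⊤ ∧ B ≠ ⊤ ∧
      (∀ i s t, Λ i (s - t) = Λ i s - Λ i t) ∧
      (∀ i s, ‖Λ i s‖ₑ ≤ B * (1 + ∫⁻ x, ENNReal.ofReal (normSq s.1 x) ∂surfaceMeasure)) ∧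
      ∀ s, ∫⁻ x in Subtype.val '' K, ENNReal.ofReal (normSq s.1 x) ∂surfaceMeasure
        ≤ c * ∑ i, ENNReal.ofReal (Λ i s ^ 2)
          + ε * (∫⁻ x, ENNReal.ofReal (normSq s.1 x) ∂surfaceMeasure
            + ∫⁻ x, ENNReal.ofReal (gradSq cov s.1 x) ∂surfaceMeasure) := by
  obtain ⟨n, σ, C, M, hC, hM, hσ, hσM, hσC⟩ := exists_spanning_sections_bound F V hcov.smooth
  obtain ⟨κ, hκ0, hκt, hκ⟩ := exists_lintegral_shell (a := 1) (b := 2) (by norm_num) (by norm_num)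
  obtain ⟨κ', hκ'0, hκ't, hκ'⟩ := exists_lintegral_shell (a := 1 / 2) (b := 5 / 2)
    (by norm_num) (by norm_num)
  set K' : Set S3 := Subtype.val '' K with hK'
  have hK'c : IsCompact K' := hK.image continuous_subtype_val
  -- A Lebesgue number: each ball of radius `δ` centered in `K'` lies in a region with a unit frame
  -- of `I`.
  obtain ⟨δ, hδ, hδK⟩ : ∃ δ > 0, ∀ x ∈ K', ∃ u : ∀ y : U, I y,
      ∀ y ∈ Metric.ball x δ, ∃ z : U, IsUnitFrameAt u z ∧ (z : S3) = y := by
    obtain ⟨δ, hδ, h⟩ := lebesgue_number_lemma_of_metric (c := fun x : U =>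
      interior (Subtype.val '' {z | IsUnitFrameAt (frame I x) z})) hK'c
      (fun _ => isOpen_interior) (by
        rintro _ ⟨x, hx, rfl⟩
        refine mem_iUnion.2 ⟨x, mem_interior_iff_mem_nhds.2 ?_⟩
        exact U.2.isOpenEmbedding_subtypeVal.isOpenMap.image_mem_nhds
          (isUnitFrameAt_frame x).eventually)
    refine ⟨δ, hδ, fun x hx => ?_⟩
    obtain ⟨i, hi⟩ := h x hx
    refine ⟨frame I i, fun y hy => ?_⟩
    obtain ⟨z, hz, hzy⟩ := interior_subset (hi hy)
    exact ⟨z, hz, hzy⟩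
  set A : ℝ≥0∞ := ENNReal.ofReal (C ^ 2 * n) * (n * (2 ^ Module.finrank ℝ E4
    * (ENNReal.ofReal ((1 / 2)⁻¹ ^ 2) * ENNReal.ofReal (2 * M ^ 2)))) * κ' with hA
  -- The side is small enough for the error term, and also for a cell to project into a single such
  -- ball: its diameter `2ρ` at most doubles under `radial`.
  obtain ⟨ρ, hρ, hρ', hρε, hρδ⟩ : ∃ ρ : ℝ, 0 < ρ ∧ ρ ≤ 1 / 4 ∧
      A * ENNReal.ofReal ((2 * ρ) ^ 2) ≤ κ * ε ∧ 4 * ρ < δ := by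
    obtain ⟨ρ, hρ, hρ', hρε⟩ := exists_cell_side (K := A) (by finiteness) (mul_ne_zero hκ0 hε)
    refine ⟨min ρ (δ / 8), by positivity, (min_le_left _ _).trans hρ', le_trans ?_ hρε, ?_⟩
    · gcongr
      exact min_le_left _ _
    · have := min_le_right ρ (δ / 8)
      linarith
  obtain ⟨T, hTcov, hTsub⟩ := exists_finset_cell hρ hρ'
  classical
  -- Only cells that meet the cone over `K'` are kept, since frames are available only near `K'`.
  set T' := T.filter fun k => (cell ρ k ∩ conePart 1 2 K').Nonempty with hT'
  have hT'T : ∀ k ∈ T', k ∈ T := fun k hk => (Finset.mem_filter.1 hk).1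
  have hu : ∀ k : Fin 4 → ℤ, ∃ u : ∀ y : U, I y, k ∈ T' →
      ∀ y ∈ cell ρ k, ∃ x : U, IsUnitFrameAt u x ∧ (x : S3) = radial y := by
    intro k
    by_cases hk : k ∈ T'
    · obtain ⟨hkT, z, hz, hz1, hz2⟩ := Finset.mem_filter.1 hk
      obtain ⟨u, hu⟩ := hδK _ hz2
      refine ⟨u, fun _ y hy => hu _ ?_⟩
      have hy0 : y ≠ 0 := by
        rintro rfl
        have := (hTsub k hkT hy).1
        norm_num at this
      have h1 := dist_radial_le hy0 hz1.1.le
      have h2 := norm_sub_le_of_mem_cell hρ hy hz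
      rw [Metric.mem_ball]
      linarith
    · exact ⟨fun _ => 0, fun h => absurd h hk⟩
  choose u hu using hu
  set v : ℝ≥0∞ := volume (shell (1 / 2) (5 / 2)) with hv
  have hvt : v ≠ ⊤ := volume_ne_top_of_subset_shell subset_rfl
  set A₀ : ℝ≥0∞ := ENNReal.ofReal (C ^ 2 * n) * (n * (2 ^ Module.finrank ℝ E4
    * (ENNReal.ofReal ((1 / 2)⁻¹ ^ 2) * ENNReal.ofReal (2 * M ^ 2)))) with hA₀
  have hcont : ∀ s : testSections 𝕜 F V I, Continuous (normSq s.1) ∧ Continuous (gradSq cov s.1) :=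
    fun s => by
      obtain ⟨hs, K, hK, hsK⟩ := s.2
      exact ⟨(sqrtGradBound_normSq hcov.metric hs hK hsK).continuous,
        continuous_gradSq 𝕜 cov hs hK hsK⟩
  -- The functionals are the integrals of the contractions over the cells.
  refine ⟨T' × Fin n, inferInstance, fun i s => ∫ y in cell ρ i.1, pairing (σ i.2) (u i.1) s.1 y,
    κ⁻¹ * ∑ k ∈ T', ENNReal.ofReal (C ^ 2 * n) * (volume (cell ρ k))⁻¹,
    v + ENNReal.ofReal (M ^ 2) * κ', ?_, by finiteness, ?_, ?_, ?_⟩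
  · refine ENNReal.mul_ne_top (ENNReal.inv_ne_top.2 hκ0) (ENNReal.sum_ne_top.2 fun k _ => ?_)
    exact ENNReal.mul_ne_top ENNReal.ofReal_ne_top
      (ENNReal.inv_ne_top.2 (volume_cell_ne_zero hρ k))
  · rintro ⟨k, j⟩ s t
    have hi : ∀ s : testSections 𝕜 F V I,
        Integrable (pairing (σ j) (u k) s.1) (volume.restrict (cell ρ k)) := fun s => by
      have hfin : IsFiniteMeasure (volume.restrict (cell ρ k)) :=
        ⟨by simpa using (volume_ne_top_of_subset_shell (hTsub k (hT'T k k.2))).lt_top⟩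
      exact (memLp_pairing hcov.metric (hσ j) (hσM j) s.2.1 (hTsub k (hT'T k k.2)) (hu k k.2)
        (measurableSet_cell ρ k) (hcont s).1).integrable (by norm_num)
    simp only
    rw [← integral_sub (hi s) (hi t)]
    exact integral_congr_ae (Filter.Eventually.of_forall fun y => pairing_sub _ _ _ _ _)
  · rintro ⟨k, j⟩ s
    have hsub := hTsub k (hT'T k k.2)
    have hnm : Measurable fun x => ENNReal.ofReal (normSq s.1 x) :=
      (hcont s).1.measurable.ennreal_ofReal
    refine (enorm_integral_pairing_le hcov.metric (hσ j) (hσM j) s.2.1 hsub (hu k k.2)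
      (measurableSet_cell ρ k) (hcont s).1).trans ?_
    calc _ ≤ v + ENNReal.ofReal (M ^ 2)
          * ∫⁻ y in shell (1 / 2) (5 / 2), ENNReal.ofReal (normSq s.1 (radial y)) :=
          add_le_add (measure_mono hsub) (by gcongr)
      _ = v * 1 + ENNReal.ofReal (M ^ 2)
          * κ' * ∫⁻ x, ENNReal.ofReal (normSq s.1 x) ∂surfaceMeasure := by
        rw [hκ' _ hnm, mul_one, mul_assoc]
      _ ≤ v * (1 + ∫⁻ x, ENNReal.ofReal (normSq s.1 x) ∂surfaceMeasure) + ENNReal.ofReal (M ^ 2)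
          * κ' * (1 + ∫⁻ x, ENNReal.ofReal (normSq s.1 x) ∂surfaceMeasure) := by
        gcongr
        · exact le_self_add
        · exact le_add_self
      _ = _ := by rw [add_mul]
  · intro s
    have hnm : Measurable fun x => ENNReal.ofReal (normSq s.1 x) :=
      (hcont s).1.measurable.ennreal_ofReal
    have hgm : Measurable fun x => ENNReal.ofReal (gradSq cov s.1 x) :=
      (hcont s).2.measurable.ennreal_ofReal
    have hsum : ∫⁻ y in conePart 1 2 K', ENNReal.ofReal (normSq s.1 (radial y))
        ≤ ∑ k ∈ T', ∫⁻ y in cell ρ k, ENNReal.ofReal (normSq s.1 (radial y)) := by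
      rw [← lintegral_biUnion_finset (fun k _ l _ h => pairwise_disjoint_cell ρ h)
        (fun k _ => measurableSet_cell ρ k)]
      refine lintegral_mono_set fun y hy => ?_
      obtain ⟨k, hk, hyk⟩ := mem_iUnion₂.1 (hTcov hy.1)
      exact mem_iUnion₂.2 ⟨k, Finset.mem_filter.2 ⟨hk, y, hyk, hy⟩, hyk⟩
    rw [lintegral_conePart hκ hK'c.isClosed.measurableSet hnm] at hsum
    let I' : Fin n → (Fin 4 → ℤ) → ℝ≥0∞ := fun j k =>
      ENNReal.ofReal ((∫ y in cell ρ k, pairing (σ j) (u k) s.1 y) ^ 2)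
    let E : E4 → ℝ≥0∞ := fun y => ENNReal.ofReal (normSq s.1 (radial y))
            + ENNReal.ofReal (gradSq cov s.1 (radial y))
    have hcell : ∀ k ∈ T', ∫⁻ y in cell ρ k, ENNReal.ofReal (normSq s.1 (radial y))
        ≤ ENNReal.ofReal (C ^ 2 * n) * (volume (cell ρ k))⁻¹ * ∑ j, I' j k
          + A₀ * ENNReal.ofReal ((2 * ρ) ^ 2) * ∫⁻ y in cell ρ k, E y := fun k hk =>
      lintegral_normSq_le_sum_pairing hcov.metric s.2.1 (hTsub k (hT'T k hk)) (hu k hk)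
        (measurableSet_cell ρ k) hσ hσM hσC (convex_cell hρ k) (volume_cell_ne_zero hρ k)
        (fun x hx y hy => norm_sub_le_of_mem_cell hρ hx hy) (hcont s).1 (hcont s).2
    have hEint : ∑ k ∈ T', ∫⁻ y in cell ρ k, E y
        ≤ κ' * (∫⁻ x, ENNReal.ofReal (normSq s.1 x) ∂surfaceMeasure
            + ∫⁻ x, ENNReal.ofReal (gradSq cov s.1 x) ∂surfaceMeasure) := by
      refine (sum_lintegral_cell_le (fun k hk => hTsub k (hT'T k hk)) E).trans_eq ?_
      rw [← lintegral_add_left hnm]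
      exact hκ' _ (hnm.add hgm)
    have hJ : ∑ i : T' × Fin n, I' i.2 i.1 = ∑ k ∈ T', ∑ j, I' j k := by
      rw [Fintype.sum_prod_type]
      exact Finset.sum_coe_sort T' fun k => ∑ j, I' j k
    have hall := hsum.trans (sum_le_sum_mul_sum_add hcell)
    rw [← ENNReal.mul_le_mul_iff_right hκ0 hκt]
    refine hall.trans ?_
    rw [mul_add κ, ← mul_assoc κ, ← mul_assoc κ, ENNReal.mul_inv_cancel hκ0 hκt, one_mul,
      ← mul_assoc κ]
    refine add_le_add (mul_le_mul' le_rfl hJ.ge) ?_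
    refine (mul_le_mul' le_rfl hEint).trans ?_
    rw [← mul_assoc]
    refine mul_le_mul' ?_ le_rfl
    refine le_trans (le_of_eq ?_) hρε
    rw [hA]
    ring

end LocalCompactness

/-- A criterion for total boundedness: up to a small error, the norm is controlled by finitely many
bounded functionals. -/
lemma totallyBounded_image_of_functionals {X L H : Type*} [AddCommGroup X] [NormedAddCommGroup L]
    [NormedAddCommGroup H] {f : X → L} (hf : ∀ s t, f (s - t) = f s - f t) {g : X → H}
    (hg : ∀ s t, g (s - t) = g s - g t)
    (h : ∀ ε : ℝ, 0 < ε → ∃ (J : Type) (_ : Fintype J) (Λ : J → X → ℝ) (c B : ℝ), 0 ≤ c ∧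
      (∀ i s t, Λ i (s - t) = Λ i s - Λ i t) ∧ (∀ i s, ‖g s‖ ≤ 1 → |Λ i s| ≤ B) ∧
      ∀ s, ‖f s‖ ^ 2 ≤ c * ∑ i, Λ i s ^ 2 + ε * ‖g s‖ ^ 2) :
    TotallyBounded (f '' {s | ‖g s‖ ≤ 1}) := by
  refine Metric.totallyBounded_iff.2 fun ε hε => ?_
  obtain ⟨J, _, Λ, c, B, hc, hΛ, hB, hle⟩ := h (ε ^ 2 / 8) (by positivity)
  set N : ℝ := c * Fintype.card J with hN
  have hN0 : 0 ≤ N := by positivity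
  -- This gives `N η² ≤ ε² / 4`. As `‖g (s - r y)‖ ≤ 2`, the error term with factor `ε² / 8` is at
  -- most `ε² / 2`, and the total stays below `ε²`.
  set η : ℝ := ε / (2 * (N + 1)) with hη
  have hη0 : 0 < η := by positivity
  have hηN : N * η ^ 2 ≤ ε ^ 2 / 4 := by
    rw [hη, div_pow, ← mul_div_assoc, div_le_div_iff₀ (by positivity) (by norm_num)]
    nlinarith [sq_nonneg ε, mul_nonneg (sq_nonneg ε) hN0, mul_nonneg (sq_nonneg ε) (sq_nonneg N)]
  set D : Set X := {s | ‖g s‖ ≤ 1} with hD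
  -- The vector of functionals maps the unit ball to a bounded set of a finite-dimensional space,
  -- which has a finite `η`-net.
  let Φ : X → J → ℝ := fun s i => Λ i s
  have hΦ : TotallyBounded (Φ '' D) := by
    refine (isCompact_closedBall (0 : J → ℝ) (max B 0)).totallyBounded.subset ?_
    rintro _ ⟨s, hs, rfl⟩
    rw [mem_closedBall_zero_iff, pi_norm_le_iff_of_nonneg (le_max_right _ _)]
    exact fun i => (hB i s hs).trans (le_max_left _ _)
  obtain ⟨t, htD, htf, htc⟩ := Metric.finite_approx_of_totallyBounded hΦ η hη0
  have htD' : ∀ y ∈ t, ∃ s, s ∈ D ∧ Φ s = y := fun y hy => htD hy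
  choose! r hrD hr using htD'
  refine ⟨(fun y => f (r y)) '' t, htf.image _, ?_⟩
  rintro _ ⟨s, hs, rfl⟩
  obtain ⟨y, hy, hsy⟩ := mem_iUnion₂.1 (htc ⟨s, hs, rfl⟩)
  refine mem_iUnion₂.2 ⟨f (r y), ⟨y, hy, rfl⟩, ?_⟩
  have h1 : ∀ i, Λ i (s - r y) ^ 2 ≤ η ^ 2 := fun i => by
    rw [← hr y hy, Metric.mem_ball] at hsy
    have h2 := (dist_le_pi_dist (Φ s) (Φ (r y)) i).trans hsy.le
    rw [Real.dist_eq, ← hΛ] at h2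
    exact sq_le_sq' (abs_le.1 h2).1 (abs_le.1 h2).2
  have h2 : ∑ i, Λ i (s - r y) ^ 2 ≤ Fintype.card J * η ^ 2 := by
    refine (Finset.sum_le_card_nsmul _ _ _ fun i _ => h1 i).trans_eq ?_
    simp
  have h3 : ‖g (s - r y)‖ ≤ 2 := by
    rw [hg]
    refine (norm_sub_le _ _).trans ?_
    have h4 : ‖g s‖ ≤ 1 := hs
    have h5 : ‖g (r y)‖ ≤ 1 := hrD y hy
    linarith
  have h4 : ‖f (s - r y)‖ ^ 2 < ε ^ 2 := by
    have h5 := hle (s - r y)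
    have h6 := mul_le_mul_of_nonneg_left h2 hc
    have h7 : ‖g (s - r y)‖ ^ 2 ≤ 4 := by nlinarith [norm_nonneg (g (s - r y))]
    have h8 := mul_le_mul_of_nonneg_left h7 (by positivity : 0 ≤ ε ^ 2 / 8)
    rw [← mul_assoc, ← hN] at h6
    nlinarith [sq_pos_of_pos hε]
  rw [Metric.mem_ball, dist_eq_norm, ← hf]
  exact lt_of_pow_lt_pow_left₀ 2 hε.le h4

/-! ### Compactness of the map from `ℍ` to `𝕃` -/

section Compactness

variable (𝕜 : Type*) [RCLike 𝕜]
  {F : Type*} [NormedAddCommGroup F] [NormedSpace ℝ F]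
  {V : S3 → Type*} [TopologicalSpace (TotalSpace F V)]
  [∀ x, NormedAddCommGroup (V x)] [∀ x, InnerProductSpace ℝ (V x)]
  [FiberBundle F V] [VectorBundle ℝ F V]
  {U : TopologicalSpace.Opens S3}
  {I : U → Type*} [TopologicalSpace (TotalSpace ℝ I)]
  [∀ x, NormedAddCommGroup (I x)] [∀ x, InnerProductSpace ℝ (I x)]
  [FiberBundle ℝ I] [VectorBundle ℝ ℝ I] [IsContinuousRiemannianBundle ℝ I]
  [IsContMDiffRiemannianBundle (𝓡 3) ∞ F V]
  [FiniteDimensional ℝ F] [ContMDiffVectorBundle ∞ F V (𝓡 3)]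
  [∀ x, InnerProductSpace 𝕜 (V x)] [∀ x, IsScalarTower ℝ 𝕜 (V x)] [SmoothScalars 𝕜 F V]
  (cov : CovariantDerivative (𝓡 3) F V) [hcov : MetricConnection 𝕜 F V cov]

/-- Up to a small multiple of the Dirichlet norm, the `L²` norm is controlled by finitely many
bounded functionals. -/
lemma exists_functionals_norm_toL_sq_le {C : ℝ}
    (hC : ∀ s : testSections 𝕜 F V I, ‖toL s‖ ≤ C * ‖toH cov s‖) {ε : ℝ} (hε : 0 < ε) :
    ∃ (J : Type) (_ : Fintype J) (Λ : J → testSections 𝕜 F V I → ℝ) (c B : ℝ), 0 ≤ c ∧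
      (∀ i s t, Λ i (s - t) = Λ i s - Λ i t) ∧ (∀ i s, ‖toH cov s‖ ≤ 1 → |Λ i s| ≤ B) ∧
      ∀ s, ‖toL s‖ ^ 2 ≤ c * ∑ i, Λ i s ^ 2 + ε * ‖toH cov s‖ ^ 2 := by
  -- The full energy is at most `C² + 1` times the squared Dirichlet norm, and the error occurs
  -- twice, near the boundary of `U` and on the compact part; each occurrence costs `ε / 2`.
  set ε' : ℝ≥0∞ := ENNReal.ofReal (ε / (2 * (C ^ 2 + 1))) with hε'
  have hε0 : ε' ≠ 0 := (ENNReal.ofReal_pos.2 (by positivity)).ne'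
  obtain ⟨η, hη, hnear⟩ := exists_small_set_bound hε0
  -- Inner regularity: the part of `U` outside a compact set has measure below `η`.
  obtain ⟨K', hK'U, hK', hK'η⟩ := U.2.measurableSet.exists_isCompact_sdiff_lt
    (μ := surfaceMeasure) (measure_ne_top _ _) hη
  replace hK'U : K' ⊆ (U : Set S3) := hK'U
  have hK : IsCompact ((↑) ⁻¹' K' : Set U) :=
    U.2.isOpenEmbedding_subtypeVal.isInducing.isCompact_preimage' hK' (by simpa using hK'U)
  have himage : Subtype.val '' ((↑) ⁻¹' K' : Set U) = K' := by
    rw [image_preimage_eq_inter_range]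
    exact inter_eq_left.2 (by simpa using hK'U)
  obtain ⟨J, hJ, Λ, c, B, hc, hB, hΛ, hΛB, hfar⟩ := exists_functionals (I := I) 𝕜 cov hK hε0
  have hLH : ∀ s : testSections 𝕜 F V I, ‖toL s‖ ^ 2 ≤ C ^ 2 * ‖toH cov s‖ ^ 2 := fun s => by
    rw [← mul_pow]
    exact pow_le_pow_left₀ (norm_nonneg _) (hC s) 2
  have hfin : B * (1 + ENNReal.ofReal (C ^ 2)) ≠ ⊤ :=
    ENNReal.mul_ne_top hB (ENNReal.add_ne_top.2 ⟨ENNReal.one_ne_top, ENNReal.ofReal_ne_top⟩)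
  refine ⟨J, hJ, Λ, c.toReal, (B * (1 + ENNReal.ofReal (C ^ 2))).toReal, ENNReal.toReal_nonneg, hΛ,
    fun i s hs => ?_, fun s => ?_⟩
  · have h1 := hΛB i s
    rw [← ofReal_norm_toL_sq] at h1
    have h2 : ‖toL s‖ ^ 2 ≤ C ^ 2 := by
      refine (hLH s).trans (mul_le_of_le_one_right (sq_nonneg C) ?_)
      exact pow_le_one₀ (norm_nonneg _) hs
    have h3 := h1.trans (mul_le_mul_right (add_le_add_right (ENNReal.ofReal_le_ofReal h2) 1) B)
    rw [← Real.norm_eq_abs, ← toReal_enorm]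
    exact ENNReal.toReal_mono hfin h3
  · obtain ⟨hs, T, hT, hsT⟩ := s.2
    have hsq := sqrtGradBound_normSq hcov.metric hs hT hsT
    have hcont : Continuous fun x => √(gradSq cov s.1 x) := (continuous_gradSq 𝕜 cov hs hT hsT).sqrt
    have hgr : ∀ x, ENNReal.ofReal (√(gradSq cov s.1 x) ^ 2) = ENNReal.ofReal (gradSq cov s.1 x) :=
      fun x => by rw [Real.sq_sqrt (gradSq_nonneg cov s.1 x)]
    have h1 := hnear (U \ K') (U.2.measurableSet.diff hK'.isClosed.measurableSet) hK'η.le _ _ hsq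
      hcont (fun x => Real.sqrt_nonneg _)
    have h2 := hfar s
    rw [himage] at h2
    simp only [hgr, enorm_sqrt_sq (normSq_nonneg s.1 _), ← ofReal_norm_toH_sq cov s,
      ← ofReal_norm_toL_sq s] at h1 h2
    have h3 : ENNReal.ofReal (‖toL s‖ ^ 2)
        ≤ ∫⁻ x in (U \ K'), ENNReal.ofReal (normSq s.1 x) ∂surfaceMeasure
          + ∫⁻ x in K', ENNReal.ofReal (normSq s.1 x) ∂surfaceMeasure := by
      rw [ofReal_norm_toL_sq]
      refine le_trans (le_of_eq ?_) (lintegral_union_le _ _ _)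
      rw [sdiff_union_self, union_eq_self_of_subset_right hK'U, ← lintegral_indicator (s := (U : Set S3)) U.2.measurableSet]
      refine lintegral_congr fun x => ?_
      by_cases hx : x ∈ (U : Set S3)
      · rw [indicator_of_mem hx]
      · rw [indicator_of_notMem hx, normSq, extendZero_of_notMem _ hx, ENNReal.ofReal_zero]
    have h4 := h3.trans (add_le_add h1 h2)
    have h5 : ENNReal.ofReal (‖toL s‖ ^ 2) + ENNReal.ofReal (‖toH cov s‖ ^ 2)
        ≤ ENNReal.ofReal ((C ^ 2 + 1) * ‖toH cov s‖ ^ 2) := by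
      rw [← ENNReal.ofReal_add (by positivity) (by positivity)]
      refine ENNReal.ofReal_le_ofReal ?_
      rw [add_mul, one_mul]
      gcongr
      exact hLH s
    have h6 : ENNReal.ofReal (‖toL s‖ ^ 2) ≤ ENNReal.ofReal
        (c.toReal * ∑ i, Λ i s ^ 2 + ε * ‖toH cov s‖ ^ 2) := by
      refine h4.trans ?_
      have h7 : ε' * (ENNReal.ofReal (‖toL s‖ ^ 2) + ENNReal.ofReal (‖toH cov s‖ ^ 2))
          ≤ ENNReal.ofReal (ε / 2 * ‖toH cov s‖ ^ 2) := by
        refine (mul_le_mul_right h5 _).trans_eq ?_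
        rw [hε', ← ENNReal.ofReal_mul (by positivity)]
        congr 1
        field_simp
      have h8 : c * ∑ i, ENNReal.ofReal (Λ i s ^ 2)
          = ENNReal.ofReal (c.toReal * ∑ i, Λ i s ^ 2) := by
        rw [ENNReal.ofReal_mul ENNReal.toReal_nonneg, ENNReal.ofReal_toReal hc,
          ENNReal.ofReal_sum_of_nonneg fun i _ => sq_nonneg _]
      rw [h8]
      refine (add_le_add h7 (add_le_add_right h7 _)).trans_eq ?_
      rw [← ENNReal.ofReal_add (by positivity) (by positivity),
        ← ENNReal.ofReal_add (by positivity) (by positivity)]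
      congr 1
      ring
    exact (ENNReal.ofReal_le_ofReal_iff (by positivity)).1 h6

variable {𝕜}

/-- The extension of the identity on test sections to a map from `ℍ` to `𝕃`. -/
def embed (h : ∃ C : ℝ, ∀ s : testSections 𝕜 F V I, ‖toL s‖ ≤ C * ‖toH cov s‖) :
    HSpace 𝕜 F I cov →L[𝕜] LSpace 𝕜 F V I :=
  ContinuousLinearMap.completion
    (LinearMap.mkContinuousOfExistsBound (E := PreH 𝕜 F I cov) (F := PreL 𝕜 F V I)
      (show PreH 𝕜 F I cov →ₗ[𝕜] PreL 𝕜 F V I from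
        (LinearMap.id : testSections 𝕜 F V I →ₗ[𝕜] testSections 𝕜 F V I))
      (h.imp fun C hC s => by
        have h1 : ‖toL (show testSections 𝕜 F V I from s)‖ = ‖(show PreL 𝕜 F V I from s)‖ :=
          UniformSpace.Completion.norm_coe _
        have h2 : ‖toH cov (show testSections 𝕜 F V I from s)‖ = ‖s‖ :=
          UniformSpace.Completion.norm_coe _
        exact h1.symm.le.trans ((hC s).trans_eq (by rw [h2]))))

variable {cov}

lemma embed_toH (h : ∃ C : ℝ, ∀ s : testSections 𝕜 F V I, ‖toL s‖ ≤ C * ‖toH cov s‖)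
    (s : testSections 𝕜 F V I) : embed cov h (toH cov s) = toL s :=
  UniformSpace.Completion.map_coe (ContinuousLinearMap.uniformContinuous _) _

lemma denseRange_toL : DenseRange (toL : testSections 𝕜 F V I → LSpace 𝕜 F V I) :=
  UniformSpace.Completion.denseRange_coe (α := PreL 𝕜 F V I)

lemma denseRange_toH : DenseRange (toH cov : testSections 𝕜 F V I → HSpace 𝕜 F I cov) :=
  UniformSpace.Completion.denseRange_coe (α := PreH 𝕜 F I cov)

lemma denseRange_embed (h : ∃ C : ℝ, ∀ s : testSections 𝕜 F V I, ‖toL s‖ ≤ C * ‖toH cov s‖) :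
    DenseRange (embed cov h) := by
  refine denseRange_toL.mono ?_
  rintro _ ⟨s, rfl⟩
  exact ⟨toH cov s, embed_toH h s⟩

/-- The test sections of Dirichlet norm at most one have totally bounded image in `𝕃`. They are
dense in the unit ball of `ℍ`, so by continuity that ball maps into the compact closure of this
image. -/
lemma isCompactOperator_embed
    (h : ∃ C : ℝ, ∀ s : testSections 𝕜 F V I, ‖toL s‖ ≤ C * ‖toH cov s‖) :
    IsCompactOperator (embed cov h) := by
  have h1 : TotallyBounded ((toL : testSections 𝕜 F V I → _) '' {s | ‖toH cov s‖ ≤ 1}) := by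
    obtain ⟨C, hC⟩ := h
    refine totallyBounded_image_of_functionals (fun s t => UniformSpace.Completion.coe_sub (α := PreL 𝕜 F V I) s t)
      (g := toH cov) (fun s t => UniformSpace.Completion.coe_sub (α := PreH 𝕜 F I cov) s t)
      fun ε hε => exists_functionals_norm_toL_sq_le 𝕜 cov hC hε
  refine ⟨_, h1.closure.isCompact_of_isClosed isClosed_closure, ?_⟩
  refine Filter.mem_of_superset (Metric.ball_mem_nhds 0 one_pos) fun x hx => ?_
  have h2 : x ∈ closure (Metric.ball 0 1 ∩ range (toH cov : testSections 𝕜 F V I → _)) :=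
    denseRange_toH.open_subset_closure_inter Metric.isOpen_ball hx
  have h3 := image_closure_subset_closure_image (embed cov h).continuous ⟨x, h2, rfl⟩
  refine closure_mono ?_ h3
  rintro _ ⟨_, ⟨h4, s, rfl⟩, rfl⟩
  exact ⟨s, (mem_ball_zero_iff.1 h4).le, (embed_toH h s).symm⟩

end Compactness

/-! ### The group action and the invariance of weak solutions -/

section Equivariance

variable {𝕜 : Type*} [RCLike 𝕜]
  {F : Type*} [NormedAddCommGroup F] [NormedSpace ℝ F]
  {V : S3 → Type*} [TopologicalSpace (TotalSpace F V)]
  [∀ x, NormedAddCommGroup (V x)] [∀ x, InnerProductSpace ℝ (V x)]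
  [FiberBundle F V] [VectorBundle ℝ F V]
  {U : TopologicalSpace.Opens S3}
  {I : U → Type*} [TopologicalSpace (TotalSpace ℝ I)]
  [∀ x, NormedAddCommGroup (I x)] [∀ x, InnerProductSpace ℝ (I x)]
  [FiberBundle ℝ I] [VectorBundle ℝ ℝ I] [IsContinuousRiemannianBundle ℝ I]
  [∀ x, InnerProductSpace 𝕜 (V x)] [∀ x, IsScalarTower ℝ 𝕜 (V x)] [SmoothScalars 𝕜 F V]

lemma contract_tmul_self (y : U) {u : I y} (hu : ‖u‖ = 1) (s : V y ⊗[ℝ] I y) :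
    contract u s ⊗ₜ[ℝ] u = s := by
  induction s with
  | zero => simp
  | tmul v j =>
    rw [contract_tmul, TensorProduct.smul_tmul, ← eq_smul_of_norm_eq_one y hu]
  | add a b ha hb => rw [map_add, TensorProduct.add_tmul, ha, hb]

lemma eq_zero_of_fiberInner_self {y : U} {s : V y ⊗[ℝ] I y} (h : fiberInner 𝕜 y s s = 0) :
    s = 0 := by
  have h1 : contract (frame I y y) s = 0 := inner_self_eq_zero.1 h
  rw [← contract_tmul_self y (isUnitFrameAt_frame y).norm_eq s, h1, TensorProduct.zero_tmul]

namespace IsometricLift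

variable {G : Subgroup (E4 ≃ₗᵢ[ℝ] E4)} {hG : Preserves G U} (δ : IsometricLift 𝕜 F V I G hG)

lemma onTest_onTest (g h : G) (s : testSections 𝕜 F V I) :
    δ.onTest g (δ.onTest h s) = δ.onTest (h * g) s :=
  Subtype.ext (δ.comp g h s.1)

/-- The maps between fibers are isometric and the action on `U` is surjective. -/
lemma onTest_injective (g : G) : Function.Injective (δ.onTest g) := by
  refine (injective_iff_map_eq_zero _).2 fun s hs => Subtype.ext (funext fun y => ?_)
  obtain ⟨x, rfl⟩ := (act hG g).surjective y
  have h1 : δ.δ g x (s.1 (act hG g x)) = 0 := congrFun (congrArg Subtype.val hs) x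
  refine eq_zero_of_fiberInner_self (𝕜 := 𝕜) ?_
  rw [← δ.isometry g x, h1]
  simp [fiberInner]

-- The composition law makes the action of `1` idempotent, and an injective idempotent map is the
-- identity.
@[simp] lemma onTest_one (s : testSections 𝕜 F V I) : δ.onTest 1 s = s := by
  apply δ.onTest_injective 1
  rw [onTest_onTest, mul_one]

lemma onTest_onTest_inv (g : G) (s : testSections 𝕜 F V I) : δ.onTest g (δ.onTest g⁻¹ s) = s := by
  rw [onTest_onTest, inv_mul_cancel, onTest_one]

lemma onTest_inv_onTest (g : G) (s : testSections 𝕜 F V I) : δ.onTest g⁻¹ (δ.onTest g s) = s := by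
  rw [onTest_onTest, mul_inv_cancel, onTest_one]

variable [IsContMDiffRiemannianBundle (𝓡 3) ∞ F V]
  [FiniteDimensional ℝ F] [ContMDiffVectorBundle ∞ F V (𝓡 3)]

/-- The action is unitary on `𝕃`; it suffices to check this on the dense set of test sections. -/
lemma inner_onL (g : G) (x y : LSpace 𝕜 F V I) :
    inner 𝕜 x (δ.onL g y) = inner 𝕜 (δ.onL g⁻¹ x) y := by
  refine denseRange_toL.induction_on₂ (p := fun x y => inner 𝕜 x (δ.onL g y)
    = inner 𝕜 (δ.onL g⁻¹ x) y) ?_ (fun s t => ?_) x y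
  · exact isClosed_eq (by fun_prop) (by fun_prop)
  · simp only [onL_toL, inner_toL]
    rw [← δ.innerL_onTest g (δ.onTest g⁻¹ s), onTest_onTest_inv]

lemma norm_toL_onTest (g : G) (s : testSections 𝕜 F V I) : ‖toL (δ.onTest g s)‖ = ‖toL s‖ := by
  rw [← sq_eq_sq₀ (norm_nonneg _) (norm_nonneg _), ← inner_self_eq_norm_sq (𝕜 := 𝕜),
    ← inner_self_eq_norm_sq (𝕜 := 𝕜), inner_toL, inner_toL, innerL_onTest]

end IsometricLift

variable [IsContMDiffRiemannianBundle (𝓡 3) ∞ F V]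
  [FiniteDimensional ℝ F] [ContMDiffVectorBundle ∞ F V (𝓡 3)]

lemma SymmetricEndomorphism.inner_onL (R : SymmetricEndomorphism 𝕜 F V) (x y : LSpace 𝕜 F V I) :
    inner 𝕜 (R.onL x) y = inner 𝕜 x (R.onL y) := by
  refine denseRange_toL.induction_on₂ (p := fun x y => inner 𝕜 (R.onL x) y
    = inner 𝕜 x (R.onL y)) ?_ (fun s t => ?_) x y
  · exact isClosed_eq (by fun_prop) (by fun_prop)
  · simp only [onL_toL, inner_toL, innerL]
    refine integral_congr_ae (Filter.Eventually.of_forall fun z => ?_)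
    change inner 𝕜 (contract _ (R.twist I z (s.1 z))) _
      = inner 𝕜 _ (contract _ (R.twist I z (t.1 z)))
    rw [contract_twist, contract_twist, R.symm]

variable {cov : CovariantDerivative (𝓡 3) F V} [hcov : MetricConnection 𝕜 F V cov]
  {G : Subgroup (E4 ≃ₗᵢ[ℝ] E4)} {hG : Preserves G U} {δ : IsometricLift 𝕜 F V I G hG}
  {R : SymmetricEndomorphism 𝕜 F V}

lemma abs_re_inner_onL_le (R : SymmetricEndomorphism 𝕜 F V) (x : LSpace 𝕜 F V I) :
    |RCLike.re (inner 𝕜 x (R.onL x))|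
      ≤ ‖(R.onL : LSpace 𝕜 F V I →L[𝕜] LSpace 𝕜 F V I)‖ * ‖x‖ ^ 2 := by
  refine (RCLike.abs_re_le_norm _).trans ((norm_inner_le_norm _ _).trans ?_)
  have h1 := (R.onL : LSpace 𝕜 F V I →L[𝕜] LSpace 𝕜 F V I).le_opNorm x
  nlinarith [norm_nonneg x]

set_option maxHeartbeats 2000000 in
-- Equivariance concerns the sum `∇†∇ + R` only, so the action is not assumed to preserve the
-- Dirichlet norm. But the energy is preserved, and the `R`-term is bounded by the `L²` norm, which
-- the action preserves and the Dirichlet norm dominates.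
lemma IsEquivariant.exists_norm_toH_onTest_le (hδ : IsEquivariant cov R δ)
    (h : ∃ C : ℝ, ∀ s : testSections 𝕜 F V I, ‖toL s‖ ≤ C * ‖toH cov s‖) (g : G) :
    ∃ M : ℝ, ∀ s, ‖toH cov (δ.onTest g s)‖ ≤ M * ‖toH cov s‖ := by
  obtain ⟨C, hC⟩ := h
  obtain ⟨c, hc⟩ : ∃ c, c = ‖(R.onL : LSpace 𝕜 F V I →L[𝕜] LSpace 𝕜 F V I)‖ := ⟨_, rfl⟩
  have hc0 : 0 ≤ c := hc ▸ norm_nonneg _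
  have hR : ∀ s : testSections 𝕜 F V I, |RCLike.re (innerL 𝕜 F s (R.onTest s))|
      ≤ c * ‖toL s‖ ^ 2 := fun s => by
    have h1 := abs_re_inner_onL_le R (toL s)
    rwa [SymmetricEndomorphism.onL_toL, inner_toL, ← hc] at h1
  have he : ∀ s : testSections 𝕜 F V I, RCLike.re (energy cov R s s)
      = ‖toH cov s‖ ^ 2 + RCLike.re (innerL 𝕜 F s (R.onTest s)) := fun s => by
    rw [energy, ← inner_toH, map_add, inner_self_eq_norm_sq]
  refine ⟨√(1 + 2 * c * C ^ 2), fun s => ?_⟩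
  have h1 := he (δ.onTest g s)
  rw [hδ g, δ.onTest_inv_onTest, he] at h1
  have h2 := (abs_le.1 (hR s)).2
  have h3 := (abs_le.1 (hR (δ.onTest g s))).1
  rw [δ.norm_toL_onTest] at h3
  have h4 : ‖toL s‖ ^ 2 ≤ C ^ 2 * ‖toH cov s‖ ^ 2 := by
    rw [← mul_pow]
    exact pow_le_pow_left₀ (norm_nonneg _) (hC s) 2
  rw [← sq_le_sq₀ (norm_nonneg _) (mul_nonneg (Real.sqrt_nonneg _) (norm_nonneg _)), mul_pow,
    Real.sq_sqrt (by positivity)]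
  have h5 := mul_le_mul_of_nonneg_left h4 hc0
  generalize ‖toH cov s‖ ^ 2 = a at *
  generalize ‖toL s‖ ^ 2 = b at *
  generalize ‖toH cov (δ.onTest g s)‖ ^ 2 = d at *
  generalize RCLike.re (innerL 𝕜 F s (R.onTest s)) = e at *
  generalize RCLike.re (innerL 𝕜 F _ (R.onTest (δ.onTest g s))) = f at *
  linarith

/-- The action of an element of the group on test sections extends to `ℍ`. -/
lemma IsEquivariant.exists_onH (hδ : IsEquivariant cov R δ)
    (h : ∃ C : ℝ, ∀ s : testSections 𝕜 F V I, ‖toL s‖ ≤ C * ‖toH cov s‖) (g : G) :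
    ∃ γ : HSpace 𝕜 F I cov →L[𝕜] HSpace 𝕜 F I cov, ∀ s, γ (toH cov s) = toH cov (δ.onTest g s) := by
  obtain ⟨M, hM⟩ := hδ.exists_norm_toH_onTest_le h g
  have hn : ∀ s : PreH 𝕜 F I cov, ‖toH cov (show testSections 𝕜 F V I from s)‖ = ‖s‖ :=
    fun s => UniformSpace.Completion.norm_coe _
  refine ⟨ContinuousLinearMap.completion
    (LinearMap.mkContinuousOfExistsBound (E := PreH 𝕜 F I cov) (F := PreH 𝕜 F I cov)
      (show PreH 𝕜 F I cov →ₗ[𝕜] PreH 𝕜 F I cov from δ.onTest g)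
      ⟨M, fun s => ?_⟩), fun s => ?_⟩
  · exact (hn _).symm.le.trans ((hM s).trans_eq (by rw [hn]))
  · exact UniformSpace.Completion.map_coe (ContinuousLinearMap.uniformContinuous _) _

/-- Solutions of the weak equation with invariant right hand side are invariant. -/
lemma IsEquivariant.embed_mem_invariants (hδ : IsEquivariant cov R δ)
    (h : ∃ C : ℝ, ∀ s : testSections 𝕜 F V I, ‖toL s‖ ≤ C * ‖toH cov s‖) {c : ℝ}
    (hc : ‖(R.onL : LSpace 𝕜 F V I →L[𝕜] LSpace 𝕜 F V I)‖ ≤ c) {u : HSpace 𝕜 F I cov}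
    {x : LSpace 𝕜 F V I} (hx : x ∈ δ.invariants)
    (hu : ∀ η, inner 𝕜 η u + inner 𝕜 (embed cov h η) (R.onL (embed cov h u))
      + (c : 𝕜) * inner 𝕜 (embed cov h η) (embed cov h u) = inner 𝕜 (embed cov h η) x) :
    embed cov h u ∈ δ.invariants := by
  set ι := embed cov h with hι
  rw [δ.mem_invariants] at hx ⊢
  intro g
  obtain ⟨γ, hγ⟩ := hδ.exists_onH h g
  obtain ⟨γ', hγ'⟩ := hδ.exists_onH h g⁻¹
  have hιγ : ∀ v, ι (γ v) = δ.onL g (ι v) := fun v => by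
    refine denseRange_toH.induction_on (p := fun v => ι (γ v) = δ.onL g (ι v)) v ?_ fun s => ?_
    · exact isClosed_eq (by fun_prop) (by fun_prop)
    · rw [hγ, hι, embed_toH, embed_toH, δ.onL_toL]
  have hιγ' : ∀ v, ι (γ' v) = δ.onL g⁻¹ (ι v) := fun v => by
    refine denseRange_toH.induction_on (p := fun v => ι (γ' v) = δ.onL g⁻¹ (ι v)) v ?_ fun s => ?_
    · exact isClosed_eq (by fun_prop) (by fun_prop)
    · rw [hγ', hι, embed_toH, embed_toH, δ.onL_toL]
  -- Equivariance of the form, extended from test sections to `ℍ` by density.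
  have hadj : ∀ η v, inner 𝕜 η (γ v) + inner 𝕜 (ι η) (R.onL (ι (γ v)))
      = inner 𝕜 (γ' η) v + inner 𝕜 (ι (γ' η)) (R.onL (ι v)) := fun η v => by
    refine denseRange_toH.induction_on₂ (p := fun η v => inner 𝕜 η (γ v)
      + inner 𝕜 (ι η) (R.onL (ι (γ v)))
      = inner 𝕜 (γ' η) v + inner 𝕜 (ι (γ' η)) (R.onL (ι v))) ?_ (fun s t => ?_) η v
    · exact isClosed_eq (by fun_prop) (by fun_prop)
    · have h1 := hδ g s t
      simp only [energy] at h1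
      simp only [hγ, hγ', hι, embed_toH, SymmetricEndomorphism.onL_toL, inner_toL, inner_toH]
      exact h1
  -- Since `x` is invariant, `γ u` solves the same equation as `u`, so the difference solves the
  -- homogeneous one.
  have hw : ∀ η, inner 𝕜 η (γ u - u) + inner 𝕜 (ι η) (R.onL (ι (γ u - u)))
      + (c : 𝕜) * inner 𝕜 (ι η) (ι (γ u - u)) = 0 := fun η => by
    have h1 := hu (γ' η)
    rw [← hadj, hιγ', ← δ.inner_onL, ← δ.inner_onL, ← hιγ, hx] at h1
    simp only [map_sub, inner_sub_right]
    linear_combination h1 - hu η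
  -- Test with the difference itself: because `‖R‖ ≤ c`, the zeroth order terms add up to something
  -- nonnegative, and the Dirichlet norm must vanish.
  have h1 := congrArg RCLike.re (hw (γ u - u))
  rw [map_add, map_add, RCLike.re_ofReal_mul, inner_self_eq_norm_sq, inner_self_eq_norm_sq,
    map_zero] at h1
  have h2 := (abs_le.1 (abs_re_inner_onL_le R (ι (γ u - u)))).1
  have h3 : ‖γ u - u‖ ^ 2 ≤ 0 := by
    nlinarith [mul_le_mul_of_nonneg_right hc (sq_nonneg ‖ι (γ u - u)‖)]
  have h4 : γ u - u = 0 := norm_eq_zero.1 (pow_eq_zero_iff two_ne_zero |>.1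
    (le_antisymm h3 (sq_nonneg _)))
  rw [← hιγ, sub_eq_zero.1 h4]

lemma isClosed_invariants (δ : IsometricLift 𝕜 F V I G hG) :
    IsClosed (δ.invariants : Set (LSpace 𝕜 F V I)) := by
  have h1 : (δ.invariants : Set (LSpace 𝕜 F V I)) = ⋂ g, {x | δ.onL g x = x} := by
    ext x
    simp [δ.mem_invariants]
  rw [h1]
  exact isClosed_iInter fun g => isClosed_eq (by fun_prop) continuous_id

end Equivariance

/-! ### The invariant subspace has infinite dimension -/

/-- A non-trivial linear isometry moves some point of each nonempty open set. -/
lemma interior_fixed_eq_empty {g : E4 ≃ₗᵢ[ℝ] E4} (hg : g ≠ 1) :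
    interior {x : S3 | rotate g x = x} = ∅ := by
  by_contra h
  obtain ⟨x, hx⟩ := nonempty_iff_ne_empty.2 h
  -- An interior fixed point on the sphere gives an open cone of fixed vectors, so the linear space
  -- of fixed vectors has interior and is everything.
  have h1 : (LinearMap.ker ((g.toLinearEquiv : E4 →ₗ[ℝ] E4) - LinearMap.id)) = ⊤ := by
    refine Submodule.eq_top_of_nonempty_interior' _ ⟨(x : E4), ?_⟩
    rw [mem_interior_iff_mem_nhds] at hx ⊢
    filter_upwards [eventually_radial hx, isOpen_ne.mem_nhds (S3.ne_zero x)] with y hy hy0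
    have h2 := congrArg Subtype.val (show rotate g (radial y) = radial y from hy)
    have h3 : g (radial y : E4) = radial y := h2
    rw [coe_radial hy0, map_smul] at h3
    have h4 : g y = y := smul_right_injective _ (inv_ne_zero (norm_ne_zero_iff.2 hy0)) h3
    simp [h4]
  refine hg (LinearIsometryEquiv.ext fun y => ?_)
  have h2 : y ∈ (LinearMap.ker ((g.toLinearEquiv : E4 →ₗ[ℝ] E4) - LinearMap.id)) :=
    h1 ▸ Submodule.mem_top
  have h3 : g y - y = 0 := h2
  exact sub_eq_zero.1 h3

/-- A finite group of linear isometries moves a suitable open set to pairwise disjoint sets. -/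
lemma exists_isOpen_forall_rotate_notMem {G : Subgroup (E4 ≃ₗᵢ[ℝ] E4)} [Finite G] {O : Set S3}
    (hO : IsOpen O) (hne : O.Nonempty) : ∃ W ⊆ O, IsOpen W ∧ W.Nonempty ∧
      ∀ g : G, g ≠ 1 → ∀ x ∈ W, rotate g x ∉ W := by
  -- Finitely many closed sets with empty interior: some point of `O` is moved by every nontrivial
  -- element. Hausdorff separation then moves a whole neighborhood off itself.
  have h1 : Dense (⋂ g : {g : G // g ≠ 1}, {x : S3 | rotate (g : G) x = x}ᶜ) := by
    refine dense_iInter_of_isOpen (fun g => ?_) fun g => ?_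
    · exact (isClosed_eq (continuous_rotate _) continuous_id).isOpen_compl
    · rw [← interior_eq_empty_iff_dense_compl]
      exact interior_fixed_eq_empty fun h => g.2 (Subtype.ext h)
  obtain ⟨x, hxO, hx⟩ := h1.inter_open_nonempty O hO hne
  have h2 : ∀ g : {g : G // g ≠ 1}, ∀ᶠ A in (𝓝 x).smallSets, ∀ y ∈ A, rotate (g : G) y ∉ A := by
    intro g
    have hgx : x ≠ rotate (g : G) x := fun h => (mem_iInter.1 hx g) h.symm
    obtain ⟨A, B, hA, hB, hxA, hxB, hAB⟩ := t2_separation hgx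
    refine Filter.eventually_smallSets.2 ⟨A ∩ rotate (g : G) ⁻¹' B, ?_, fun C hC y hy hgy => ?_⟩
    · exact Filter.inter_mem (hA.mem_nhds hxA)
        ((continuous_rotate _).continuousAt.preimage_mem_nhds (hB.mem_nhds hxB))
    · exact disjoint_left.1 hAB (hC hgy).1 (hC hy).2
  obtain ⟨A, hA, hA'⟩ := Filter.eventually_smallSets.1 (Filter.eventually_all.2 h2)
  refine ⟨O ∩ interior A, inter_subset_left, hO.inter isOpen_interior,
    ⟨x, hxO, mem_interior_iff_mem_nhds.2 hA⟩, fun g hg y hy hgy => ?_⟩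
  exact hA' (O ∩ interior A) (inter_subset_right.trans interior_subset) ⟨g, hg⟩ y hy hgy

/-- A nonempty open subset of the sphere contains infinitely many disjoint nonempty open sets. -/
lemma exists_seq_isOpen_pairwise_disjoint {W : Set S3} (hW : IsOpen W) (hne : W.Nonempty) :
    ∃ O : ℕ → Set S3, (∀ n, IsOpen (O n)) ∧ (∀ n, (O n).Nonempty) ∧ (∀ n, O n ⊆ W) ∧
      ∀ m n, m ≠ n → Disjoint (O m) (O n) := by
  obtain ⟨x, hx⟩ := hne
  have : Nontrivial S3 := by
    refine ⟨x, -x, fun h => S3.ne_zero x ?_⟩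
    have := IsAddTorsionFree.of_isTorsionFree ℝ E4
    exact self_eq_neg.1 (congrArg Subtype.val h)
  have : ConnectedSpace S3 := ⟨⟨x⟩⟩
  -- A connected Hausdorff space with more than one point has no isolated points, so its nonempty
  -- open sets are infinite.
  have : Infinite W := (infinite_of_mem_nhds x (hW.mem_nhds hx)).to_subtype
  obtain ⟨O, hO, hne, hdis⟩ := exists_seq_infinite_isOpen_pairwise_disjoint W
  refine ⟨fun n => Subtype.val '' O n, fun n => hW.isOpenMap_subtype_val _ (hne n), fun n => ?_,
    fun n => ?_, fun m n hmn => ?_⟩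
  · exact (hO n).nonempty.image _
  · rintro _ ⟨y, -, rfl⟩
    exact y.2
  · exact (disjoint_image_iff Subtype.val_injective).2 (hdis hmn)

section Invariants

variable {𝕜 : Type*} [RCLike 𝕜]
  {F : Type*} [NormedAddCommGroup F] [NormedSpace ℝ F]
  {V : S3 → Type*} [TopologicalSpace (TotalSpace F V)]
  [∀ x, NormedAddCommGroup (V x)] [∀ x, InnerProductSpace ℝ (V x)]
  [FiberBundle F V] [VectorBundle ℝ F V]
  {U : TopologicalSpace.Opens S3}
  {I : U → Type*} [TopologicalSpace (TotalSpace ℝ I)]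
  [∀ x, NormedAddCommGroup (I x)] [∀ x, InnerProductSpace ℝ (I x)]
  [FiberBundle ℝ I] [VectorBundle ℝ ℝ I] [IsContinuousRiemannianBundle ℝ I]
  [∀ x, InnerProductSpace 𝕜 (V x)] [∀ x, IsScalarTower ℝ 𝕜 (V x)] [SmoothScalars 𝕜 F V]
  [IsContMDiffRiemannianBundle (𝓡 3) ∞ F V]
  [FiniteDimensional ℝ F] [ContMDiffVectorBundle ∞ F V (𝓡 3)]

variable (𝕜 F V I) in
/-- There are test sections with support in any given nonempty open set. -/
lemma exists_testSection_apply_ne_zero [Nontrivial F] {O : Set S3} (hO : IsOpen O) {x : U}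
    (hx : (x : S3) ∈ O) : ∃ s : testSections 𝕜 F V I, (∀ y : U, (y : S3) ∉ O → s.1 y = 0) ∧
      s.1 x ≠ 0 := by
  set u := frame I x with hu
  have hux : IsUnitFrameAt u x := isUnitFrameAt_frame x
  obtain ⟨f, -, hf⟩ := (SmoothBumpFunction.nhds_basis_tsupport (I := 𝓡 3) (x : S3)).mem_iff.1
    (Filter.inter_mem (hO.mem_nhds hx) (eventually_of_coe hux.eventually))
  have hV : Nontrivial (V x) :=
    ((trivializationAt F V x).continuousLinearEquivAt ℝ (x : S3)
      (FiberBundle.mem_baseSet_trivializationAt' (x : S3))).toLinearEquiv.toEquiv.nontrivial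
  obtain ⟨w, hw⟩ := exists_ne (0 : V x)
  obtain ⟨n, σ, C, hC, hσ, hσC⟩ := exists_spanning_sections F V
  obtain ⟨j, hj⟩ : ∃ j, σ j x ≠ 0 := by
    by_contra! h
    refine hw (norm_le_zero_iff.1 ((hσC x w).trans ?_))
    simp [h]
  have hzero : ∀ y : U, (y : S3) ∉ tsupport f → f y = 0 := fun y hy =>
    image_eq_zero_of_notMem_tsupport hy
  -- A local unit frame tensored with a section of `V` not vanishing at `x`, cut off inside both `O`
  -- and the domain of the frame.
  refine ⟨⟨fun y => (f y • σ j y) ⊗ₜ[ℝ] u y, fun z v hv => ?_, ((↑) ⁻¹' tsupport f : Set U), ?_,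
    fun y hy => ?_⟩, fun y hy => ?_, fun h => ?_⟩
  · by_cases hz : (z : S3) ∈ tsupport f
    · obtain ⟨-, hzU, hzu⟩ := hf hz
      obtain ⟨c, -, hc⟩ := IsUnitFrameAt.exists_sign hzu hv
      have h1 : ContMDiffAt (𝓡 3) ((𝓡 3).prod 𝓘(ℝ, F)) ∞
          (fun y : S3 => TotalSpace.mk' F y (c • (f y • σ j y))) (z : S3) :=
        ((f.contMDiff z).smul_section (hσ j z)).const_smul_section (a := c)
      refine h1.congr_of_eventuallyEq ?_
      filter_upwards [eventually_of_coe (hc.and (show ∀ᶠ y in _, _ from hzu))]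
        with y hy
      obtain ⟨hyU, hy1, hy2⟩ := hy
      simp [localRep, hyU, hy1, inner_smul_left, hy2.1]
    · refine (contMDiff_zeroSection ℝ V (z : S3)).congr_of_eventuallyEq ?_
      filter_upwards [(isClosed_tsupport f).isOpen_compl.mem_nhds hz] with y hy
      have h1 : f y = 0 := image_eq_zero_of_notMem_tsupport hy
      by_cases h : y ∈ U <;> simp [localRep, h, h1, zeroSection]
  · refine U.2.isOpenEmbedding_subtypeVal.isInducing.isCompact_preimage'
      (isClosed_tsupport f).isCompact fun y hy => ?_
    obtain ⟨-, hyU, -⟩ := hf hy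
    exact ⟨⟨y, hyU⟩, rfl⟩
  · simp [hzero y hy]
  · simp [hzero y fun h => hy (hf h).1]
  · have h1 := congrArg (contract (u x)) h
    simp [hux.norm_eq, hj] at h1

/-- The squared norm extends by zero to a continuous function, and surface measure charges open
sets; a vanishing integral would make it zero everywhere. -/
lemma innerL_self_ne_zero {s : testSections 𝕜 F V I} {x : U} (hx : s.1 x ≠ 0) :
    innerL 𝕜 F s s ≠ 0 := by
  intro h
  obtain ⟨hs, K, hK, hsK⟩ := s.2
  have h2 : ‖toL s‖ = 0 := by
    rw [← inner_toL, inner_self_eq_zero] at h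
    rw [h, norm_zero]
  have h3 := ofReal_norm_toL_sq s
  rw [h2, zero_pow two_ne_zero, ENNReal.ofReal_zero, eq_comm] at h3
  have hc : Continuous (normSq s.1) := by
    refine continuous_extendZero hK (fun y hy => by simp [hsK y hy]) ?_
    refine (RCLike.continuous_re.comp (continuous_fiberInner 𝕜 F hs hs)).congr fun y => ?_
    exact inner_self_eq_norm_sq _
  have h4 := (lintegral_eq_zero_iff (ENNReal.continuous_ofReal.comp hc).measurable).1 h3
  have h5 := (Continuous.ae_eq_iff_eq surfaceMeasure (ENNReal.continuous_ofReal.comp hc)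
    continuous_const).1 h4
  have h6 : ENNReal.ofReal (normSq s.1 x) = 0 := congrFun h5 x
  rw [ENNReal.ofReal_eq_zero, normSq, extendZero_coe] at h6
  have h7 : contract (frame I x x) (s.1 x) = 0 :=
    norm_eq_zero.1 (pow_eq_zero_iff two_ne_zero |>.1 (le_antisymm h6 (sq_nonneg _)))
  apply hx
  rw [← contract_tmul_self x (isUnitFrameAt_frame x).norm_eq (s.1 x), h7, TensorProduct.zero_tmul]

/-- The space of invariant elements of `𝕃` for a finite group has infinite dimension. -/
lemma not_finiteDimensional_invariants [Nontrivial F] {G : Subgroup (E4 ≃ₗᵢ[ℝ] E4)} [Finite G]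
    {hG : Preserves G U} (δ : IsometricLift 𝕜 F V I G hG) (hU : (U : Set S3).Nonempty) :
    ¬ FiniteDimensional 𝕜 δ.invariants := by
  have := Fintype.ofFinite G
  obtain ⟨W, hWU, hW, hne, hGW⟩ := exists_isOpen_forall_rotate_notMem (G := G) U.2 hU
  obtain ⟨O, hO, hOne, hOW, hdis⟩ := exists_seq_isOpen_pairwise_disjoint hW hne
  choose x hx using hOne
  choose s hs hsx using fun n => exists_testSection_apply_ne_zero 𝕜 F V I (hO n)
    (x := ⟨x n, hWU (hOW n (hx n))⟩) (hx n)
  -- Averages over the group of sections supported in disjoint open subsets of `W`.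
  let t : ℕ → testSections 𝕜 F V I := fun n => ∑ g, δ.onTest g (s n)
  have ht : ∀ n, toL (t n) ∈ δ.invariants := fun n => by
    refine δ.mem_invariants.2 fun g => ?_
    rw [δ.onL_toL, map_sum]
    simp only [δ.onTest_onTest]
    congr 1
    exact Fintype.sum_equiv (Equiv.mulRight g) _ _ fun h => rfl
  -- Distinct `O n` are disjoint, and nontrivial elements move `W` off itself, so all these supports
  -- are disjoint. Hence pairing a linear relation with `s m` isolates its `m`-th coefficient.
  have hzero : ∀ m n (g : G), g ≠ 1 ∨ m ≠ n → innerL 𝕜 F (s m) (δ.onTest g (s n)) = 0 := by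
    intro m n g hg
    refine (integral_congr_ae (Filter.Eventually.of_forall fun y => ?_)).trans (integral_zero _ _)
    by_cases hy : (y : S3) ∈ O m
    · have h1 : (δ.onTest g (s n)).1 y = 0 := by
        by_cases hg1 : g = 1
        · rw [hg1, δ.onTest_one]
          exact hs n y (disjoint_left.1 (hdis m n (hg.resolve_left (not_not.2 hg1))) hy)
        · change δ.δ g y ((s n).1 (act hG g y)) = 0
          rw [hs n (act hG g y) fun h => hGW g hg1 _ (hOW m hy) (hOW n h), map_zero]
      simp [fiberInner, h1]
    · simp [fiberInner, hs m y hy]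
  have hsum : ∀ m n, inner 𝕜 (toL (s m)) (toL (t n))
      = ∑ g, innerL 𝕜 F (s m) (δ.onTest g (s n)) := fun m n => by
    have h1 : toL (t n) = ∑ g, toL (δ.onTest g (s n)) :=
      map_sum (UniformSpace.Completion.toComplL (𝕜 := 𝕜) (E := PreL 𝕜 F V I)) _ _
    rw [h1, inner_sum]
    simp only [inner_toL]
  intro hfin
  have hli : LinearIndependent 𝕜 fun n => (⟨toL (t n), ht n⟩ : δ.invariants) := by
    refine linearIndependent_iff'.2 fun T a ha m hm => ?_
    have h1 := congrArg (fun v : δ.invariants => inner 𝕜 (toL (s m)) (v : LSpace 𝕜 F V I)) ha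
    simp only [Submodule.coe_sum, Submodule.coe_smul, inner_sum, inner_smul_right, hsum,
      Submodule.coe_zero, inner_zero_right] at h1
    rw [Finset.sum_eq_single_of_mem m hm fun n _ hn => by
      rw [Finset.sum_eq_zero fun g _ => hzero m n g (Or.inr hn.symm), mul_zero],
      Finset.sum_eq_single_of_mem 1 (Finset.mem_univ _) fun g _ hg => hzero m m g (Or.inl hg),
      δ.onTest_one] at h1
    exact (mul_eq_zero.1 h1).resolve_right (innerL_self_ne_zero (hsx m))
  exact not_finite_iff_infinite.2 inferInstance hli.finite

end Invariants

end TwistedSphere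

end

/-! ### Assembly of the theorem -/

open TwistedSphere
theorem lemma5p2 {𝕜 : Type*} [RCLike 𝕜]
    (Γ : EmbeddedGraph) (hΓ : Γ.IsAdmissible)
    {I : Γ.compl → Type*} [TopologicalSpace (TotalSpace ℝ I)]
    [∀ x, NormedAddCommGroup (I x)] [∀ x, InnerProductSpace ℝ (I x)]
    [FiberBundle ℝ I] [VectorBundle ℝ ℝ I] [IsContinuousRiemannianBundle ℝ I]
    (hI : ∀ c, Γ.IsLinkingCircle c → IsMoebius I c)
    {F : Type*} [NormedAddCommGroup F] [NormedSpace ℝ F] [FiniteDimensional ℝ F] [Nontrivial F]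
    {V : S3 → Type*} [TopologicalSpace (TotalSpace F V)]
    [∀ x, NormedAddCommGroup (V x)] [∀ x, InnerProductSpace ℝ (V x)]
    [∀ x, InnerProductSpace 𝕜 (V x)] [∀ x, IsScalarTower ℝ 𝕜 (V x)]
    [FiberBundle F V] [VectorBundle ℝ F V] [ContMDiffVectorBundle ∞ F V (𝓡 3)]
    [IsContMDiffRiemannianBundle (𝓡 3) ∞ F V] [SmoothScalars 𝕜 F V]
    (cov : CovariantDerivative (𝓡 3) F V) [MetricConnection 𝕜 F V cov]
    (R : SymmetricEndomorphism 𝕜 F V)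
    (G : Subgroup (E4 ≃ₗᵢ[ℝ] E4)) [Finite G]
    (hdet : ∀ g ∈ G,
      LinearMap.det (g.toLinearEquiv : E4 →ₗ[ℝ] E4) = 1)
    (hG : ∀ g ∈ G, rotate g '' Γ.carrier = Γ.carrier)
    (δ : IsometricLift 𝕜 F V I G (Γ.preserves_compl hG))
    (hδ : IsEquivariant cov R δ) :
    ∃ ι : HSpace 𝕜 F I cov →L[𝕜] LSpace 𝕜 F V I,
      (∀ s : testSections 𝕜 F V I,
        ι (toH cov s) = toL s) ∧
      ∃ S : Set (HSpace 𝕜 F I cov),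
        S.Countable ∧ S.Infinite ∧
        (∀ ψ ∈ S, IsEigensection R ι ψ ∧ ∀ g : G, δ.onL g (ι ψ) = ι ψ) ∧
        Orthonormal 𝕜 (fun ψ : S => ι ψ) ∧
        (Submodule.span 𝕜 (ι '' S)).topologicalClosure = δ.invariants := by
  have hpos := hΓ.pos_numEdges
  obtain ⟨C, -, hC⟩ := exists_norm_toL_le (I := I) 𝕜 cov hpos hI
  have h : ∃ C : ℝ, ∀ s : testSections 𝕜 F V I, ‖toL s‖ ≤ C * ‖toH cov s‖ := ⟨C, hC⟩
  refine ⟨embed cov h, embed_toH h, ?_⟩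
  -- A linking circle lies in the complement.
  have hU : (Γ.compl : Set S3).Nonempty := by
    obtain ⟨B, x, hx⟩ := exists_eventually_isLinkingCircle hpos one_pos
    obtain ⟨-, c, -⟩ := hx.self_of_nhds
    exact ⟨c 1, (c 1).2⟩
  -- The shift is the operator norm of `R` on `𝕃`, the least evident constant that makes the shifted
  -- zeroth order form nonnegative.
  obtain ⟨S, hS, hS', hSE, hSo, hSs⟩ := exists_weak_eigenvectors (embed cov h)
    (isCompactOperator_embed h) (denseRange_embed h) R.onL R.inner_onL
    ‖(R.onL : LSpace 𝕜 F V I →L[𝕜] LSpace 𝕜 F V I)‖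
    (fun x => by linarith [(abs_le.1 (abs_re_inner_onL_le R x)).1]) δ.invariants
    (isClosed_invariants δ) (fun u x hx hu => hδ.embed_mem_invariants h le_rfl hx hu)
    (not_finiteDimensional_invariants δ hU)
  exact ⟨S, hS, hS', fun ψ hψ => ⟨⟨(hSE ψ hψ).1, (hSE ψ hψ).2.1⟩,
    δ.mem_invariants.1 (hSE ψ hψ).2.2⟩, hSo, hSs⟩
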